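/- Let $N\ge 4$ be even and let $\alpha,\beta\in\mathbb R$. On the phase space $\mathbb R^{2N}$ with coordinates $(q_n,p_n)_{1\le n\le N}$ (indices mod $N$) and symplectic form $\sum_n dq_n\wedge dp_n$, consider FPU Hamiltonians $$H_V=\tfrac12\sum_{n=1}^N p_n^2+\sum_{n=1}^N V(q_{n+1}-q_n),$$ where $V:\mathbb R\to\mathbb R$ is smooth with $V(x)=\frac{x^2}{2}+\frac{\alpha}{3!}x^3+\frac{\beta}{4!}x^4+O(x^5)$ at $0$. Put $Q=\frac1N\sum_n q_n$ and $P=\frac1N\sum_n p_n$. Then there are functions $(x_k,y_k)_{1\le k\le N-1}$, depending only on $N,\alpha,\beta$ (not otherwise on $V$), defined on an open neighbourhood of the set of all points $q=(Q,\dots,Q)$, $p=(P,\dots,P)$ and vanishing at these points, such that $(Q,NP,(x_k,y_k)_{1\le k\le N-1})$ are real analytic canonical coordinates on this neighbourhood, i.e. they form a real analytic diffeomorphism onto an open subset of $\mathbb R^{2N}$ with real analytic inverse and $\sum_n dq_n\wedge dp_n=dQ\wedge d(NP)+\sum_k dx_k\wedge dy_k$; and such that for every such $V$ the Hamiltonian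 $H_V$, expressed in these coordinates, takes the form $$\frac{NP^2}{2}+H_{\alpha,\beta}(I)-R_{\alpha,\beta}(J,M)+O(|(x,y)|^5)\qquad ((x,y)\to0),$$ uniformly in $Q,P\in\mathbb R$. Here, for $1\le k\le N-1$, $$I_k=\tfrac12(x_k^2+y_k^2),\quad J_k=\tfrac12(x_kx_{N-k}+y_ky_{N-k}),\quad M_k=\tfrac12(x_ky_{N-k}-x_{N-k}y_k),$$ $$H_{\alpha,\beta}(I)=2\sum_{k=1}^{N-1}\sin\tfrac{k\pi}{N}\,I_k+\frac1{4N}\sum_{k=1}^{N-1}\Big(\alpha^2+(\beta-\alpha^2)\sin^2\tfrac{k\pi}{N}\Big)I_k^2+\frac{\beta-\alpha^2}{2N}\sum_{\substack{1\le l,m\le N-1\\ l\ne m}}\sin\tfrac{l\pi}{N}\sin\tfrac{m\pi}{N}\,I_lI_m,$$ $$R_{\alpha,\beta}(J,M)=\frac{\beta-\alpha^2}{4N}\Big(4\sum_{1\le k<N/4}\sin\tfrac{2k\pi}{N}\,\big(J_kJ_{N/2-k}-M_kM_{N/2-k}\big)+R_{N/4}(J,M)\Big),$$ with $R_{N/4}(J,M)=J_{N/4}^2-M_{N/4}^2$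 if $4\mid N$ and $R_{N/4}(J,M)=0$ otherwise. -/

import Mathlib

open scoped ContDiff

namespace FPU

noncomputable section

/-- The linear phase space of points `(position, momentum)` with degrees of freedom indexed
by `ι`. -/
abbrev PhaseSpace (ι : Type) : Type := (ι → ℝ) × (ι → ℝ)

/-- The standard symplectic form `∑ dq_i ∧ dp_i` on `PhaseSpace ι`. -/
def symp {ι : Type} [Fintype ι] (a b : PhaseSpace ι) : ℝ :=
  ∑ i, (a.1 i * b.2 i - a.2 i * b.1 i)

/-- The index set `{1, …, N - 1}` of the coordinates `(x_k, y_k)`. -/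
abbrev Mode (N : ℕ) : Type := ↥(Finset.Icc 1 (N - 1))

/-- Centre of mass and total momentum `(Q, N P)`, together with `(x_k, y_k)`, `1 ≤ k ≤ N - 1`. -/
abbrev CoordSpace (N : ℕ) : Type := (ℝ × ℝ) × PhaseSpace (Mode N)

/-- The standard symplectic form `dQ ∧ d(NP) + ∑ dx_k ∧ dy_k` on `CoordSpace N`. -/
def coordSymp (N : ℕ) (a b : CoordSpace N) : ℝ :=
  (a.1.1 * b.1.2 - a.1.2 * b.1.1) + symp a.2 b.2

/-- The FPU Hamiltonian `½ ∑ p_n² + ∑ V (q_{n+1} - q_n)` of `N` particles with periodic boundary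
conditions (the particles are indexed cyclically). -/
def hamiltonian (N : ℕ) [NeZero N] (V : ℝ → ℝ) (z : PhaseSpace (ZMod N)) : ℝ :=
  (1 / 2) * ∑ n, z.2 n ^ 2 + ∑ n, V (z.1 (n + 1) - z.1 n)

/-- The centre of mass `Q = (1/N) ∑ q_n`. -/
def centerOfMass (N : ℕ) [NeZero N] (z : PhaseSpace (ZMod N)) : ℝ := (1 / (N : ℝ)) * ∑ n, z.1 n

/-- The mean momentum `P = (1/N) ∑ p_n`. -/
def meanMomentum (N : ℕ) [NeZero N] (z : PhaseSpace (ZMod N)) : ℝ := (1 / (N : ℝ)) * ∑ n, z.2 n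

/-- `V` is a smooth potential with `V(x) = x²/2 + α x³/3! + β x⁴/4! + …` at `0`. -/
structure IsPotential (α β : ℝ) (V : ℝ → ℝ) : Prop where
  smooth : ContDiff ℝ ∞ V
  zero : V 0 = 0
  first : iteratedDeriv 1 V 0 = 0
  second : iteratedDeriv 2 V 0 = 1
  third : iteratedDeriv 3 V 0 = α
  fourth : iteratedDeriv 4 V 0 = β

/-- `Φ` is a real analytic canonical coordinate system `(q, p) ↦ ((Q, N P), (x, y))` defined on an
open neighbourhood of all the points `q = (Q, …, Q)`, `p = (P, …, P)`, which are the points of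
the phase space that correspond to the equilibrium of the chain relative to its centre of mass,
and these points have `(x, y) = 0`. -/
structure IsCanonicalChart (N : ℕ) [NeZero N]
    (Φ : OpenPartialHomeomorph (PhaseSpace (ZMod N)) (CoordSpace N)) : Prop where
  analytic : ContDiffOn ℝ ω Φ Φ.source
  analytic_symm : ContDiffOn ℝ ω Φ.symm Φ.target
  symplectic : ∀ z ∈ Φ.source, ∀ a b : PhaseSpace (ZMod N),
    coordSymp N (fderiv ℝ Φ z a) (fderiv ℝ Φ z b) = symp a b
  center : ∀ z ∈ Φ.source, (Φ z).1 = (centerOfMass N z, N * meanMomentum N z)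
  equilibrium : ∀ Q P : ℝ,
    ((fun _ => Q, fun _ => P) : PhaseSpace (ZMod N)) ∈ Φ.source ∧
      (Φ (fun _ => Q, fun _ => P)).2 = 0

/-- The `k`-th component of a vector indexed by `1 ≤ k ≤ N - 1` (and `0` for other `k`). -/
def comp {N : ℕ} (x : Mode N → ℝ) (k : ℕ) : ℝ :=
  if h : k ∈ Finset.Icc 1 (N - 1) then x ⟨k, h⟩ else 0

/-- `I_k = (x_k² + y_k²) / 2`. -/
def actionI {N : ℕ} (w : PhaseSpace (Mode N)) (k : ℕ) : ℝ :=
  (1 / 2) * (comp w.1 k ^ 2 + comp w.2 k ^ 2)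

/-- `J_k = (x_k x_{N-k} + y_k y_{N-k}) / 2`. -/
def actionJ {N : ℕ} (w : PhaseSpace (Mode N)) (k : ℕ) : ℝ :=
  (1 / 2) * (comp w.1 k * comp w.1 (N - k) + comp w.2 k * comp w.2 (N - k))

/-- `M_k = (x_k y_{N-k} - x_{N-k} y_k) / 2`. -/
def actionM {N : ℕ} (w : PhaseSpace (Mode N)) (k : ℕ) : ℝ :=
  (1 / 2) * (comp w.1 k * comp w.2 (N - k) - comp w.1 (N - k) * comp w.2 k)

/-- `s_k = sin (k π / N)`. -/
def sinMode (N k : ℕ) : ℝ := Real.sin (k * Real.pi / N)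

/-- `c_k = α² + (β - α²) sin² (k π / N)`. -/
def coeff (N : ℕ) (α β : ℝ) (k : ℕ) : ℝ := α ^ 2 + (β - α ^ 2) * sinMode N k ^ 2

/-- The function `H_{α,β}(I)`. -/
def normalForm (N : ℕ) (α β : ℝ) (I : ℕ → ℝ) : ℝ :=
  2 * ∑ k ∈ Finset.Icc 1 (N - 1), sinMode N k * I k
    + 1 / (4 * (N : ℝ)) * ∑ k ∈ Finset.Icc 1 (N - 1), coeff N α β k * I k ^ 2
    + (β - α ^ 2) / (2 * (N : ℝ)) *
      ∑ l ∈ Finset.Icc 1 (N - 1), ∑ m ∈ Finset.Icc 1 (N - 1) with l ≠ m,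
        sinMode N l * sinMode N m * I l * I m

/-- The function `R(J, M)`, a sum over `1 ≤ k < N / 4`. -/
def resonantSum (N : ℕ) (J M : ℕ → ℝ) : ℝ :=
  4 * ∑ k ∈ Finset.Icc 1 (N - 1) with 4 * k < N,
    Real.sin (2 * k * Real.pi / N) * (J k * J (N / 2 - k) - M k * M (N / 2 - k))

/-- The function `R_{N/4}(J, M)`. -/
def resonantQuarter (N : ℕ) (J M : ℕ → ℝ) : ℝ :=
  if 4 ∣ N then J (N / 4) ^ 2 - M (N / 4) ^ 2 else 0

/-- The function `R_{α,β}(J, M)`. -/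
def resonantTerm (N : ℕ) (α β : ℝ) (J M : ℕ → ℝ) : ℝ :=
  (β - α ^ 2) / (4 * (N : ℝ)) * (resonantSum N J M + resonantQuarter N J M)

end

end FPU

/-! Label the normal modes by `j` in `ZMod (2 * N)`, with complex amplitudes satisfying `z (-j) =
conj (z j)` and signed frequency `2 sin (π j / N)`; the sign of the frequency tells an amplitude
from its conjugate. The cubic and quartic parts of the Hamiltonian are supported on tuples of modes
whose index sum is `0` or `N`, the two cases carrying opposite signs (`wind`). In this labelling the
theorem is a Birkhoff normal form of order four: a monomial can be removed unless its frequency sum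
vanishes.

No cubic monomial is resonant, because the frequency sum of three modes factors
(`sine_add_three_ne_zero`). For four modes with index sum `0` it factors too, and only pairs of
opposite modes resonate; they produce the polynomial in the actions. For index sum `N` the
arithmetic of roots of unity is needed: Galois conjugation and reduction modulo a prime above `2`
show that the sines still cancel in pairs (`sin_pair_of_sum_sin_eq_zero`). The surviving pairs are
`a, a + N`, and they produce the terms in `J` and `M`.

The coordinate change is a composition of shears, the explicit polynomial flows generated by powers
of real linear forms. By polarization these powers span all real cubic and quartic forms, and the
commutator terms created by composing cubic shears are quartic, so they can be absorbed in the
quartic generator (`realizes_of_realSpan`). Hence the chart is global and polynomial up to a linear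
map, and only its effect modulo degree five matters.

Removing the cubic terms changes the quartic coefficients by the second order term `kappa`. Summed
over the three pairings of a resonant quadruple this contributes `-1`, plus `1 / sin²` when a mode
is paired with itself in two ways (`exchange_sum`). Therefore `β` and `α²` occur only as `β - α²`,
apart from the extra `α²` in front of the squared actions (`aeval_normalForm`). A Taylor estimate
takes care of the rest of `V`. -/

namespace FPU

/-! ### Vanishing sums of four sines of rational angles. -/

section NumberTheory
open Polynomial

/-- The integer polynomial whose value at `exp (π i / N)` is `2 i ∑ sin (j π / N)`. -/
noncomputable def sineSumPoly (N : ℕ) (j : Fin 4 → ℕ) : ℤ[X] :=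
  ∑ i, (X ^ (j i) + X ^ (N + (2 * N - 1) * j i))

/-- The exponent `N + (2 * N - 1) * j` stands for `N - j` modulo `2 * N`. With natural exponents the
same integer polynomial can be evaluated at a complex root of unity, where `μ ^ N = -1` produces
sines, and in characteristic two. -/
theorem aeval_sineSumPoly {R : Type*} [Field R] {N : ℕ} (hN : 0 < N) (j : Fin 4 → ℕ)
    (μ : R) (h : μ ^ (2 * N) = 1) :
    aeval μ (sineSumPoly N j) = ∑ i, (μ ^ (j i) + μ ^ N * (μ ^ (j i))⁻¹) := by
  have hμ : μ ≠ 0 := by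
    rintro rfl
    rw [zero_pow (by omega)] at h
    exact zero_ne_one h
  simp only [sineSumPoly, map_sum, map_add, map_pow, aeval_X]
  refine Finset.sum_congr rfl fun i _ => ?_
  rw [pow_add]
  congr 2
  refine eq_inv_of_mul_eq_one_left ?_
  rw [← pow_add, show (2 * N - 1) * j i + j i = (2 * N) * j i by
      rw [Nat.sub_mul, one_mul, Nat.sub_add_cancel]
      exact Nat.le_mul_of_pos_left _ (by omega),
    pow_mul, h, one_pow]

theorem isPrimitiveRoot_exp_pi {N : ℕ} (hN : 0 < N) :
    IsPrimitiveRoot (Complex.exp (Real.pi / N * Complex.I)) (2 * N) := by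
  have h := Complex.isPrimitiveRoot_exp (2 * N) (by omega)
  convert h using 2
  push_cast
  have : (N : ℂ) ≠ 0 := by exact_mod_cast hN.ne'
  field_simp

theorem aeval_sineSumPoly_exp {N : ℕ} (hN : 0 < N) (j : Fin 4 → ℕ) {k : ℕ} (hk : Odd k) :
    aeval (Complex.exp (Real.pi / N * Complex.I) ^ k) (sineSumPoly N j)
      = 2 * Complex.I * ((∑ i, Real.sin (k * j i * Real.pi / N) : ℝ) : ℂ) := by
  have hN' : (N : ℂ) ≠ 0 := by exact_mod_cast hN.ne'
  have hp := isPrimitiveRoot_exp_pi hN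
  have hroot : (Complex.exp (Real.pi / N * Complex.I) ^ k) ^ (2 * N) = 1 := by
    rw [← pow_mul, mul_comm k, pow_mul, hp.pow_eq_one, one_pow]
  rw [aeval_sineSumPoly hN j _ hroot]
  have hneg : (Complex.exp (Real.pi / N * Complex.I) ^ k) ^ N = -1 := by
    rw [← pow_mul, mul_comm k, pow_mul, ← Complex.exp_nat_mul]
    rw [show (N : ℂ) * (Real.pi / N * Complex.I) = Real.pi * Complex.I by field_simp,
      Complex.exp_pi_mul_I, hk.neg_one_pow]
  rw [hneg]
  push_cast
  rw [Finset.mul_sum]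
  refine Finset.sum_congr rfl fun i _ => ?_
  rw [← pow_mul, ← Complex.exp_nat_mul, ← Complex.exp_neg, Complex.sin]
  rw [show ((k * j i : ℕ) : ℂ) * (Real.pi / N * Complex.I)
    = (k * j i * Real.pi / N) * Complex.I by push_cast; ring]
  rw [show -((k : ℂ) * j i * Real.pi / N) * Complex.I
    = -((k * j i * Real.pi / N) * Complex.I) by ring]
  linear_combination (-1 : ℂ) * (Complex.exp (-((k * j i * Real.pi / N) * Complex.I))
    - Complex.exp ((k * j i * Real.pi / N) * Complex.I)) * Complex.I_sq

/-- Galois conjugation of a vanishing sum of sines. -/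
theorem sum_sin_coprime_mul_eq_zero {N : ℕ} (hN : 0 < N) (j : Fin 4 → ℕ) {k : ℕ}
    (hk : Nat.Coprime k (2 * N)) (h : ∑ i, Real.sin (j i * Real.pi / N) = 0) :
    ∑ i, Real.sin (k * j i * Real.pi / N) = 0 := by
  have hp := isPrimitiveRoot_exp_pi hN
  have hodd : Odd k := by
    have := (Nat.Coprime.coprime_mul_right_right hk)
    exact (Nat.coprime_two_right).1 this
  have h1 := aeval_sineSumPoly_exp hN j (k := 1) odd_one
  simp only [Nat.cast_one, one_mul, pow_one, h, Complex.ofReal_zero, mul_zero] at h1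
  have h2 := minpoly.isIntegrallyClosed_dvd (hp.isIntegral (by omega)) h1
  rw [hp.minpoly_eq_pow_coprime hk] at h2
  obtain ⟨q, hq⟩ := h2
  have h3 : aeval (Complex.exp (Real.pi / N * Complex.I) ^ k) (sineSumPoly N j) = 0 := by
    rw [hq, map_mul, minpoly.aeval, zero_mul]
  rw [aeval_sineSumPoly_exp hN j hodd] at h3
  simpa [-Complex.ofReal_sum] using h3

/-- After substituting `d = (a * b * c)⁻¹`, the sum is `(a b - 1) (a c - 1) (b c - 1) / (a b c)` in
characteristic two, where signs do not matter; `b c = 1` amounts to `a d = 1`. -/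
theorem charTwo_factor {F : Type*} [Field F] [CharP F 2] {a b c d : F} (ha : a ≠ 0) (hb : b ≠ 0)
    (hc : c ≠ 0) (hprod : a * b * c * d = 1)
    (hsum : a + a⁻¹ + (b + b⁻¹) + (c + c⁻¹) + (d + d⁻¹) = 0) :
    a * b = 1 ∨ a * c = 1 ∨ a * d = 1 := by
  have h2 : (2 : F) = 0 := CharTwo.two_eq_zero
  have hd' : d = (a * b * c)⁻¹ := by
    refine eq_inv_of_mul_eq_one_left ?_
    linear_combination hprod
  have key : (a * b - 1) * (a * c - 1) * (b * c - 1) = 0 := by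
    rw [hd'] at hsum
    field_simp at hsum
    linear_combination hsum - h2 * (a * b * c * a + a * b * c * b + a * b * c * c + 1)
  rcases mul_eq_zero.1 key with h | h
  · rcases mul_eq_zero.1 h with h | h
    · exact Or.inl (sub_eq_zero.1 h)
    · exact Or.inr (Or.inl (sub_eq_zero.1 h))
  · refine Or.inr (Or.inr ?_)
    have := sub_eq_zero.1 h
    linear_combination hprod - a * d * this

/-- Since `2 * N = 2 ^ (s + 1) * m`, the cyclotomic polynomial of order `2 * N` vanishes in
characteristic two at a primitive `m`-th root of unity `η`. There `η ^ N = 1`, so the relation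
becomes the one of `charTwo_factor`. -/
theorem dvd_add_of_aeval_sineSumPoly {F : Type*} [Field F] [CharP F 2] {N s m : ℕ} (hN : 0 < N)
    [NeZero (m : F)] (hNm : N = 2 ^ s * m) (j : Fin 4 → ℕ) (hsum : m ∣ ∑ i, j i)
    (h : cyclotomic (2 * N) ℤ ∣ sineSumPoly N j) {η : F} (hη : IsPrimitiveRoot η m) :
    (m ∣ j 0 + j 1) ∨ (m ∣ j 0 + j 2) ∨ (m ∣ j 0 + j 3) := by
  obtain ⟨q, hq⟩ := h
  have hroot : IsRoot (cyclotomic (2 ^ (s + 1) * m) F) η :=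
    (isRoot_cyclotomic_prime_pow_mul_iff_of_charP).2 hη
  have h3 : aeval η (sineSumPoly N j) = 0 := by
    rw [hq, map_mul, show 2 * N = 2 ^ (s + 1) * m by rw [hNm]; ring]
    rw [aeval_def, eval₂_eq_eval_map, map_cyclotomic, hroot.eq_zero, zero_mul]
  have hηN : η ^ N = 1 := by
    rw [hNm, mul_comm, pow_mul, hη.pow_eq_one, one_pow]
  rw [aeval_sineSumPoly hN j η (by rw [mul_comm, pow_mul, hηN, one_pow]), hηN] at h3
  simp only [one_mul, Fin.sum_univ_four] at h3 hsum
  have hη0 : η ≠ 0 := hη.ne_zero (by rintro rfl; simp at hNm; omega)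
  have hprod : η ^ j 0 * η ^ j 1 * η ^ j 2 * η ^ j 3 = 1 := by
    rw [← pow_add, ← pow_add, ← pow_add]
    exact (hη.pow_eq_one_iff_dvd _).2 hsum
  have := charTwo_factor (pow_ne_zero _ hη0) (pow_ne_zero _ hη0) (pow_ne_zero _ hη0) hprod h3
  simpa only [← pow_add, hη.pow_eq_one_iff_dvd] using this

/-- Reduction modulo a prime above `2` of a vanishing sum of four sines. -/
theorem dvd_add_of_sum_sin_eq_zero {N s m : ℕ} (hN : 0 < N) (hm : ¬ 2 ∣ m)
    (hNm : N = 2 ^ s * m) (j : Fin 4 → ℕ)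
    (hsum : m ∣ ∑ i, j i) (h : ∑ i, Real.sin (j i * Real.pi / N) = 0) :
    (m ∣ j 0 + j 1) ∨ (m ∣ j 0 + j 2) ∨ (m ∣ j 0 + j 3) := by
  have hp := isPrimitiveRoot_exp_pi hN
  have h1 := aeval_sineSumPoly_exp hN j (k := 1) odd_one
  simp only [Nat.cast_one, one_mul, pow_one, h, Complex.ofReal_zero, mul_zero] at h1
  have h2 := minpoly.isIntegrallyClosed_dvd (hp.isIntegral (by omega)) h1
  rw [← cyclotomic_eq_minpoly hp (by omega)] at h2
  have : NeZero (m : AlgebraicClosure (ZMod 2)) := ⟨by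
    intro h0
    exact hm ((CharP.cast_eq_zero_iff _ 2 m).1 h0)⟩
  obtain ⟨η, hη⟩ := HasEnoughRootsOfUnity.exists_primitiveRoot (AlgebraicClosure (ZMod 2)) m
  exact dvd_add_of_aeval_sineSumPoly hN hNm j hsum h2 hη

/-- Conjugation inverts unit vectors, so the vanishing of the first elementary symmetric function
`e₁` forces `e₃ = 0`; and `(a + b) (a + c) (a + d) = a² e₁ + e₃`. -/
theorem unit_sum_four {a b c d : ℂ} (ha : ‖a‖ = 1) (hb : ‖b‖ = 1) (hc : ‖c‖ = 1) (hd : ‖d‖ = 1)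
    (h : a + b + c + d = 0) : a + b = 0 ∨ a + c = 0 ∨ a + d = 0 := by
  have inv (z : ℂ) (hz : ‖z‖ = 1) : z * starRingEnd ℂ z = 1 := by
    rw [Complex.mul_conj, Complex.normSq_eq_norm_sq, hz]; simp
  have h' := congrArg (starRingEnd ℂ) h
  simp only [map_add, map_zero] at h'
  have hA := inv a ha
  have hB := inv b hb
  have hC := inv c hc
  have hD := inv d hd
  have key : (a + b) * ((a + c) * (a + d)) = 0 := by
    linear_combination a ^ 2 * h + a * b * c * d * h' - b * c * d * hA - a * c * d * hB
      - a * b * d * hC - a * b * c * hD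
  simpa [mul_eq_zero] using key

/-- Two angles whose sum is an even multiple of `π` have opposite sines. Both pair sums cannot be
odd multiples of `π`, because the total would then be `0` and not `N` modulo `2 * N`. So one pair
cancels, and then the other does. -/
theorem sin_add_sin_eq_zero_of_dvd {N a b c d : ℕ} (hN : 0 < N) (hab : N ∣ a + b)
    (hcd : N ∣ c + d) (hsum : a + b + c + d ≡ N [MOD 2 * N])
    (h : Real.sin (a * Real.pi / N) + Real.sin (b * Real.pi / N) + Real.sin (c * Real.pi / N)
      + Real.sin (d * Real.pi / N) = 0) :
    Real.sin (a * Real.pi / N) + Real.sin (b * Real.pi / N) = 0 := by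
  have hN' : (N : ℝ) ≠ 0 := by exact_mod_cast hN.ne'
  have key {x y t : ℕ} (hxy : x + y = N * t) (ht : Even t) :
      Real.sin (x * Real.pi / N) + Real.sin (y * Real.pi / N) = 0 := by
    have hxy' : (x : ℝ) + y = N * t := by exact_mod_cast hxy
    have : (y : ℝ) * Real.pi / N = t * Real.pi - x * Real.pi / N := by
      field_simp
      linear_combination hxy'
    rw [this, Real.sin_nat_mul_pi_sub, ht.neg_one_pow]
    ring
  obtain ⟨t, ht⟩ := hab
  obtain ⟨t', ht'⟩ := hcd
  rcases Nat.even_or_odd t with h0 | h0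
  · exact key ht h0
  · rcases Nat.even_or_odd t' with h1 | h1
    · have := key ht' h1
      linarith
    · exfalso
      obtain ⟨u, rfl⟩ := h0
      obtain ⟨u', rfl⟩ := h1
      have e : a + b + c + d = 0 + (2 * N) * (u + u' + 1) := by
        rw [add_assoc (a + b), ht, ht']
        ring
      rw [e] at hsum
      have : 0 ≡ N [MOD 2 * N] := (Nat.ModEq.symm (by simp [Nat.ModEq])).trans hsum
      have := (Nat.modEq_zero_iff_dvd.1 this.symm)
      have := Nat.le_of_dvd hN this
      omega

/-- If four multiples of `π / N` add up to `π` modulo `2 π` and their sines add up to `0`, then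
the sines cancel in pairs. -/
theorem sin_pair_of_sum_sin_eq_zero (N : ℕ) (hN : 0 < N) (j : Fin 4 → ℕ)
    (hsum : ∑ i, j i ≡ N [MOD 2 * N]) (h : ∑ i, Real.sin (j i * Real.pi / N) = 0) :
    ∃ i, i ≠ 0 ∧ Real.sin (j 0 * Real.pi / N) + Real.sin (j i * Real.pi / N) = 0 := by
  induction N using Nat.strong_induction_on generalizing j with
  | _ N ih =>
  have hN' : (N : ℝ) ≠ 0 := by exact_mod_cast hN.ne'
  have close (H : (N ∣ j 0 + j 1 ∧ N ∣ j 2 + j 3) ∨ (N ∣ j 0 + j 2 ∧ N ∣ j 1 + j 3) ∨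
      (N ∣ j 0 + j 3 ∧ N ∣ j 1 + j 2)) :
      ∃ i, i ≠ 0 ∧ Real.sin (j 0 * Real.pi / N) + Real.sin (j i * Real.pi / N) = 0 := by
    rw [Fin.sum_univ_four] at hsum h
    rcases H with ⟨h1, h2⟩ | ⟨h1, h2⟩ | ⟨h1, h2⟩
    · exact ⟨1, by decide, sin_add_sin_eq_zero_of_dvd hN h1 h2 hsum h⟩
    · refine ⟨2, by decide, sin_add_sin_eq_zero_of_dvd hN h1 h2 ?_ (by linarith)⟩
      rwa [show j 0 + j 2 + j 1 + j 3 = j 0 + j 1 + j 2 + j 3 by ring]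
    · refine ⟨3, by decide, sin_add_sin_eq_zero_of_dvd hN h1 h2 ?_ (by linarith)⟩
      rwa [show j 0 + j 3 + j 1 + j 2 = j 0 + j 1 + j 2 + j 3 by ring]
  have hNsum : N ∣ ∑ i, j i := by
    have := hsum.of_dvd (Dvd.intro_left 2 rfl)
    exact Nat.modEq_zero_iff_dvd.1 (this.trans (Nat.modEq_zero_iff_dvd.2 dvd_rfl))
  by_cases hodd : ¬ 2 ∣ N
  · refine close ?_
    -- For odd `N` the reduction modulo `2` loses nothing: `m = N`.
    have := dvd_add_of_sum_sin_eq_zero (s := 0) hN hodd (by simp) j hNsum h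
    rw [Fin.sum_univ_four] at hNsum
    rcases this with h1 | h1 | h1
    · exact Or.inl ⟨h1, (Nat.dvd_add_right h1).1 (by convert hNsum using 1; ring)⟩
    · exact Or.inr (Or.inl ⟨h1, (Nat.dvd_add_right h1).1 (by convert hNsum using 1; ring)⟩)
    · exact Or.inr (Or.inr ⟨h1, (Nat.dvd_add_right h1).1 (by convert hNsum using 1; ring)⟩)
  rw [not_not] at hodd
  obtain ⟨K, rfl⟩ := hodd
  have hK0 : 0 < K := by omega
  have hK : (K : ℝ) ≠ 0 := by exact_mod_cast hK0.ne'
  have hpar : 2 ∣ ∑ i, j i := dvd_trans (Dvd.intro _ rfl) hNsum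
  rw [Fin.sum_univ_four] at hpar
  by_cases hall : ∀ i, Odd (j i)
  · by_cases hKodd : ¬ 2 ∣ K
    · refine close ?_
      -- Here `K` is odd and reduction only gives divisibility of the pair sums by `K`; sums of two
      -- odd indices are even, which restores divisibility by `2 * K`.
      have hKs : K ∣ ∑ i, j i := dvd_trans (Dvd.intro_left 2 rfl) hNsum
      have := dvd_add_of_sum_sin_eq_zero (s := 1) hN hKodd (by simp) j hKs h
      have hcop : Nat.Coprime 2 K := (Nat.Prime.coprime_iff_not_dvd Nat.prime_two).2 hKodd
      have up {x : ℕ} (i k : Fin 4) (hx : x = j i + j k) (hd : K ∣ x) : 2 * K ∣ j i + j k := by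
        subst hx
        refine hcop.mul_dvd_of_dvd_of_dvd ?_ hd
        exact even_iff_two_dvd.1 ((hall i).add_odd (hall k))
      rw [Fin.sum_univ_four] at hKs
      rcases this with h1 | h1 | h1
      · exact Or.inl ⟨up _ _ rfl h1,
          up _ _ rfl ((Nat.dvd_add_right h1).1 (by convert hKs using 1; ring))⟩
      · exact Or.inr (Or.inl ⟨up _ _ rfl h1,
          up _ _ rfl ((Nat.dvd_add_right h1).1 (by convert hKs using 1; ring))⟩)
      · exact Or.inr (Or.inr ⟨up _ _ rfl h1,
          up _ _ rfl ((Nat.dvd_add_right h1).1 (by convert hKs using 1; ring))⟩)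
    · rw [not_not] at hKodd
      -- Multiplying an odd index by `1 + N / 2` turns its angle by an odd multiple of `π / 2`. The
      -- conjugate relation therefore says that the cosines, with suitable signs, add up to `0` as
      -- well.
      have hcop : Nat.Coprime (1 + K) (2 * (2 * K)) := by
        have h2 : Nat.Coprime (1 + K) 2 := by
          rw [Nat.coprime_two_right]
          exact odd_one.add_even (even_iff_two_dvd.2 hKodd)
        exact h2.mul_right (h2.mul_right (by simp))
      have h1 := sum_sin_coprime_mul_eq_zero hN j hcop h
      -- the unit vectors `exp (i x)` resp. `- exp (- i x)`
      let v (i : Fin 4) : ℂ :=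
        ⟨Real.sin ((1 + K : ℕ) * j i * Real.pi / (2 * K : ℕ)),
          Real.sin (j i * Real.pi / (2 * K : ℕ))⟩
      have hv (i : Fin 4) : ‖v i‖ = 1 := by
        obtain ⟨t, ht⟩ := hall i
        have e : ((1 + K : ℕ) : ℝ) * j i * Real.pi / (2 * K : ℕ)
            = j i * Real.pi / (2 * K : ℕ) + Real.pi / 2 + t * Real.pi := by
          rw [ht]
          push_cast
          field_simp
          ring
        have h2 : ‖v i‖ ^ 2 = 1 := by
          rw [← Complex.normSq_eq_norm_sq, Complex.normSq_mk, e, Real.sin_add_nat_mul_pi,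
            Real.sin_add_pi_div_two]
          have h3 : ((-1 : ℝ) ^ t) * (-1) ^ t = 1 := by
            rw [← mul_pow]; simp
          have := Real.sin_sq_add_cos_sq (j i * Real.pi / (2 * K : ℕ))
          linear_combination this + Real.cos (j i * Real.pi / (2 * K : ℕ)) ^ 2 * h3
        exact (pow_eq_one_iff_of_nonneg (norm_nonneg _) two_ne_zero).1 h2
      have hv4 : v 0 + v 1 + v 2 + v 3 = 0 := by
        rw [Fin.sum_univ_four] at h h1
        apply Complex.ext
        · simpa [v] using h1
        · simpa [v] using h
      rcases unit_sum_four (hv 0) (hv 1) (hv 2) (hv 3) hv4 with h2 | h2 | h2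
      · exact ⟨1, by decide, congrArg Complex.im h2⟩
      · exact ⟨2, by decide, congrArg Complex.im h2⟩
      · exact ⟨3, by decide, congrArg Complex.im h2⟩
  by_cases hev : ∀ i, Even (j i)
  -- Halving all four indices together with `N` does not change the angles, so the induction
  -- hypothesis applies.
  · choose l hl using hev
    have e (i : Fin 4) : (j i : ℝ) * Real.pi / (2 * K : ℕ) = l i * Real.pi / K := by
      rw [hl i]
      push_cast
      field_simp
      ring
    simp only [e] at h ⊢
    refine ih K (by omega) hK0 l ?_ h
    have : 2 * ∑ i, l i ≡ 2 * K [MOD 2 * (2 * K)] := by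
      convert hsum using 1
      simp only [hl, Fin.sum_univ_four]
      ring
    exact Nat.ModEq.mul_left_cancel' (by norm_num) this
  -- Mixed parities: multiplication by `1 + N` changes exactly the signs of the sines with odd
  -- index, so the even and the odd part vanish separately. The index sum is even, so each part has
  -- two members.
  have hcop : Nat.Coprime (1 + 2 * K) (2 * (2 * K)) := by
    have h2 : Nat.Coprime (1 + 2 * K) 2 := by simp
    exact h2.mul_right (h2.mul_right (by simp))
  have h1 := sum_sin_coprime_mul_eq_zero hN j hcop h
  have hs (i : Fin 4) : Real.sin ((1 + 2 * K : ℕ) * j i * Real.pi / (2 * K : ℕ)) =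
      (-1) ^ (j i) * Real.sin (j i * Real.pi / (2 * K : ℕ)) := by
    rw [← Real.sin_add_nat_mul_pi]
    congr 1
    push_cast
    field_simp
  simp only [hs] at h1
  rw [Fin.sum_univ_four] at h h1
  simp only [Fin.forall_fin_succ, Fin.isValue, Fin.succ_zero_eq_one, Fin.succ_one_eq_two,
    IsEmpty.forall_iff, and_true] at hall hev
  rw [← even_iff_two_dvd] at hpar
  have finish (H : Real.sin (j 0 * Real.pi / (2 * K : ℕ)) + Real.sin (j 1 * Real.pi / (2 * K : ℕ)) = 0 ∨
      Real.sin (j 0 * Real.pi / (2 * K : ℕ)) + Real.sin (j 2 * Real.pi / (2 * K : ℕ)) = 0 ∨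
      Real.sin (j 0 * Real.pi / (2 * K : ℕ)) + Real.sin (j 3 * Real.pi / (2 * K : ℕ)) = 0) :
      ∃ i, i ≠ 0 ∧
        Real.sin (j 0 * Real.pi / (2 * K : ℕ)) + Real.sin (j i * Real.pi / (2 * K : ℕ)) = 0 := by
    rcases H with H | H | H
    exacts [⟨1, by decide, H⟩, ⟨2, by decide, H⟩, ⟨3, by decide, H⟩]
  apply finish
  have e32 : (Fin.succ 2 : Fin 4) = 3 := rfl
  rw [e32] at hall hev
  rcases Nat.even_or_odd (j 0) with p0 | p0 <;> rcases Nat.even_or_odd (j 1) with p1 | p1 <;>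
  rcases Nat.even_or_odd (j 2) with p2 | p2 <;> rcases Nat.even_or_odd (j 3) with p3 | p3 <;>
  first
  | (exfalso; exact hall ⟨p0, p1, p2, p3⟩)
  | (exfalso; exact hev ⟨p0, p1, p2, p3⟩)
  | (exfalso
     simp only [Nat.even_add, p0, p1, p2, p3, Nat.not_even_iff_odd.2] at hpar
     simp at hpar; done)
  | (simp only [p0.neg_one_pow, p1.neg_one_pow, p2.neg_one_pow, p3.neg_one_pow] at h1
     first
     | (left; linarith)
     | (right; left; linarith)
     | (right; right; linarith))

end NumberTheory

/-! ### Signed frequencies on `ZMod (2 * N)` and resonances of three and four modes. -/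

section Phase
variable {N : ℕ} [NeZero N]

/-- The root of unity `exp (i π j / N)`. -/
noncomputable def phase (j : ZMod (2 * N)) : ℂ := ZMod.stdAddChar j

/-- `sin (π j / N)`. -/
noncomputable def sine (j : ZMod (2 * N)) : ℝ := (phase j).im

theorem phase_zero : phase (0 : ZMod (2 * N)) = 1 := AddChar.map_zero_eq_one _

theorem phase_add (j l : ZMod (2 * N)) : phase (j + l) = phase j * phase l :=
  AddChar.map_add_eq_mul _ _ _

theorem phase_ne_zero (j : ZMod (2 * N)) : phase j ≠ 0 := by
  intro h
  have := phase_add j (-j)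
  rw [add_neg_cancel, phase_zero, h, zero_mul] at this
  exact one_ne_zero this

theorem phase_neg (j : ZMod (2 * N)) : phase (-j) = (phase j)⁻¹ := by
  refine eq_inv_of_mul_eq_one_left ?_
  rw [← phase_add, neg_add_cancel, phase_zero]

theorem phase_neg_eq_conj (j : ZMod (2 * N)) : phase (-j) = starRingEnd ℂ (phase j) := by
  rw [phase_neg, phase, ZMod.stdAddChar_apply, ← Circle.coe_inv_eq_conj, Circle.coe_inv]

theorem phase_injective : Function.Injective (phase (N := N)) := ZMod.injective_stdAddChar

theorem phase_natCast (k : ℕ) :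
    phase (k : ZMod (2 * N)) = Complex.exp ((k * Real.pi / N : ℝ) * Complex.I) := by
  have h := ZMod.stdAddChar_coe (N := 2 * N) (k : ℤ)
  have hN : (N : ℂ) ≠ 0 := by exact_mod_cast NeZero.ne N
  rw [phase]
  push_cast at h
  rw [h]
  congr 1
  push_cast
  field_simp

theorem sine_natCast (k : ℕ) : sine (k : ZMod (2 * N)) = sinMode N k := by
  rw [sine, phase_natCast, Complex.exp_ofReal_mul_I_im, sinMode]

theorem phase_half : phase (N : ZMod (2 * N)) = -1 := by
  have hN : (N : ℝ) ≠ 0 := by exact_mod_cast NeZero.ne N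
  rw [phase_natCast, mul_div_cancel_left₀ _ hN, Complex.exp_pi_mul_I]

theorem half_add_half : (N : ZMod (2 * N)) + N = 0 := by
  have := ZMod.natCast_self (2 * N)
  push_cast at this
  linear_combination this

theorem neg_half : -(N : ZMod (2 * N)) = N := by
  linear_combination -half_add_half (N := N)

theorem half_ne_zero : (N : ZMod (2 * N)) ≠ 0 := by
  intro h
  have := phase_half (N := N)
  rw [h, phase_zero] at this
  norm_num at this

theorem two_I_sine (j : ZMod (2 * N)) : 2 * Complex.I * (sine j : ℂ) = phase j - phase (-j) := by
  rw [phase_neg_eq_conj, Complex.sub_conj, sine]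
  push_cast
  ring

theorem two_I_sine' (j : ZMod (2 * N)) : 2 * Complex.I * (sine j : ℂ) = phase j - (phase j)⁻¹ := by
  rw [two_I_sine, phase_neg]

theorem two_re_phase (j : ZMod (2 * N)) :
    2 * ((phase j).re : ℂ) = phase j + (phase j)⁻¹ := by
  rw [← phase_neg, phase_neg_eq_conj, Complex.add_conj]
  push_cast
  ring

theorem sine_neg (j : ZMod (2 * N)) : sine (-j) = -sine j := by
  rw [sine, phase_neg_eq_conj, Complex.conj_im, sine]

theorem sine_add_half (j : ZMod (2 * N)) : sine (j + (N : ZMod (2 * N))) = -sine j := by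
  rw [sine, phase_add, phase_half, sine]
  simp

theorem sine_half_sub (j : ZMod (2 * N)) : sine ((N : ZMod (2 * N)) - j) = sine j := by
  rw [sub_eq_neg_add, sine_add_half, sine_neg, neg_neg]

@[simp] theorem sine_zero : sine (0 : ZMod (2 * N)) = 0 := by simp [sine, phase_zero]

@[simp] theorem sine_half : sine (N : ZMod (2 * N)) = 0 := by simp [sine, phase_half]

theorem sine_add_sine_eq_zero {j l : ZMod (2 * N)} (h : sine j + sine l = 0) :
    j + l = 0 ∨ l = j + N := by
  have hj := phase_ne_zero j
  have hl := phase_ne_zero l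
  have h1 : (phase j - (phase j)⁻¹) + (phase l - (phase l)⁻¹) = 0 := by
    rw [← two_I_sine', ← two_I_sine', ← mul_add]
    rw [← Complex.ofReal_add, h]
    simp
  have h2 : (phase j * phase l - 1) * (phase l + phase j) = 0 := by
    field_simp at h1
    linear_combination h1
  rcases mul_eq_zero.1 h2 with h3 | h3
  · left
    apply phase_injective
    rw [phase_add, phase_zero]
    exact sub_eq_zero.1 h3
  · right
    apply phase_injective
    rw [phase_add, phase_half]
    linear_combination h3

theorem sine_eq_zero {j : ZMod (2 * N)} (h : sine j = 0) : j = 0 ∨ j = N := by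
  rcases sine_add_sine_eq_zero (j := 0) (l := j) (by simp [h]) with h | h
  · left; simpa using h
  · right; simpa using h

theorem sine_eq_zero_of_two_mul {j : ZMod (2 * N)} (h : j + j = 0) : sine j = 0 := by
  have := sine_neg j
  rw [← eq_neg_of_add_eq_zero_left h] at this
  linarith

/-- With `x`, `y` the phases of `a`, `b`, the first expression is `-(x - 1) (y - 1) (x y - 1) / (x
y)` up to the factor `2 i`. The second follows by adding `N` to both indices, which flips `sine a`
and `sine b` but fixes `a + b`. -/
theorem sine_triple_ne_zero {a b : ZMod (2 * N)} (ha : sine a ≠ 0) (hb : sine b ≠ 0)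
    (hab : sine (a + b) ≠ 0) :
    sine a + sine b - sine (a + b) ≠ 0 ∧ sine a + sine b + sine (a + b) ≠ 0 := by
  have main {a b : ZMod (2 * N)} (ha : sine a ≠ 0) (hb : sine b ≠ 0)
    (hab : sine (a + b) ≠ 0) : sine a + sine b - sine (a + b) ≠ 0 := by
    intro h
    have hA := phase_ne_zero a
    have hB := phase_ne_zero b
    have h1 : (phase a - (phase a)⁻¹) + (phase b - (phase b)⁻¹)
        - (phase a * phase b - (phase a * phase b)⁻¹) = 0 := by
      rw [← phase_add, ← two_I_sine', ← two_I_sine', ← two_I_sine', ← mul_add, ← mul_sub]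
      rw [← Complex.ofReal_add, ← Complex.ofReal_sub, h]
      simp
    have h2 : (phase a - 1) * ((phase b - 1) * (phase a * phase b - 1)) = 0 := by
      field_simp at h1
      linear_combination -h1
    have key {x : ZMod (2 * N)} (hx : phase x - 1 = 0) : sine x = 0 := by
      rw [sine, sub_eq_zero.1 hx]; simp
    rcases mul_eq_zero.1 h2 with h3 | h3
    · exact ha (key h3)
    · rcases mul_eq_zero.1 h3 with h3 | h3
      · exact hb (key h3)
      · exact hab (key (by rwa [phase_add]))
  refine ⟨main ha hb hab, ?_⟩
  have h2 : a + (N : ZMod (2 * N)) + (b + (N : ZMod (2 * N))) = a + b := by linear_combination half_add_half (N := N)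
  have := main (a := a + N) (b := b + N) (by rwa [sine_add_half, neg_ne_zero])
    (by rwa [sine_add_half, neg_ne_zero]) (by rwa [h2])
  rw [h2, sine_add_half, sine_add_half] at this
  contrapose! this
  linarith

/-- There are no cubic resonances. -/
theorem sine_add_three_ne_zero {a b c : ZMod (2 * N)} (ha : sine a ≠ 0) (hb : sine b ≠ 0)
    (hc : sine c ≠ 0) (h : a + b + c = 0 ∨ a + b + c = N) : sine a + sine b + sine c ≠ 0 := by
  rcases h with h | h
  · have e : c = -(a + b) := by linear_combination h
    rw [e, sine_neg, neg_ne_zero] at hc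
    rw [e, sine_neg, ← sub_eq_add_neg]
    exact (sine_triple_ne_zero ha hb hc).1
  · have e : c = N - (a + b) := by linear_combination h
    rw [e, sine_half_sub] at hc ⊢
    exact (sine_triple_ne_zero ha hb hc).2

/-- Eliminating `d`, the sum of sines factors in the phases `x, y, z` of `a, b, c` as `(x y - 1) (x
z - 1) (y z - 1)` up to a unit. -/
theorem resonance_of_sum_eq_zero {a b c d : ZMod (2 * N)} (h : a + b + c + d = 0)
    (hs : sine a + sine b + sine c + sine d = 0) : a + b = 0 ∨ a + c = 0 ∨ a + d = 0 := by
  have hd : d = -(a + b + c) := by linear_combination h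
  have hA := phase_ne_zero a
  have hB := phase_ne_zero b
  have hC := phase_ne_zero c
  have h1 : (phase a - (phase a)⁻¹) + (phase b - (phase b)⁻¹) + (phase c - (phase c)⁻¹)
        - (phase a * phase b * phase c - (phase a * phase b * phase c)⁻¹) = 0 := by
    rw [hd, sine_neg, ← sub_eq_add_neg] at hs
    rw [← phase_add, ← phase_add, ← two_I_sine', ← two_I_sine', ← two_I_sine', ← two_I_sine',
      ← mul_add, ← mul_add, ← mul_sub]
    rw [← Complex.ofReal_add, ← Complex.ofReal_add, ← Complex.ofReal_sub, hs]
    simp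
  have h2 : (phase a * phase b - 1) * ((phase a * phase c - 1) * (phase b * phase c - 1)) = 0 := by
    field_simp at h1
    linear_combination -h1
  have key {x y : ZMod (2 * N)} (hx : phase x * phase y - 1 = 0) : x + y = 0 := by
    apply phase_injective
    rw [phase_add, phase_zero]
    exact sub_eq_zero.1 hx
  rcases mul_eq_zero.1 h2 with h3 | h3
  · exact Or.inl (key h3)
  · rcases mul_eq_zero.1 h3 with h3 | h3
    · exact Or.inr (Or.inl (key h3))
    · refine Or.inr (Or.inr ?_)
      linear_combination h - key h3

theorem sine_eq_sin_val (j : ZMod (2 * N)) : sine j = Real.sin (j.val * Real.pi / N) := by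
  conv_lhs => rw [← ZMod.natCast_zmod_val j]
  rw [sine_natCast, sinMode]

/-- Two sines cancel if the modes are opposite or differ by `N`. Two opposite pairs would have total
`0`, not `N`; one opposite and one shifted pair would force a mode of order two, whose sine
vanishes. -/
theorem shift_of_pair {a b c d : ZMod (2 * N)} (h : a + b + c + d = N) (ha : sine a ≠ 0)
    (hc : sine c ≠ 0)
    (hs : sine a + sine b + sine c + sine d = 0) (hab : sine a + sine b = 0) :
    b = a + N ∧ d = c + N := by
  have h2 := half_add_half (N := N)
  rcases sine_add_sine_eq_zero hab with h3 | h3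
  · exfalso
    rcases sine_add_sine_eq_zero (show sine c + sine d = 0 by linarith) with h4 | h4
    · exact half_ne_zero (N := N) (by rw [← h]; linear_combination h3 + h4)
    · exact hc (sine_eq_zero_of_two_mul (by linear_combination h - h3 - h4))
  · refine ⟨h3, ?_⟩
    rcases sine_add_sine_eq_zero (show sine c + sine d = 0 by linarith) with h4 | h4
    · exact absurd (sine_eq_zero_of_two_mul (by linear_combination h - h3 - h4)) ha
    · exact h4

theorem resonance_of_sum_eq_half {a b c d : ZMod (2 * N)} (h : a + b + c + d = N)
    (hs : sine a + sine b + sine c + sine d = 0) (ha : sine a ≠ 0) (hb : sine b ≠ 0)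
    (hc : sine c ≠ 0) :
    (b = a + N ∧ d = c + N) ∨ (c = a + N ∧ d = b + N) ∨ (d = a + N ∧ c = b + N) := by
  have h1 := sin_pair_of_sum_sin_eq_zero N (NeZero.pos N) ![a.val, b.val, c.val, d.val]
    (by
      rw [← ZMod.natCast_eq_natCast_iff, Fin.sum_univ_four]
      push_cast
      simpa using h)
    (by
      rw [Fin.sum_univ_four]
      simpa [sine_eq_sin_val] using hs)
  obtain ⟨i, hi, h2⟩ := h1
  fin_cases i
  · simp at hi
  · left
    refine shift_of_pair h ha hc hs ?_
    simpa [sine_eq_sin_val] using h2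
  · right; left
    refine shift_of_pair (by rw [← h]; ring) ha hb (by linarith) ?_
    simpa [sine_eq_sin_val] using h2
  · right; right
    refine shift_of_pair (by rw [← h]; ring) ha hb (by linarith) ?_
    simpa [sine_eq_sin_val] using h2

/-- The exchange coefficient of the second order of perturbation theory on resonances. -/
noncomputable def exchange (a b : ZMod (2 * N)) : ℝ :=
  (1 / 2) * (sine (a + b) / (-(sine a + sine b) - sine (a + b))
    - sine (a + b) / (-(sine a + sine b) + sine (a + b)))

theorem exchange_of_add_eq_zero {a b : ZMod (2 * N)} (h : a + b = 0) : exchange a b = 0 := by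
  simp [exchange, h]

/-- On a common denominator this is `sin² (a + b) / ((sin a + sin b)² - sin² (a + b))`. By
half-angle formulas the denominator is `4 sin² ((a + b) / 2) sin a sin b`, and the numerator
contains the same `sin²` factor. -/
theorem exchange_eq {a b : ZMod (2 * N)} (ha : sine a ≠ 0) (hb : sine b ≠ 0) (hab : a + b ≠ 0) :
    exchange a b = (1 + (phase (a + b)).re) / (2 * sine a * sine b) := by
  by_cases h : sine (a + b) = 0
  · rcases sine_eq_zero h with h | h
    · exact absurd h hab
    · rw [h, phase_half, exchange, h, sine_half]; simp
  · obtain ⟨h1, h2⟩ := sine_triple_ne_zero ha hb h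
    have e : exchange a b = sine (a + b) ^ 2 /
        ((sine a + sine b - sine (a + b)) * (sine a + sine b + sine (a + b))) := by
      rw [exchange]
      have h1' : -(sine a + sine b) + sine (a + b) ≠ 0 := by contrapose! h1; linarith
      have h2' : -(sine a + sine b) - sine (a + b) ≠ 0 := by contrapose! h2; linarith
      field_simp
      ring
    rw [e, div_eq_div_iff (mul_ne_zero h1 h2) (by positivity)]
    have hA := phase_ne_zero a
    have hB := phase_ne_zero b
    -- Each sine is given a factor `2 i`, so that the identity becomes one between rational
    -- functions of two phases.
    have key : ((2 * Complex.I * sine (a + b)) ^ 2 * (2 * ((2 * Complex.I) * sine a) *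
        ((2 * Complex.I) * sine b)) : ℂ) =
        2 * ((2 + 2 * ((phase (a + b)).re : ℂ)) *
          ((2 * Complex.I * sine a + 2 * Complex.I * sine b - 2 * Complex.I * sine (a + b)) *
          (2 * Complex.I * sine a + 2 * Complex.I * sine b + 2 * Complex.I * sine (a + b)))) * (-1)
           := by
      rw [two_I_sine', two_I_sine', two_I_sine', two_re_phase, phase_add]
      field_simp
      ring
    have h3 : ((sine (a + b) ^ 2 * (2 * sine a * sine b) : ℝ) : ℂ) =
        (((1 + (phase (a + b)).re) *
          ((sine a + sine b - sine (a + b)) * (sine a + sine b + sine (a + b))) : ℝ) : ℂ) := by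
      push_cast
      have hI := Complex.I_sq
      have hI4 : Complex.I ^ 4 = 1 := Complex.I_pow_four
      linear_combination key / 16 - (sine (a + b) ^ 2 * (2 * sine a * sine b)) * hI4
        - ((1 + (phase (a + b)).re) *
          ((sine a + sine b - sine (a + b)) * (sine a + sine b + sine (a + b)))) * hI
    exact_mod_cast h3

end Phase

/-! ### Polynomials filtered by lowest degree. -/

section Filtration
open MvPolynomial
variable {σ : Type*}

/-- The complex polynomials all of whose monomials have degree at least `k`. -/
noncomputable def fil (σ : Type*) (k : ℕ) : Submodule ℂ (MvPolynomial σ ℂ) :=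
  Submodule.span ℂ {f | ∃ l : List σ, k ≤ l.length ∧ f = (l.map X).prod}

theorem prod_mem_fil (l : List σ) {k : ℕ} (h : k ≤ l.length) :
    ((l.map X).prod : MvPolynomial σ ℂ) ∈ fil σ k :=
  Submodule.subset_span ⟨l, h, rfl⟩

theorem fil_mono {k l : ℕ} (h : k ≤ l) : fil σ l ≤ fil σ k :=
  Submodule.span_mono fun _ ⟨m, hm, e⟩ => ⟨m, h.trans hm, e⟩

theorem X_mem_fil (j : σ) : (X j : MvPolynomial σ ℂ) ∈ fil σ 1 := by
  simpa using prod_mem_fil [j] (k := 1) le_rfl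

theorem mul_mem_fil {k l : ℕ} {f g : MvPolynomial σ ℂ} (hf : f ∈ fil σ k) (hg : g ∈ fil σ l) :
    f * g ∈ fil σ (k + l) := by
  have h := Submodule.mul_mem_mul hf hg
  rw [fil, fil, Submodule.span_mul_span] at h
  refine Submodule.span_mono ?_ h
  rintro _ ⟨_, ⟨l₁, h₁, rfl⟩, _, ⟨l₂, h₂, rfl⟩, rfl⟩
  exact ⟨l₁ ++ l₂, by simp; omega, by simp⟩

theorem C_mul_mem_fil {k : ℕ} {f : MvPolynomial σ ℂ} (c : ℂ) (hf : f ∈ fil σ k) :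
    C c * f ∈ fil σ k := by
  rw [← smul_eq_C_mul]
  exact Submodule.smul_mem _ _ hf

theorem one_mem_fil : (1 : MvPolynomial σ ℂ) ∈ fil σ 0 := by
  simpa using prod_mem_fil ([] : List σ) (k := 0) le_rfl

theorem pow_mem_fil {k : ℕ} {f : MvPolynomial σ ℂ} (hf : f ∈ fil σ k) (n : ℕ) :
    f ^ n ∈ fil σ (n * k) := by
  induction n with
  | zero => simpa using one_mem_fil
  | succ n ih =>
    rw [pow_succ, add_mul, one_mul]
    exact mul_mem_fil ih hf

/-- Linear maps are controlled on the filtration by their values on products of variables. -/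
theorem fil_induction {k m : ℕ} (φ : MvPolynomial σ ℂ →ₗ[ℂ] MvPolynomial σ ℂ)
    (h : ∀ l : List σ, φ (l.map X).prod ∈ fil σ (l.length + m)) {f : MvPolynomial σ ℂ}
    (hf : f ∈ fil σ k) : φ f ∈ fil σ (k + m) := by
  induction hf using Submodule.span_induction with
  | mem x hx =>
    obtain ⟨l, hl, rfl⟩ := hx
    exact fil_mono (by omega) (h l)
  | zero => simp
  | add x y _ _ hx hy => rw [map_add]; exact add_mem hx hy
  | smul a x _ hx => rw [map_smul]; exact Submodule.smul_mem _ _ hx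

theorem derivation_mem_fil {k m : ℕ} (B : Derivation ℂ (MvPolynomial σ ℂ) (MvPolynomial σ ℂ))
    (hB : ∀ j, B (X j) ∈ fil σ (1 + m)) {f : MvPolynomial σ ℂ} (hf : f ∈ fil σ k) :
    B f ∈ fil σ (k + m) := by
  refine fil_induction B.toLinearMap (fun l => ?_) hf
  induction l with
  | nil => simp
  | cons j l ih =>
    simp only [List.map_cons, List.prod_cons, Derivation.coeFn_coe, Derivation.leibniz,
      smul_eq_mul, List.length_cons]
    refine add_mem (fil_mono (by omega) (mul_mem_fil (X_mem_fil j) ih)) ?_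
    exact fil_mono (by omega) (mul_mem_fil (prod_mem_fil l le_rfl) (hB j))

/-- The substitution is multiplicative and `1 + B` is multiplicative up to `B f * B g`, which is two
degrees higher; so it suffices that they agree on the variables. -/
theorem algHom_sub_mem_fil {k : ℕ} (B : Derivation ℂ (MvPolynomial σ ℂ) (MvPolynomial σ ℂ))
    (hB : ∀ j, B (X j) ∈ fil σ 2) {f : MvPolynomial σ ℂ} (hf : f ∈ fil σ k) :
    aeval (R := ℂ) (fun j => X j + B (X j)) f - f - B f ∈ fil σ (k + 2) := by
  have hB' : ∀ j, B (X j) ∈ fil σ (1 + 1) := hB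
  refine fil_induction ((aeval (R := ℂ) (fun j => X j + B (X j))).toLinearMap - LinearMap.id
    - B.toLinearMap) (fun l => ?_) hf
  induction l with
  | nil => simp
  | cons j l ih =>
    simp only [List.map_cons, List.prod_cons, Derivation.coeFn_coe, Derivation.leibniz,
      smul_eq_mul, List.length_cons, LinearMap.sub_apply, AlgHom.toLinearMap_apply, map_mul,
      aeval_X, LinearMap.id_apply] at ih ⊢
    set p : MvPolynomial σ ℂ := (l.map X).prod with hp
    have hpm : p ∈ fil σ l.length := prod_mem_fil l le_rfl
    have hBp := derivation_mem_fil B hB' hpm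
    set r := aeval (R := ℂ) (fun j => X j + B (X j)) p - p - B p with hr
    have e : (X j + B (X j)) * aeval (R := ℂ) (fun j => X j + B (X j)) p - X j * p
        - (X j * B p + p * B (X j)) = X j * r + B (X j) * B p + B (X j) * r := by
      rw [hr]; ring
    rw [e]
    refine add_mem (add_mem ?_ ?_) ?_
    · exact fil_mono (by omega) (mul_mem_fil (X_mem_fil j) ih)
    · exact fil_mono (by omega) (mul_mem_fil (hB j) hBp)
    · exact fil_mono (by omega) (mul_mem_fil (hB j) ih)

/-- This turns membership in the filtration into the error estimate of the theorem. -/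
theorem aeval_bound [Fintype σ] {k : ℕ} {f : MvPolynomial σ ℂ} (hf : f ∈ fil σ k) :
    ∃ C : ℝ, 0 ≤ C ∧ ∀ (v : σ → ℂ) (ρ : ℝ), ρ ≤ 1 → (∀ j, ‖v j‖ ≤ ρ) → 0 ≤ ρ →
      ‖aeval v f‖ ≤ C * ρ ^ k := by
  induction hf using Submodule.span_induction with
  | mem x hx =>
    obtain ⟨l, hl, rfl⟩ := hx
    refine ⟨1, zero_le_one, fun v ρ h1 hv h0 => ?_⟩
    rw [one_mul]
    refine le_trans ?_ (pow_le_pow_of_le_one h0 h1 hl)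
    clear hl
    induction l with
    | nil => simp
    | cons j l ih =>
      simp only [List.map_cons, List.prod_cons, map_mul, aeval_X, List.length_cons, norm_mul]
      rw [pow_succ']
      exact mul_le_mul (hv j) ih (norm_nonneg _) h0
  | zero => exact ⟨0, le_rfl, by simp⟩
  | add x y _ _ hx hy =>
    obtain ⟨A, hA0, hA⟩ := hx
    obtain ⟨B, hB0, hB⟩ := hy
    refine ⟨A + B, add_nonneg hA0 hB0, fun v ρ h1 hv h0 => ?_⟩
    rw [map_add, add_mul]
    exact (norm_add_le _ _).trans (add_le_add (hA v ρ h1 hv h0) (hB v ρ h1 hv h0))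
  | smul a x _ hx =>
    obtain ⟨A, hA0, hA⟩ := hx
    refine ⟨‖a‖ * A, by positivity, fun v ρ h1 hv h0 => ?_⟩
    rw [map_smul, norm_smul, mul_assoc]
    exact mul_le_mul_of_nonneg_left (hA v ρ h1 hv h0) (norm_nonneg _)

end Filtration

/-! ### The Poisson bracket in complex amplitudes and the rotation generated by the quadratic part.
-/

section Poisson
open MvPolynomial
variable {N : ℕ} [NeZero N]

/-- Complex polynomials in the complex amplitudes of the normal modes. -/
abbrev Poly (N : ℕ) : Type := MvPolynomial (ZMod (2 * N)) ℂ

/-- The sign of the frequency of a mode. -/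
noncomputable def sgn (j : ZMod (2 * N)) : ℝ := Real.sign (sine j)

theorem sgn_neg (j : ZMod (2 * N)) : sgn (-j) = -sgn j := by
  rw [sgn, sine_neg, Real.sign_neg, sgn]

theorem sgn_mul_abs (j : ZMod (2 * N)) : sgn j * |sine j| = sine j := by
  rw [sgn]
  rcases lt_trichotomy (sine j) 0 with h | h | h
  · rw [Real.sign_of_neg h, abs_of_neg h]; ring
  · simp [h]
  · rw [Real.sign_of_pos h, abs_of_pos h]; ring

/-- The Poisson bracket with `g` as a derivation, `{X j, X (-j)} = i sgn j`. -/
noncomputable def pbRight (g : Poly N) : Derivation ℂ (Poly N) (Poly N) :=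
  mkDerivation ℂ fun j => C (Complex.I * sgn j) * pderiv (-j) g

/-- The Poisson bracket. -/
noncomputable def pb (f g : Poly N) : Poly N := pbRight g f

theorem pb_X_left (j : ZMod (2 * N)) (g : Poly N) :
    pb (X j) g = C (Complex.I * sgn j) * pderiv (-j) g := mkDerivation_X _ _ _

theorem derivation_sum_apply {ι : Type*} (s : Finset ι)
    (D : ι → Derivation ℂ (Poly N) (Poly N)) (f : Poly N) : (∑ i ∈ s, D i) f = ∑ i ∈ s, D i f := by
  classical
  induction s using Finset.induction_on with
  | empty => simp
  | insert a s ha ih => rw [Finset.sum_insert ha, Finset.sum_insert ha, Derivation.add_apply, ih]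

theorem pb_eq_sum (f g : Poly N) :
    pb f g = ∑ j, C (Complex.I * sgn j) * pderiv (-j) g * pderiv j f := by
  have : pbRight g = ∑ j, (C (Complex.I * sgn j) * pderiv (-j) g) • pderiv j := by
    refine derivation_ext fun l => ?_
    rw [pbRight, mkDerivation_X, derivation_sum_apply, Finset.sum_eq_single l]
    · simp
    · intro b _ hb
      simp [pderiv_X_of_ne hb.symm]
    · simp
  rw [pb, this, derivation_sum_apply]
  rfl

theorem pb_antisymm (f g : Poly N) : pb f g = -pb g f := by
  rw [pb_eq_sum, pb_eq_sum, ← Finset.sum_neg_distrib]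
  refine Fintype.sum_equiv (Equiv.neg _) _ _ fun j => ?_
  rw [Equiv.neg_apply, sgn_neg, neg_neg]
  push_cast
  rw [mul_neg, C_neg]
  ring

@[simp] theorem pb_zero_left (g : Poly N) : pb 0 g = 0 := map_zero _
theorem pb_add_left (f f' g : Poly N) : pb (f + f') g = pb f g + pb f' g := map_add _ _ _
@[simp] theorem pb_zero_right (f : Poly N) : pb f 0 = 0 := by rw [pb_antisymm]; simp
theorem pb_add_right (f g g' : Poly N) : pb f (g + g') = pb f g + pb f g' := by
  rw [pb_antisymm, pb_add_left, pb_antisymm g, pb_antisymm g']; ring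
theorem pb_neg_left (f g : Poly N) : pb (-f) g = -pb f g := map_neg _ _
theorem pb_sum_left {ι : Type*} (s : Finset ι) (f : ι → Poly N) (g : Poly N) :
    pb (∑ i ∈ s, f i) g = ∑ i ∈ s, pb (f i) g := map_sum _ _ _
theorem pb_sum_right {ι : Type*} (s : Finset ι) (f : Poly N) (g : ι → Poly N) :
    pb f (∑ i ∈ s, g i) = ∑ i ∈ s, pb f (g i) := by
  rw [pb_antisymm, pb_sum_left, ← Finset.sum_neg_distrib]
  exact Finset.sum_congr rfl fun i _ => (pb_antisymm _ _).symm
theorem pb_mul_left (f f' g : Poly N) : pb (f * f') g = f * pb f' g + f' * pb f g :=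
  Derivation.leibniz _ _ _
theorem pb_mul_right (f g g' : Poly N) : pb f (g * g') = g * pb f g' + g' * pb f g := by
  rw [pb_antisymm, pb_mul_left, pb_antisymm f g, pb_antisymm f g']; ring
theorem pb_C_mul_left (c : ℂ) (f g : Poly N) : pb (C c * f) g = C c * pb f g := by
  rw [← smul_eq_C_mul, ← smul_eq_C_mul]; exact Derivation.map_smul _ _ _
theorem pb_C_mul_right (c : ℂ) (f g : Poly N) : pb f (C c * g) = C c * pb f g := by
  rw [pb_antisymm, pb_C_mul_left, pb_antisymm f g, mul_neg]
theorem pb_self (f : Poly N) : pb f f = 0 := self_eq_neg.1 (pb_antisymm f f)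
theorem pb_pow_right (f g : Poly N) (n : ℕ) : pb f (g ^ (n + 1)) = C (n + 1 : ℂ) * g ^ n * pb f g := by
  rw [pb_antisymm, pb, Derivation.leibniz_pow, pb_antisymm f g]
  simp [pb, nsmul_eq_mul, mul_assoc]

/-- The bracket removes one variable from each factor, hence lowers the total degree by two; writing
the degree of `g` as `l + 2` avoids truncated subtraction. -/
theorem pb_mem_fil {k l : ℕ} {f g : Poly N} (hf : f ∈ fil _ k) (hg : g ∈ fil _ (l + 2)) :
    pb f g ∈ fil _ (k + l) := by
  refine derivation_mem_fil (pbRight g) (fun j => ?_) hf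
  change pb (X j) g ∈ _
  rw [pb_antisymm]
  refine neg_mem ?_
  have hpos : ∀ (j : ZMod (2 * N)) {k : ℕ} {g : Poly N}, g ∈ fil _ (k + 1) →
      pb g (X j) ∈ fil _ k := by
    intro j k g hg
    induction hg using Submodule.span_induction with
    | mem x hx =>
      obtain ⟨l, hl, rfl⟩ := hx
      have : ∀ l : List (ZMod (2 * N)),
          pb ((l.map X).prod) (X j) ∈ fil (ZMod (2 * N)) (l.length - 1) := by
        intro l
        induction l with
        | nil => simp [pb]
        | cons i l ih =>
          rw [List.map_cons, List.prod_cons, pb_mul_left]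
          refine add_mem ?_ ?_
          · rcases l with _ | ⟨i', l⟩
            · simp [pb]
            · exact fil_mono (by simp) (mul_mem_fil (X_mem_fil i) ih)
          · have : pb (X i) (X j) ∈ fil (ZMod (2 * N)) 0 := by
              rw [pb_X_left]
              refine C_mul_mem_fil _ ?_
              rw [pderiv_X, Pi.single_apply]
              split_ifs
              · exact one_mem_fil
              · exact zero_mem _
            exact fil_mono (by simp) (mul_mem_fil (prod_mem_fil l le_rfl) this)
      exact fil_mono (by omega) (this l)
    | zero => simp
    | add x y _ _ hx hy => rw [pb_add_left]; exact add_mem hx hy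
    | smul a x _ hx => rw [smul_eq_C_mul, pb_C_mul_left]; exact C_mul_mem_fil _ hx
  exact fil_mono (by omega) (hpos j (k := l + 1) hg)

/-- The Poisson bracket `{H₂, ·}` with the quadratic Hamiltonian. -/
noncomputable def rot : Derivation ℂ (Poly N) (Poly N) :=
  mkDerivation ℂ fun j => C (-(2 * Complex.I * sine j)) * X j

theorem rot_X (j : ZMod (2 * N)) : rot (X j) = C (-(2 * Complex.I * sine j)) * X j :=
  mkDerivation_X _ _ _

theorem rot_C_mul (c : ℂ) (f : Poly N) : rot (C c * f) = C c * rot f := by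
  rw [← smul_eq_C_mul, ← smul_eq_C_mul]; exact Derivation.map_smul _ _ _

theorem pderiv_rot (l : ZMod (2 * N)) (g : Poly N) :
    pderiv l (rot g) = rot (pderiv l g) + C (-(2 * Complex.I * sine l)) * pderiv l g := by
  have h : ⁅(pderiv l : Derivation ℂ (Poly N) (Poly N)), rot⁆ =
      (C (-(2 * Complex.I * sine l)) : Poly N) • pderiv l := by
    refine derivation_ext fun m => ?_
    rw [Derivation.commutator_apply, rot_X, pderiv_C_mul]
    by_cases hm : m = l
    · subst hm
      simp
    · simp [pderiv_X_of_ne hm]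
  have := congrArg (fun d : Derivation ℂ (Poly N) (Poly N) => d g) h
  simp only [Derivation.commutator_apply, Derivation.smul_apply, smul_eq_mul] at this
  linear_combination this

/-- The only case of the Jacobi identity that is needed. It holds because `rot` is diagonal on the
variables with eigenvalues odd in `j`, so that it annihilates the constants `{X j, X (-j)}`. -/
theorem rot_pb (f g : Poly N) : rot (pb f g) = pb (rot f) g + pb f (rot g) := by
  have h : ⁅(rot : Derivation ℂ (Poly N) (Poly N)), pbRight g⁆ = pbRight (rot g) := by
    refine derivation_ext fun j => ?_
    rw [Derivation.commutator_apply]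
    change rot (pb (X j) g) - pb (rot (X j)) g = pb (X j) (rot g)
    rw [pb_X_left, pb_X_left, rot_X, pb_C_mul_left, pb_X_left, rot_C_mul, pderiv_rot, sine_neg]
    push_cast
    rw [mul_neg, neg_neg, C_neg]
    ring
  have := congrArg (fun d : Derivation ℂ (Poly N) (Poly N) => d f) h
  simp only [Derivation.commutator_apply] at this
  change rot (pb f g) - pb (rot f) g = pb f (rot g) at this
  linear_combination this

/-- The quadratic part of the Hamiltonian. -/
noncomputable def quadratic (N : ℕ) [NeZero N] : Poly N :=
  ∑ j : ZMod (2 * N), C ((|sine j| : ℝ) : ℂ) * (X j * X (-j))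

theorem pb_quadratic (g : Poly N) : pb (quadratic N) g = rot g := by
  rw [pb_antisymm]
  have h : pbRight (quadratic N) = -rot := by
    refine derivation_ext fun j => ?_
    change pb (X j) (quadratic N) = -rot (X j)
    rw [rot_X, quadratic, pb_sum_right]
    have : ∀ l : ZMod (2 * N), pb (X j) (C ((|sine l| : ℝ) : ℂ) * (X l * X (-l)))
        = (if l = j then C (Complex.I * sine j) * X j else 0) +
          (if l = -j then C (Complex.I * sine j) * X j else 0) := by
      intro l
      have hs : (sine j : ℂ) = sgn j * (|sine j| : ℝ) := by
        exact_mod_cast (sgn_mul_abs j).symm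
      rw [pb_C_mul_right, pb_mul_right, pb_X_left, pb_X_left, pderiv_X, pderiv_X]
      simp only [Pi.single_apply]
      have e1 : ∀ c : ℂ, (C (|sine l| : ℝ) : Poly N) * (X l * (C c * (if -l = -j then 1 else 0)))
          = if l = j then C (|sine j| * c) * X j else 0 := by
        intro c
        by_cases h : l = j
        · subst h
          rw [if_pos rfl, if_pos rfl, C_mul]; ring
        · rw [if_neg h, if_neg (by simpa using h)]; ring
      have e2 : ∀ c : ℂ, (C (|sine l| : ℝ) : Poly N) * (X (-l) * (C c * (if l = -j then 1 else 0)))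
          = if l = -j then C (|sine j| * c) * X j else 0 := by
        intro c
        by_cases h : l = -j
        · subst h
          rw [if_pos rfl, if_pos rfl, C_mul, sine_neg, abs_neg, neg_neg]; ring
        · rw [if_neg h, if_neg h]; ring
      rw [mul_add, e1, e2, hs]
      rw [show ((|sine j| : ℝ) : ℂ) * (Complex.I * sgn j)
        = Complex.I * (sgn j * (|sine j| : ℝ)) by ring]
    simp only [this, Finset.sum_add_distrib, Finset.sum_ite_eq', Finset.mem_univ, if_true]
    rw [C_neg, mul_assoc (2 : ℂ), C_mul (a := (2 : ℂ)),
      show (C (2 : ℂ) : Poly N) = 2 from map_ofNat _ _, C_mul]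
    ring
  change -(pbRight (quadratic N) g) = _
  rw [h]
  simp

end Poisson

/-! ### Real coordinates and complex amplitudes. -/

section Modes
variable {N : ℕ} [NeZero N]

theorem sum_zmod_eq_sum_range {M : ℕ} [NeZero M] {A : Type*} [AddCommMonoid A] (F : ZMod M → A) :
    ∑ j, F j = ∑ i ∈ Finset.range M, F (i : ZMod M) := by
  refine Finset.sum_nbij' (fun j => j.val) (fun i => (i : ZMod M)) ?_ ?_ ?_ ?_ ?_
  · intro j _
    exact Finset.mem_range.2 (ZMod.val_lt j)
  · simp
  · simp
  · intro i hi
    exact ZMod.val_cast_of_lt (Finset.mem_range.1 hi)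
  · simp

theorem sum_range_eq_zero_add {A : Type*} [AddCommMonoid A] (N : ℕ) [NeZero N] (F : ℕ → A) :
    ∑ i ∈ Finset.range N, F i = F 0 + ∑ k ∈ Finset.Icc 1 (N - 1), F k := by
  obtain ⟨n, rfl⟩ : ∃ n, N = n + 1 := ⟨N - 1, by have := NeZero.pos N; omega⟩
  rw [Finset.range_eq_Ico, Finset.sum_eq_sum_Ico_succ_bot (by omega)]
  rfl

theorem natCast_sub_half {k : ℕ} (hk : k ≤ N) :
    ((N + (N - k) : ℕ) : ZMod (2 * N)) = -(k : ZMod (2 * N)) := by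
  push_cast [Nat.cast_sub hk]
  linear_combination half_add_half (N := N)

/-- Splitting a sum over all modes into the two modes of frequency zero, the modes of positive
frequency and those of negative frequency. -/
theorem sum_modes {A : Type*} [AddCommMonoid A] (F : ZMod (2 * N) → A) :
    ∑ j, F j = F 0 + F (N : ZMod (2 * N)) +
      ∑ k ∈ Finset.Icc 1 (N - 1), (F (k : ZMod (2 * N)) + F (-(k : ZMod (2 * N)))) := by
  rw [sum_zmod_eq_sum_range, show Finset.range (2 * N) = Finset.range (N + N) by rw [two_mul],
    Finset.sum_range_add, sum_range_eq_zero_add,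
    sum_range_eq_zero_add, Finset.sum_add_distrib]
  have : ∑ k ∈ Finset.Icc 1 (N - 1), F ((N + k : ℕ) : ZMod (2 * N))
      = ∑ k ∈ Finset.Icc 1 (N - 1), F (-(k : ZMod (2 * N))) := by
    refine Finset.sum_nbij' (fun k => N - k) (fun k => N - k) ?_ ?_ ?_ ?_ ?_
    · intro k hk
      rw [Finset.mem_Icc] at hk ⊢
      omega
    · intro k hk
      rw [Finset.mem_Icc] at hk ⊢
      omega
    · intro k hk
      rw [Finset.mem_Icc] at hk
      omega
    · intro k hk
      rw [Finset.mem_Icc] at hk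
      omega
    · intro k hk
      rw [Finset.mem_Icc] at hk
      rw [← natCast_sub_half (by omega)]
      congr 3
      omega
  rw [this, Nat.cast_zero, Nat.add_zero]
  abel

theorem comp_coe (x : Mode N → ℝ) (i : Mode N) : comp x i = x i := by
  rw [comp, dif_pos i.2]

theorem comp_eq_zero (x : Mode N → ℝ) {k : ℕ} (hk : k ∉ Finset.Icc 1 (N - 1)) : comp x k = 0 := by
  rw [comp, dif_neg hk]

theorem symp_eq_sum_comp (a b : PhaseSpace (Mode N)) :
    symp a b = ∑ k ∈ Finset.Icc 1 (N - 1), (comp a.1 k * comp b.2 k - comp a.2 k * comp b.1 k) := by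
  rw [symp, ← Finset.sum_coe_sort (Finset.Icc 1 (N - 1))]
  exact Finset.sum_congr rfl fun i _ => by rw [comp_coe, comp_coe, comp_coe, comp_coe]

theorem abs_comp_le (x : Mode N → ℝ) (k : ℕ) : |comp x k| ≤ ‖x‖ := by
  rw [comp]
  split_ifs with h
  · exact norm_le_pi_norm x ⟨k, h⟩
  · simp

/-- The complex amplitude `z_j`, equal to `(x_j - i y_j) / √2` for `0 < j < N` and subject to
`z_{-j} = conj z_j`. -/
noncomputable def amplitude (w : PhaseSpace (Mode N)) (j : ZMod (2 * N)) : ℂ :=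
  ((comp w.1 j.val - Complex.I * comp w.2 j.val) +
    (comp w.1 (-j).val + Complex.I * comp w.2 (-j).val)) / (Real.sqrt 2 : ℝ)

theorem amplitude_neg (w : PhaseSpace (Mode N)) (j : ZMod (2 * N)) :
    amplitude w (-j) = starRingEnd ℂ (amplitude w j) := by
  rw [amplitude, amplitude, neg_neg]
  simp only [map_div₀, map_add, map_sub, map_mul, Complex.conj_ofReal, Complex.conj_I]
  ring

theorem comp_add (x x' : Mode N → ℝ) (k : ℕ) : comp (x + x') k = comp x k + comp x' k := by
  rw [comp, comp, comp]
  split_ifs <;> simp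

theorem comp_smul (c : ℝ) (x : Mode N → ℝ) (k : ℕ) : comp (c • x) k = c * comp x k := by
  rw [comp, comp]
  split_ifs <;> simp

theorem amplitude_add (w w' : PhaseSpace (Mode N)) (j : ZMod (2 * N)) :
    amplitude (w + w') j = amplitude w j + amplitude w' j := by
  simp only [amplitude, Prod.fst_add, Prod.snd_add, comp_add]
  push_cast
  ring

theorem amplitude_smul (c : ℝ) (w : PhaseSpace (Mode N)) (j : ZMod (2 * N)) :
    amplitude (c • w) j = c * amplitude w j := by
  simp only [amplitude, Prod.smul_fst, Prod.smul_snd, comp_smul]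
  push_cast
  ring

theorem norm_amplitude_le (w : PhaseSpace (Mode N)) (j : ZMod (2 * N)) :
    ‖amplitude w j‖ ≤ 4 * ‖w‖ := by
  have h1 : (1 : ℝ) ≤ Real.sqrt 2 := Real.one_le_sqrt.2 (by norm_num)
  have hx (k : ℕ) : ‖(comp w.1 k : ℂ)‖ ≤ ‖w‖ := by
    rw [Complex.norm_real]; exact (abs_comp_le _ _).trans (norm_fst_le w)
  have hy (k : ℕ) : ‖Complex.I * (comp w.2 k : ℂ)‖ ≤ ‖w‖ := by
    rw [norm_mul, Complex.norm_I, one_mul, Complex.norm_real]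
    exact (abs_comp_le _ _).trans (norm_snd_le w)
  rw [amplitude, norm_div, Complex.norm_real, Real.norm_of_nonneg (Real.sqrt_nonneg _)]
  refine (div_le_self (norm_nonneg _) h1).trans ?_
  refine (norm_add_le _ _).trans ?_
  have e1 := norm_sub_le (comp w.1 j.val : ℂ) (Complex.I * comp w.2 j.val)
  have e2 := norm_add_le (comp w.1 (-j).val : ℂ) (Complex.I * comp w.2 (-j).val)
  have := hx j.val
  have := hx (-j).val
  have := hy j.val
  have := hy (-j).val
  linarith

theorem val_natCast_mode {k : ℕ} (hk : k ∈ Finset.Icc 1 (N - 1)) :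
    (k : ZMod (2 * N)).val = k ∧ (-(k : ZMod (2 * N))).val = 2 * N - k := by
  rw [Finset.mem_Icc] at hk
  have h1 : (k : ZMod (2 * N)).val = k := ZMod.val_cast_of_lt (by omega)
  refine ⟨h1, ?_⟩
  rw [← natCast_sub_half (by omega), ZMod.val_cast_of_lt (by omega)]
  omega

/-- Since `comp` is `0` outside `1, …, N - 1`, only one of the two summands of `amplitude` survives,
according to the sign of the frequency. -/
theorem amplitude_natCast (w : PhaseSpace (Mode N)) {k : ℕ} (hk : k ∈ Finset.Icc 1 (N - 1)) :
    amplitude w (k : ZMod (2 * N)) = (comp w.1 k - Complex.I * comp w.2 k) / (Real.sqrt 2 : ℝ) := by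
  obtain ⟨h1, h2⟩ := val_natCast_mode hk
  rw [Finset.mem_Icc] at hk
  have h3 : 2 * N - k ∉ Finset.Icc 1 (N - 1) := by rw [Finset.mem_Icc]; omega
  rw [amplitude, h1, h2, comp_eq_zero w.1 h3, comp_eq_zero w.2 h3]
  simp

@[simp] theorem amplitude_zero (w : PhaseSpace (Mode N)) : amplitude w 0 = 0 := by
  simp [amplitude, comp_eq_zero]

@[simp] theorem amplitude_half (w : PhaseSpace (Mode N)) :
    amplitude w (N : ZMod (2 * N)) = 0 := by
  have hN := NeZero.pos N
  have h : (N : ZMod (2 * N)).val = N := ZMod.val_cast_of_lt (by omega)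
  have h3 : N ∉ Finset.Icc 1 (N - 1) := by rw [Finset.mem_Icc]; omega
  simp [amplitude, neg_half, h, comp_eq_zero _ h3]

theorem sinMode_pos {k : ℕ} (hk : k ∈ Finset.Icc 1 (N - 1)) : 0 < sinMode N k := by
  rw [Finset.mem_Icc] at hk
  have hN : (0 : ℝ) < N := by exact_mod_cast NeZero.pos N
  refine Real.sin_pos_of_pos_of_lt_pi ?_ ?_
  · have : (0 : ℝ) < k := by exact_mod_cast hk.1
    positivity
  · rw [div_lt_iff₀ hN, mul_comm]
    refine mul_lt_mul_of_pos_left ?_ Real.pi_pos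
    exact_mod_cast (show k < N by omega)

theorem sgn_natCast {k : ℕ} (hk : k ∈ Finset.Icc 1 (N - 1)) : sgn (k : ZMod (2 * N)) = 1 := by
  rw [sgn, sine_natCast, Real.sign_of_pos (sinMode_pos hk)]

theorem sgn_zero : sgn (0 : ZMod (2 * N)) = 0 := by simp [sgn]

theorem sgn_half : sgn (N : ZMod (2 * N)) = 0 := by simp [sgn]

theorem sqrt_two_sq : ((Real.sqrt 2 : ℝ) : ℂ) ^ 2 = 2 := by
  rw [← Complex.ofReal_pow, Real.sq_sqrt (by norm_num)]; simp

theorem sqrt_two_ne_zero : ((Real.sqrt 2 : ℝ) : ℂ) ≠ 0 := by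
  rw [Complex.ofReal_ne_zero]; positivity

theorem symp_eq_sum_amplitude (a b : PhaseSpace (Mode N)) :
    (symp a b : ℂ) = ∑ j : ZMod (2 * N), -Complex.I * sgn j * amplitude a j * amplitude b (-j) := by
  rw [sum_modes, symp_eq_sum_comp]
  simp only [amplitude_zero, amplitude_half, mul_zero, zero_mul, zero_add]
  push_cast
  refine Finset.sum_congr rfl fun k hk => ?_
  rw [neg_neg, amplitude_neg, amplitude_neg, amplitude_natCast a hk, amplitude_natCast b hk,
    sgn_neg, sgn_natCast hk]
  simp only [map_div₀, map_sub, map_mul, Complex.conj_ofReal, Complex.conj_I]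
  have h2 := sqrt_two_sq
  have h0 := sqrt_two_ne_zero
  field_simp
  rw [h2]
  push_cast
  linear_combination (comp a.1 k * comp b.2 k - comp a.2 k * comp b.1 k : ℂ) * 2 * Complex.I_sq

/-- Every family of amplitudes with the right symmetry comes from a point of phase space. -/
theorem exists_amplitude_eq (b : ZMod (2 * N) → ℂ) (hb : ∀ j, b (-j) = starRingEnd ℂ (b j))
    (h0 : b 0 = 0) (hN : b (N : ZMod (2 * N)) = 0) :
    ∃ w : PhaseSpace (Mode N), ∀ j, amplitude w j = b j := by
  refine ⟨(fun k => Real.sqrt 2 * (b (k : ℕ)).re, fun k => -(Real.sqrt 2 * (b (k : ℕ)).im)), ?_⟩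
  have main (k : ℕ) (hk : k ∈ Finset.Icc 1 (N - 1)) : amplitude
      ((fun k => Real.sqrt 2 * (b (k : ℕ)).re, fun k => -(Real.sqrt 2 * (b (k : ℕ)).im)) :
        PhaseSpace (Mode N)) (k : ZMod (2 * N)) = b k := by
    rw [amplitude_natCast _ hk, comp, comp, dif_pos hk, dif_pos hk]
    have h0 := sqrt_two_ne_zero
    conv_rhs => rw [← Complex.re_add_im (b k)]
    push_cast
    field_simp
    ring
  intro j
  have hj : j.val < 2 * N := ZMod.val_lt j
  have ej : ((j.val : ℕ) : ZMod (2 * N)) = j := ZMod.natCast_zmod_val j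
  rcases Nat.eq_zero_or_pos j.val with h | h
  · rw [h, Nat.cast_zero] at ej
    rw [← ej, amplitude_zero, h0]
  rcases lt_trichotomy j.val N with h' | h' | h'
  · rw [← ej]
    exact main _ (Finset.mem_Icc.2 ⟨h, by omega⟩)
  · rw [h'] at ej
    rw [← ej, amplitude_half, hN]
  · have hk : 2 * N - j.val ∈ Finset.Icc 1 (N - 1) := Finset.mem_Icc.2 ⟨by omega, by omega⟩
    have e : j = -((2 * N - j.val : ℕ) : ZMod (2 * N)) := by
      rw [← natCast_sub_half (by omega)]
      conv_lhs => rw [← ej]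
      congr 1
      omega
    rw [e, amplitude_neg, hb, main _ hk]

end Modes

/-! ### Symplectic shears. -/

section SympLemmas
variable {ι : Type} [Fintype ι]

theorem symp_add_left (a a' b : PhaseSpace ι) : symp (a + a') b = symp a b + symp a' b := by
  simp only [symp, ← Finset.sum_add_distrib, Prod.fst_add, Prod.snd_add, Pi.add_apply]
  exact Finset.sum_congr rfl fun i _ => by ring

theorem symp_smul_left (c : ℝ) (a b : PhaseSpace ι) : symp (c • a) b = c * symp a b := by
  simp only [symp, Finset.mul_sum, Prod.smul_fst, Prod.smul_snd, Pi.smul_apply, smul_eq_mul]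
  exact Finset.sum_congr rfl fun i _ => by ring

theorem symp_antisymm (a b : PhaseSpace ι) : symp a b = -symp b a := by
  simp only [symp, ← Finset.sum_neg_distrib]
  exact Finset.sum_congr rfl fun i _ => by ring

theorem symp_self (a : PhaseSpace ι) : symp a a = 0 := by
  have := symp_antisymm a a
  linarith

theorem symp_add_right (a b b' : PhaseSpace ι) : symp a (b + b') = symp a b + symp a b' := by
  rw [symp_antisymm, symp_add_left, symp_antisymm a, symp_antisymm a]; ring

theorem symp_smul_right (c : ℝ) (a b : PhaseSpace ι) : symp a (c • b) = c * symp a b := by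
  rw [symp_antisymm, symp_smul_left, symp_antisymm a]; ring

/-- The linear form `symp X`. -/
noncomputable def sympForm (X : PhaseSpace ι) : PhaseSpace ι →L[ℝ] ℝ :=
  LinearMap.toContinuousLinearMap
    { toFun := symp X
      map_add' := symp_add_right X
      map_smul' := fun c b => symp_smul_right c X b }

theorem sympForm_apply (X b : PhaseSpace ι) : sympForm X b = symp X b := rfl

/-- The time `c` map of the Hamiltonian flow of a multiple of `(symp X) ^ (d + 1)`. -/
noncomputable def shear (X : PhaseSpace ι) (d : ℕ) (c : ℝ) (w : PhaseSpace ι) : PhaseSpace ι :=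
  w + (c * sympForm X w ^ d) • X

/-- The form `symp X` does not change in the direction `X`, so the shear moves every point along a
line by an amount constant on that line, and reversing `c` undoes it. -/
theorem shear_shear (X : PhaseSpace ι) (d : ℕ) (c : ℝ) (w : PhaseSpace ι) :
    shear X d (-c) (shear X d c w) = w := by
  have : sympForm X (shear X d c w) = sympForm X w := by
    rw [shear, map_add, map_smul, sympForm_apply X X, symp_self]; simp
  rw [shear, this, shear, add_assoc, ← add_smul]
  simp

theorem contDiff_shear (X : PhaseSpace ι) (d : ℕ) (c : ℝ) : ContDiff ℝ ω (shear X d c) := by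
  unfold shear
  exact contDiff_id.add ((contDiff_const.mul ((sympForm X).contDiff.pow d)).smul contDiff_const)

/-- The derivative is a transvection `v ↦ v + κ ω(X, v) X`; the two mixed terms cancel by
antisymmetry. -/
theorem symp_fderiv_shear (X : PhaseSpace ι) (d : ℕ) (c : ℝ) (w a b : PhaseSpace ι) :
    symp (fderiv ℝ (shear X d c) w a) (fderiv ℝ (shear X d c) w b) = symp a b := by
  have h : HasFDerivAt (shear X d c) (ContinuousLinearMap.id ℝ (PhaseSpace ι) +
      ((c • ((d * sympForm X w ^ (d - 1)) • sympForm X)).smulRight X)) w := by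
    unfold shear
    refine (hasFDerivAt_id w).add ?_
    have h1 : HasFDerivAt (fun w => sympForm X w ^ d)
        ((d * sympForm X w ^ (d - 1)) • sympForm X) w := by
      have := (sympForm X).hasFDerivAt (x := w) |>.pow d
      simpa using this
    exact (h1.const_mul c).smul_const X
  rw [h.fderiv]
  set κ : ℝ := c * (d * sympForm X w ^ (d - 1))
  have e (v : PhaseSpace ι) : (ContinuousLinearMap.id ℝ (PhaseSpace ι) +
      ((c • ((d * sympForm X w ^ (d - 1)) • sympForm X)).smulRight X)) v
        = v + (κ * symp X v) • X := by
    simp [κ, sympForm_apply, mul_assoc]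
  rw [e, e, symp_add_left, symp_add_right, symp_add_right, symp_smul_left, symp_smul_left,
    symp_smul_right, symp_smul_right, symp_self, symp_antisymm a X]
  ring

end SympLemmas

/-! ### Canonical transformations tracked modulo degree five. -/

section Realization
open MvPolynomial
variable {N : ℕ} [NeZero N]

/-- Real analytic symplectic automorphisms of the space of normal modes that fix the origin. -/
structure SympAut (N : ℕ) where
  toEquiv : PhaseSpace (Mode N) ≃ PhaseSpace (Mode N)
  contDiff : ContDiff ℝ ω toEquiv
  contDiff_symm : ContDiff ℝ ω toEquiv.symm
  -- Required of the inverse, since the chart sends a point to its coordinates by `toEquiv.symm`.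
  symp_symm : ∀ w a b, symp (fderiv ℝ toEquiv.symm w a) (fderiv ℝ toEquiv.symm w b) = symp a b
  map_zero : toEquiv 0 = 0

/-- The identity as a symplectic automorphism. -/
def SympAut.refl (N : ℕ) : SympAut N where
  toEquiv := Equiv.refl _
  contDiff := contDiff_id
  contDiff_symm := contDiff_id
  symp_symm w a b := by
    change symp (fderiv ℝ id w a) (fderiv ℝ id w b) = _
    simp
  map_zero := rfl

/-- `T₁ ∘ T₂`. -/
def SympAut.comp (T₁ T₂ : SympAut N) : SympAut N where
  toEquiv := T₂.toEquiv.trans T₁.toEquiv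
  contDiff := T₁.contDiff.comp T₂.contDiff
  contDiff_symm := T₂.contDiff_symm.comp T₁.contDiff_symm
  symp_symm w a b := by
    change symp (fderiv ℝ (T₂.toEquiv.symm ∘ T₁.toEquiv.symm) w a)
      (fderiv ℝ (T₂.toEquiv.symm ∘ T₁.toEquiv.symm) w b) = _
    rw [fderiv_comp _ (T₂.contDiff_symm.differentiable (by simp) _)
      (T₁.contDiff_symm.differentiable (by simp) _)]
    exact (T₂.symp_symm _ _ _).trans (T₁.symp_symm _ _ _)
  map_zero := by simp [T₁.map_zero, T₂.map_zero]

/-- A shear as a symplectic automorphism. -/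
noncomputable def SympAut.ofShear (X : PhaseSpace (Mode N)) (d : ℕ) (hd : d ≠ 0) (c : ℝ) :
    SympAut N where
  toEquiv :=
    { toFun := shear X d c
      invFun := shear X d (-c)
      left_inv := shear_shear X d c
      right_inv := fun w => by simpa using shear_shear X d (-c) w }
  contDiff := contDiff_shear X d c
  contDiff_symm := contDiff_shear X d (-c)
  symp_symm := symp_fderiv_shear X d (-c)
  map_zero := by simp [shear, hd]

/-- Real linear forms in the amplitudes. -/
def IsRealLinear (f : Poly N) : Prop :=
  ∃ a : ZMod (2 * N) → ℂ, (∀ j, a (-j) = starRingEnd ℂ (a j)) ∧ f = ∑ j, C (a j) * X j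

theorem IsRealLinear.add {f g : Poly N} (hf : IsRealLinear f) (hg : IsRealLinear g) :
    IsRealLinear (f + g) := by
  obtain ⟨a, ha, rfl⟩ := hf
  obtain ⟨b, hb, rfl⟩ := hg
  refine ⟨a + b, fun j => by simp [ha, hb], ?_⟩
  simp [add_mul, Finset.sum_add_distrib]

theorem IsRealLinear.neg {f : Poly N} (hf : IsRealLinear f) : IsRealLinear (-f) := by
  obtain ⟨a, ha, rfl⟩ := hf
  refine ⟨-a, fun j => by simp [ha], ?_⟩
  simp

theorem IsRealLinear.sub {f g : Poly N} (hf : IsRealLinear f) (hg : IsRealLinear g) :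
    IsRealLinear (f - g) := by
  rw [sub_eq_add_neg]
  exact hf.add hg.neg

theorem IsRealLinear.mem_fil {f : Poly N} (hf : IsRealLinear f) : f ∈ fil _ 1 := by
  obtain ⟨a, ha, rfl⟩ := hf
  exact Submodule.sum_mem _ fun j _ => C_mul_mem_fil _ (X_mem_fil j)

theorem isRealLinear_single (c : ℂ) (j : ZMod (2 * N)) :
    IsRealLinear (C c * X j + C (starRingEnd ℂ c) * X (-j)) := by
  refine ⟨fun l => (if l = j then c else 0) + (if l = -j then starRingEnd ℂ c else 0), ?_, ?_⟩
  · intro l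
    have e1 : (-l = j) ↔ (l = -j) := neg_eq_iff_eq_neg
    have e2 : (-l = -j) ↔ (l = j) := neg_inj
    simp only [e1, e2, map_add]
    rw [add_comm]
    congr 1
    · split_ifs <;> simp
    · split_ifs <;> simp
  · simp only [C_add, add_mul, Finset.sum_add_distrib]
    congr 1
    · rw [Finset.sum_eq_single j] <;> simp +contextual
    · rw [Finset.sum_eq_single (-j)] <;> simp +contextual

theorem pb_X_linear (j : ZMod (2 * N)) (a : ZMod (2 * N) → ℂ) :
    pb (X j) (∑ l, C (a l) * X l) = C (Complex.I * sgn j * a (-j)) := by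
  rw [pb_X_left, map_sum, Finset.sum_eq_single (-j)]
  · rw [pderiv_C_mul, pderiv_X_self, mul_one, C_mul (a' := a (-j))]
  · intro l _ hl
    rw [pderiv_C_mul, pderiv_X_of_ne hl, mul_zero]
  · simp

theorem sgn_sq_mul_amplitude (w : PhaseSpace (Mode N)) (j : ZMod (2 * N)) :
    (sgn j : ℂ) ^ 2 * amplitude w j = amplitude w j := by
  by_cases h : sine j = 0
  · rcases sine_eq_zero h with rfl | rfl <;> simp
  · have : sgn j ^ 2 = 1 := by
      rcases lt_or_gt_of_ne h with h | h
      · rw [sgn, Real.sign_of_neg h]; norm_num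
      · rw [sgn, Real.sign_of_pos h]; norm_num
    have h2 : (sgn j : ℂ) ^ 2 = 1 := by exact_mod_cast this
    rw [h2, one_mul]

/-- The map of phase space and the substitution of variables given by the Hamiltonian flow of a
power of a real linear form. -/
theorem exists_shear {f : Poly N} (hf : IsRealLinear f) (c : ℝ) {d : ℕ} (hd : d ≠ 0) :
    ∃ T : SympAut N, ∀ g w, aeval (amplitude (T.toEquiv w)) g =
      aeval (amplitude w) (aeval (R := ℂ) (fun j => X j + pb (X j) (C (c : ℂ) * f ^ (d + 1))) g) := by
  obtain ⟨a, ha, rfl⟩ := hf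
  -- The amplitudes of `v` are the brackets `{X j, f}`, so `v` is the Hamiltonian vector field of
  -- `f`, and `f` takes the value `symp v w` at `w`.
  obtain ⟨v, hv⟩ := exists_amplitude_eq (N := N) (fun j => Complex.I * sgn j * a (-j))
    (fun j => by
      simp only [neg_neg, sgn_neg, map_mul, Complex.conj_I, Complex.conj_ofReal, ha,
        Complex.conj_conj]
      push_cast
      ring)
    (by simp [sgn_zero]) (by simp [sgn_half])
  have key (w : PhaseSpace (Mode N)) :
      aeval (amplitude w) (∑ j, C (a j) * X j : Poly N) = (symp v w : ℂ) := by
    rw [symp_eq_sum_amplitude, map_sum]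
    refine Fintype.sum_equiv (Equiv.neg _) _ _ fun j => ?_
    rw [map_mul, aeval_X, Equiv.neg_apply, neg_neg, hv, neg_neg, sgn_neg]
    simp only [algHom_C, Algebra.algebraMap_self, RingHom.id_apply]
    push_cast
    linear_combination (-a j) * sgn_sq_mul_amplitude w j
      + a j * sgn j ^ 2 * amplitude w j * Complex.I_sq
  -- The factor `d + 1` comes from `{X j, c f ^ (d + 1)} = c (d + 1) f ^ d {X j, f}`.
  refine ⟨SympAut.ofShear v d hd (c * (d + 1)), fun g w => ?_⟩
  change _ = ((aeval (amplitude w)).comp (aeval (R := ℂ) _)) g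
  congr 1
  refine algHom_ext fun j => ?_
  rw [AlgHom.comp_apply, aeval_X, aeval_X, map_add, aeval_X, pb_C_mul_right, pb_pow_right,
    pb_X_linear, map_mul, map_mul, map_mul, map_pow, key, ← hv]
  change amplitude (shear v d (c * (d + 1)) w) j = _
  rw [shear, amplitude_add, amplitude_smul, sympForm_apply]
  simp only [algHom_C, Algebra.algebraMap_self, RingHom.id_apply]
  push_cast
  ring

/-- `S` and `G` are generators of a canonical transformation `T` up to terms of high order. -/
def Realizes (S G : Poly N) : Prop :=
  ∃ (T : SympAut N) (τ : Poly N →ₐ[ℂ] Poly N),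
    (∀ g w, aeval (amplitude (T.toEquiv w)) g = aeval (amplitude w) (τ g)) ∧
    (∀ k f, f ∈ fil _ k → τ f - f - pb f S ∈ fil _ (k + 2)) ∧
    -- The Lie series of the quadratic Hamiltonian through degree four, for `S` of degree three and
    -- `G` of degree four.
    τ (quadratic N) - (quadratic N + rot S + C (1 / 2) * pb (rot S) S + rot G) ∈ fil _ 5

theorem realizes_zero : Realizes (0 : Poly N) 0 := by
  refine ⟨SympAut.refl N, AlgHom.id ℂ _, fun g w => rfl, fun k f _ => ?_, ?_⟩ <;> simp

theorem rot_mem_fil {k : ℕ} {f : Poly N} (hf : f ∈ fil _ k) : rot f ∈ fil _ k := by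
  have := derivation_mem_fil (m := 0) (rot (N := N)) (fun j => ?_) hf
  · simpa using this
  · rw [rot_X]; exact C_mul_mem_fil _ (X_mem_fil j)

/-- The Baker–Campbell–Hausdorff formula to second order: the bracket of two cubic generators is
quartic and joins `G`. Substitutions pull back, so they compose in the order opposite to the maps.
-/
theorem Realizes.comp {S₁ S₂ G₁ G₂ : Poly N} (h₁ : Realizes S₁ G₁) (h₂ : Realizes S₂ G₂)
    (hS₁ : S₁ ∈ fil _ 3) (hS₂ : S₂ ∈ fil _ 3) (hG₁ : G₁ ∈ fil _ 4) :
    Realizes (S₁ + S₂) (G₁ + G₂ + C (1 / 2) * pb S₁ S₂) := by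
  obtain ⟨T₁, τ₁, c₁, a₁, b₁⟩ := h₁
  obtain ⟨T₂, τ₂, c₂, a₂, b₂⟩ := h₂
  have pbS {S : Poly N} (hS : S ∈ fil _ 3) {k : ℕ} {f : Poly N} (hf : f ∈ fil _ k) :
      pb f S ∈ fil _ (k + 1) := pb_mem_fil hf (l := 1) hS
  have first {k : ℕ} {f : Poly N} (hf : f ∈ fil _ k) : τ₂ f - f ∈ fil _ (k + 1) := by
    have := add_mem (fil_mono (by omega) (a₂ k f hf)) (pbS hS₂ hf)
    simpa using this
  have zeroth {k : ℕ} {f : Poly N} (hf : f ∈ fil _ k) : τ₂ f ∈ fil _ k := by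
    have := add_mem (fil_mono (by omega) (first hf)) hf
    simpa using this
  refine ⟨T₁.comp T₂, τ₂.comp τ₁, fun g w => ?_, fun k f hf => ?_, ?_⟩
  · exact (c₁ g (T₂.toEquiv w)).trans (c₂ _ w)
  · have e1 := zeroth (a₁ k f hf)
    have e2 := a₂ k f hf
    have e3 := first (pbS hS₁ hf)
    rw [map_sub, map_sub] at e1
    rw [AlgHom.comp_apply, pb_add_right]
    convert add_mem (add_mem e1 e2) e3 using 1
    ring
  · have hr : rot S₁ ∈ fil _ 3 := rot_mem_fil hS₁
    have e1 := zeroth b₁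
    have e2 := a₂ 3 _ hr
    have e3 := first (C_mul_mem_fil (1 / 2) (pbS hS₁ hr))
    have e4 := first (rot_mem_fil hG₁)
    rw [map_sub, map_add, map_add, map_add] at e1
    rw [AlgHom.comp_apply]
    convert add_mem (add_mem (add_mem (add_mem e1 b₂) e2) e3) e4 using 1
    simp only [map_add, pb_add_left, pb_add_right, rot_C_mul, rot_pb]
    rw [pb_antisymm S₁ (rot S₂)]
    have h2 : (C (1 / 2) : Poly N) * 2 = 1 := by
      rw [show (2 : Poly N) = C 2 from (map_ofNat C 2).symm, ← C_mul]; simp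
    linear_combination (-(pb (rot S₁) S₂)) * h2

/-- Each `{X j, s}` is a constant times `f ^ d` and commutes with `s`. The Lie series of a variable
stops after the first bracket, and that of a product of two variables after the second. -/
theorem pow_shear_exact {f : Poly N} (hf : IsRealLinear f) (c : ℝ) {d : ℕ} (hd : d ≠ 0) :
    aeval (R := ℂ) (fun j => X j + pb (X j) (C (c : ℂ) * f ^ (d + 1))) (quadratic N) =
      quadratic N + rot (C (c : ℂ) * f ^ (d + 1)) +
        C (1 / 2) * pb (rot (C (c : ℂ) * f ^ (d + 1))) (C (c : ℂ) * f ^ (d + 1)) := by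
  set s : Poly N := C (c : ℂ) * f ^ (d + 1) with hs
  have hb (j : ZMod (2 * N)) : pb (pb (X j) s) s = 0 := by
    have hff : pb (f ^ d) f = 0 := by
      obtain ⟨m, rfl⟩ := Nat.exists_eq_succ_of_ne_zero hd
      rw [pb_antisymm, pb_pow_right, pb_self]; simp
    obtain ⟨a, ha, hfa⟩ := hf
    rw [hs, pb_C_mul_right, pb_C_mul_right, pb_C_mul_left, pb_pow_right, pb_pow_right,
      show pb (X j) f = C (Complex.I * sgn j * a (-j)) by rw [hfa, pb_X_linear],
      mul_comm (C (_ + 1) * f ^ d) (C (Complex.I * _ * _)), pb_C_mul_left, pb_C_mul_left, hff]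
    simp
  rw [← pb_quadratic, quadratic, map_sum, pb_sum_left, pb_sum_left, Finset.mul_sum,
    ← Finset.sum_add_distrib, ← Finset.sum_add_distrib]
  refine Finset.sum_congr rfl fun j _ => ?_
  have h2 : (C (1 / 2) : Poly N) * 2 = 1 := by
    rw [show (2 : Poly N) = C 2 from (map_ofNat C 2).symm, ← C_mul]; simp
  rw [map_mul, map_mul, aeval_X, aeval_X, algHom_C, pb_C_mul_left, pb_C_mul_left, pb_mul_left,
    pb_add_left, pb_mul_left, pb_mul_left, hb, hb, algebraMap_eq]
  linear_combination (-(C ((|sine j| : ℝ) : ℂ) * pb (X j) s * pb (X (-j)) s)) * h2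

theorem realizes_cube {f : Poly N} (hf : IsRealLinear f) (c : ℝ) :
    Realizes (C (c : ℂ) * f ^ 3) 0 := by
  obtain ⟨T, hT⟩ := exists_shear hf c (d := 2) (by norm_num)
  have hs : C (c : ℂ) * f ^ 3 ∈ fil _ 3 := C_mul_mem_fil _ (pow_mem_fil hf.mem_fil 3)
  refine ⟨T, _, hT, fun k g hg => ?_, ?_⟩
  · exact algHom_sub_mem_fil (pbRight (C (c : ℂ) * f ^ 3))
      (fun j => pb_mem_fil (k := 1) (l := 1) (X_mem_fil j) hs) hg
  · rw [pow_shear_exact hf c (by norm_num)]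
    simp

theorem realizes_fourth {f : Poly N} (hf : IsRealLinear f) (c : ℝ) :
    Realizes 0 (C (c : ℂ) * f ^ 4) := by
  obtain ⟨T, hT⟩ := exists_shear hf c (d := 3) (by norm_num)
  have hs : C (c : ℂ) * f ^ 4 ∈ fil _ 4 := C_mul_mem_fil _ (pow_mem_fil hf.mem_fil 4)
  refine ⟨T, _, hT, fun k g hg => ?_, ?_⟩
  · have h1 : aeval (R := ℂ) (fun j => X j + pb (X j) (C (c : ℂ) * f ^ 4)) g - g
        - pb g (C (c : ℂ) * f ^ 4) ∈ fil _ (k + 2) :=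
      algHom_sub_mem_fil (pbRight (C (c : ℂ) * f ^ 4))
      (fun j => fil_mono (by norm_num) (pb_mem_fil (k := 1) (l := 2) (X_mem_fil j) hs)) hg
    have h2 := pb_mem_fil hg (l := 2) hs
    have h3 := add_mem h1 h2
    rw [pb_zero_right, sub_zero]
    convert h3 using 1
    ring
  · rw [pow_shear_exact hf c (by norm_num)]
    have h := C_mul_mem_fil (1 / 2)
      (fil_mono (by norm_num : 5 ≤ 4 + 2) (pb_mem_fil (rot_mem_fil hs) (l := 2) hs))
    convert h using 1
    simp

end Realization

/-! ### Polarization: real forms as sums of powers of real linear forms. -/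

section RealSpan
open MvPolynomial
variable {N : ℕ} [NeZero N]

/-- Real linear combinations of `d`-th powers of real linear forms. -/
inductive RealSpan (d : ℕ) : Poly N → Prop
  | zero : RealSpan d 0
  | add_pow (g : Poly N) (c : ℝ) (f : Poly N) : RealSpan d g → IsRealLinear f →
      RealSpan d (g + C (c : ℂ) * f ^ d)

theorem RealSpan.pow {d : ℕ} {f : Poly N} (hf : IsRealLinear f) (c : ℝ) :
    RealSpan d (C (c : ℂ) * f ^ d) := by
  simpa using RealSpan.add_pow 0 c f .zero hf

theorem RealSpan.add {d : ℕ} {f g : Poly N} (hf : RealSpan d f) (hg : RealSpan d g) :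
    RealSpan d (f + g) := by
  induction hg with
  | zero => simpa
  | add_pow g c h _ hh ih => rw [← add_assoc]; exact .add_pow _ c h ih hh

theorem RealSpan.smul {d : ℕ} {f : Poly N} (hf : RealSpan d f) (r : ℝ) :
    RealSpan d (C (r : ℂ) * f) := by
  induction hf with
  | zero => rw [mul_zero]; exact .zero
  | add_pow g c h _ hh ih =>
    rw [mul_add, ← mul_assoc, ← C_mul, ← Complex.ofReal_mul]
    exact .add_pow _ _ h ih hh

theorem RealSpan.neg {d : ℕ} {f : Poly N} (hf : RealSpan d f) : RealSpan d (-f) := by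
  have := hf.smul (-1)
  simpa using this

theorem RealSpan.sub {d : ℕ} {f g : Poly N} (hf : RealSpan d f) (hg : RealSpan d g) :
    RealSpan d (f - g) := by
  rw [sub_eq_add_neg]
  exact hf.add hg.neg

theorem RealSpan.sum {d : ℕ} {ι : Type*} (s : Finset ι) {f : ι → Poly N}
    (h : ∀ i ∈ s, RealSpan d (f i)) : RealSpan d (∑ i ∈ s, f i) := by
  classical
  induction s using Finset.induction_on with
  | empty => exact .zero
  | insert a s ha ih =>
    rw [Finset.sum_insert ha]
    exact (h a (by simp)).add (ih fun i hi => h i (by simp [hi]))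

theorem RealSpan.mem_fil {d : ℕ} {f : Poly N} (hf : RealSpan d f) : f ∈ fil _ d := by
  induction hf with
  | zero => exact zero_mem _
  | add_pow g c f _ hf ih =>
    refine add_mem ih (C_mul_mem_fil _ ?_)
    simpa using pow_mem_fil hf.mem_fil d

theorem C_inv_mul_natCast {n : ℕ} (hn : n ≠ 0) : (C (((n : ℝ)⁻¹ : ℝ) : ℂ) : Poly N) * n = 1 := by
  rw [← map_natCast (C (R := ℂ) (σ := ZMod (2 * N))), ← C_mul]
  push_cast
  rw [inv_mul_cancel₀ (by exact_mod_cast hn), C_1]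

/-- Polarization. -/
theorem RealSpan.mul_three {a b c : Poly N} (ha : IsRealLinear a) (hb : IsRealLinear b)
    (hc : IsRealLinear c) : RealSpan 3 (a * b * c) := by
  have h (f : Poly N) (hf : IsRealLinear f) : RealSpan 3 (f ^ 3) := by
    simpa using RealSpan.pow (d := 3) hf 1
  have h2 := (((h _ ((ha.add hb).add hc)).sub (h _ ((ha.add hb).sub hc))).sub
    (h _ ((ha.sub hb).add hc))).sub (h _ ((hb.sub ha).add hc))
  -- Four sign patterns, each contributing `3!` times `a * b * c`.
  have h3 := h2.smul ((24 : ℕ) : ℝ)⁻¹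
  convert h3 using 1
  have e := C_inv_mul_natCast (N := N) (n := 24) (by norm_num)
  linear_combination (-(a * b * c)) * e

theorem RealSpan.mul_four {a b c d : Poly N} (ha : IsRealLinear a) (hb : IsRealLinear b)
    (hc : IsRealLinear c) (hd : IsRealLinear d) : RealSpan 4 (a * b * c * d) := by
  have h (f : Poly N) (hf : IsRealLinear f) : RealSpan 4 (f ^ 4) := by
    simpa using RealSpan.pow (d := 4) hf 1
  have h2 := ((h _ (((ha.add hb).add hc).add hd)).add (((h _ (((ha.add hb).sub hc).sub hd)).add
    (h _ (((ha.sub hb).add hc).sub hd))).add (h _ (((ha.sub hb).sub hc).add hd)))).sub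
    (((h _ (((ha.sub hb).add hc).add hd)).add (h _ (((ha.add hb).sub hc).add hd))).add
    ((h _ (((ha.add hb).add hc).sub hd)).add (h _ (((ha.sub hb).sub hc).sub hd))))
  -- Eight sign patterns, each contributing `4!` times the product.
  have h3 := h2.smul ((192 : ℕ) : ℝ)⁻¹
  convert h3 using 1
  have e := C_inv_mul_natCast (N := N) (n := 192) (by norm_num)
  linear_combination (-(a * b * c * d)) * e

theorem pb_isRealLinear {f g : Poly N} (hf : IsRealLinear f) (hg : IsRealLinear g) :
    ∃ r : ℝ, pb f g = C (r : ℂ) := by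
  obtain ⟨a, ha, rfl⟩ := hf
  obtain ⟨b, hb, rfl⟩ := hg
  have h : pb (∑ j, C (a j) * X j) (∑ j, C (b j) * X j : Poly N) =
      C (∑ j, a j * (Complex.I * sgn j * b (-j))) := by
    rw [pb_sum_left, map_sum]
    refine Finset.sum_congr rfl fun j _ => ?_
    rw [pb_C_mul_left, pb_X_linear, C_mul (a := a j)]
  rw [h]
  have hr : starRingEnd ℂ (∑ j, a j * (Complex.I * sgn j * b (-j)))
      = ∑ j, a j * (Complex.I * sgn j * b (-j)) := by
    rw [map_sum]
    refine Fintype.sum_equiv (Equiv.neg _) _ _ fun j => ?_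
    simp only [map_mul, Complex.conj_I, Complex.conj_ofReal, Equiv.neg_apply, neg_neg, sgn_neg,
      ha, hb, Complex.conj_conj]
    push_cast
    ring
  obtain ⟨r, hr⟩ := Complex.conj_eq_iff_real.1 hr
  exact ⟨r, by rw [hr]⟩

/-- From `{h³, f³} = 9 h² f² {h, f}` with a real constant `{h, f}`: the correction terms in
`Realizes.comp` remain real quartic forms. -/
theorem RealSpan.pb_cube {g f : Poly N} (hg : RealSpan 3 g) (hf : IsRealLinear f) (c : ℝ) :
    RealSpan 4 (pb g (C (c : ℂ) * f ^ 3)) := by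
  induction hg with
  | zero => rw [pb_zero_left]; exact .zero
  | add_pow g c' h _ hh ih =>
    rw [pb_add_left]
    refine ih.add ?_
    obtain ⟨r, hr⟩ := pb_isRealLinear hh hf
    have hr' : pb f h = -C (r : ℂ) := by rw [pb_antisymm, hr]
    have := (RealSpan.mul_four hh hh hf hf).smul (9 * c' * c * r)
    convert this using 1
    rw [pb_C_mul_left, pb_C_mul_right, pb_pow_right, pb_antisymm, pb_pow_right, hr']
    push_cast
    simp only [C_mul, C_add, map_ofNat, C_1]
    ring

/-- The quartic generator is whatever the commutators of the cubic shears leave behind;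
`realizes_of_realSpan` corrects it to the prescribed one by quartic shears. -/
theorem Realizes.exists_of_cubic {S : Poly N} (hS : RealSpan 3 S) :
    ∃ G, RealSpan 4 G ∧ Realizes S G := by
  induction hS with
  | zero => exact ⟨0, .zero, realizes_zero⟩
  | add_pow g c f hg hf ih =>
    obtain ⟨G, hG, h⟩ := ih
    have h2 := h.comp (realizes_cube hf c) hg.mem_fil
      (C_mul_mem_fil _ (pow_mem_fil hf.mem_fil 3)) hG.mem_fil
    refine ⟨_, ?_, h2⟩
    rw [add_zero]
    have := (hg.pb_cube hf c).smul (1 / 2)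
    push_cast at this
    exact hG.add this

theorem Realizes.add_quartic {S G G' : Poly N} (hS : RealSpan 3 S) (hG : RealSpan 4 G)
    (h : Realizes S G) (hG' : RealSpan 4 G') : Realizes S (G + G') := by
  induction hG' with
  | zero => rwa [add_zero]
  | add_pow g c f hg hf ih =>
    have := ih.comp (realizes_fourth hf c) hS.mem_fil (zero_mem _) (hG.add hg).mem_fil
    simpa [add_assoc] using this

/-- Real generators of degree three and four are realized by canonical transformations. -/
theorem realizes_of_realSpan {S G : Poly N} (hS : RealSpan 3 S) (hG : RealSpan 4 G) :
    Realizes S G := by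
  obtain ⟨G₀, hG₀, h⟩ := Realizes.exists_of_cubic hS
  have := h.add_quartic hS hG₀ (hG.sub hG₀)
  simpa using this

/-- Twice the real and imaginary parts of a variable with a coefficient. -/
theorem exists_real_imag (c : ℂ) (j : ZMod (2 * N)) : ∃ A B : Poly N, IsRealLinear A ∧
    IsRealLinear B ∧ 2 * (C c * X j) = A - C Complex.I * B ∧
      2 * (C (starRingEnd ℂ c) * X (-j)) = A + C Complex.I * B := by
  refine ⟨_, _, isRealLinear_single c j, isRealLinear_single (Complex.I * c) j, ?_, ?_⟩
  all_goals
    have hI : (C Complex.I * C Complex.I : Poly N) = -1 := by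
      rw [← C_mul, Complex.I_mul_I, C_neg, C_1]
    rw [map_mul (starRingEnd ℂ), Complex.conj_I, C_mul, C_mul, C_neg]
  · linear_combination (C c * X j - C (starRingEnd ℂ c) * X (-j)) * hI
  · linear_combination (-(C c * X j) + C (starRingEnd ℂ c) * X (-j)) * hI

/-- A product of factors `A - i B` plus its conjugate is twice its real part, which contains the
products with an even number of `B`'s; each of them is handled by polarization. -/
theorem RealSpan.cubic_re (c : ℂ) (i j k : ZMod (2 * N)) : RealSpan 3
    (C c * (X i * X j * X k) + C (starRingEnd ℂ c) * (X (-i) * X (-j) * X (-k)) : Poly N) := by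
  obtain ⟨A, B, hA, hB, h1, h1'⟩ := exists_real_imag c i
  obtain ⟨A', B', hA', hB', h2, h2'⟩ := exists_real_imag 1 j
  obtain ⟨A'', B'', hA'', hB'', h3, h3'⟩ := exists_real_imag 1 k
  rw [map_one] at h2' h3'
  rw [C_1, one_mul] at h2 h2' h3 h3'
  have := (((RealSpan.mul_three hA hA' hA'').sub ((RealSpan.mul_three hA hB' hB'').add
    ((RealSpan.mul_three hB hA' hB'').add (RealSpan.mul_three hB hB' hA''))))).smul ((4 : ℕ) : ℝ)⁻¹
  convert this using 1
  have e := C_inv_mul_natCast (N := N) (n := 4) (by norm_num)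
  have hI : (C Complex.I * C Complex.I : Poly N) = -1 := by
    rw [← C_mul, Complex.I_mul_I, C_neg, C_1]
  have e1 : (2 * (C c * X i)) * (2 * X j) * (2 * X k) +
      (2 * (C (starRingEnd ℂ c) * X (-i))) * (2 * X (-j)) * (2 * X (-k)) =
      2 * (A * A' * A'' - (A * B' * B'' + (B * A' * B'' + B * B' * A''))) := by
    rw [h1, h2, h3, h1', h2', h3']
    linear_combination 2 * (A * B' * B'' + (B * A' * B'' + B * B' * A'')) * hI
  have e2 : (2 : Poly N) * (((4 : ℕ) : Poly N) * (C c * (X i * X j * X k)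
      + C (starRingEnd ℂ c) * (X (-i) * X (-j) * X (-k)))) =
      2 * (A * A' * A'' - (A * B' * B'' + (B * A' * B'' + B * B' * A''))) := by
    rw [← e1]; push_cast; ring
  have e3 := mul_left_cancel₀ two_ne_zero e2
  rw [← e3]
  linear_combination (-(C c * (X i * X j * X k) +
    C (starRingEnd ℂ c) * (X (-i) * X (-j) * X (-k)))) * e

theorem RealSpan.quartic_re (c : ℂ) (i j k l : ZMod (2 * N)) : RealSpan 4
    (C c * (X i * X j * X k * X l) +
      C (starRingEnd ℂ c) * (X (-i) * X (-j) * X (-k) * X (-l)) : Poly N) := by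
  obtain ⟨A, B, hA, hB, h1, h1'⟩ := exists_real_imag c i
  obtain ⟨A', B', hA', hB', h2, h2'⟩ := exists_real_imag 1 j
  obtain ⟨A'', B'', hA'', hB'', h3, h3'⟩ := exists_real_imag 1 k
  obtain ⟨D, E, hD, hE, h4, h4'⟩ := exists_real_imag 1 l
  rw [map_one] at h2' h3' h4'
  rw [C_1, one_mul] at h2 h2' h3 h3' h4 h4'
  have m {a b c d : Poly N} (ha : IsRealLinear a) (hb : IsRealLinear b)
    (hc : IsRealLinear c) (hd : IsRealLinear d) := RealSpan.mul_four ha hb hc hd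
  have := (((m hA hA' hA'' hD).add (m hB hB' hB'' hE)).sub ((((m hA hA' hB'' hE).add
    (m hA hB' hA'' hE)).add (m hA hB' hB'' hD)).add (((m hB hA' hA'' hE).add
    (m hB hA' hB'' hD)).add (m hB hB' hA'' hD)))).smul ((8 : ℕ) : ℝ)⁻¹
  convert this using 1
  have e := C_inv_mul_natCast (N := N) (n := 8) (by norm_num)
  have hI : (C Complex.I * C Complex.I : Poly N) = -1 := by
    rw [← C_mul, Complex.I_mul_I, C_neg, C_1]
  set Y : Poly N := A * A' * A'' * D + B * B' * B'' * E - (A * A' * B'' * E + A * B' * A'' * E +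
    A * B' * B'' * D + (B * A' * A'' * E + B * A' * B'' * D + B * B' * A'' * D)) with hY
  have e1 : (2 * (C c * X i)) * (2 * X j) * (2 * X k) * (2 * X l) +
      (2 * (C (starRingEnd ℂ c) * X (-i))) * (2 * X (-j)) * (2 * X (-k)) * (2 * X (-l)) =
      2 * Y := by
    rw [h1, h2, h3, h1', h2', h3', h4, h4']
    have hI4 : (C Complex.I * C Complex.I * C Complex.I * C Complex.I : Poly N) = 1 := by
      rw [hI, mul_assoc, hI]; ring
    linear_combination 2 * (A * A' * B'' * E + A * B' * A'' * E +
      A * B' * B'' * D + (B * A' * A'' * E + B * A' * B'' * D + B * B' * A'' * D)) * hI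
      + 2 * B * B' * B'' * E * hI4
  have e2 : (2 : Poly N) * (((8 : ℕ) : Poly N) * (C c * (X i * X j * X k * X l)
      + C (starRingEnd ℂ c) * (X (-i) * X (-j) * X (-k) * X (-l)))) = 2 * Y := by
    rw [← e1]; push_cast; ring
  have e3 := mul_left_cancel₀ two_ne_zero e2
  rw [← e3]
  linear_combination (-(C c * (X i * X j * X k * X l) +
    C (starRingEnd ℂ c) * (X (-i) * X (-j) * X (-k) * X (-l)))) * e

theorem RealSpan.of_two_mul {d : ℕ} {f : Poly N} (h : RealSpan d (f + f)) : RealSpan d f := by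
  have := h.smul ((2 : ℕ) : ℝ)⁻¹
  convert this using 1
  linear_combination (-f) * C_inv_mul_natCast (N := N) (n := 2) (by norm_num)

/-- Cubic forms with real values are combinations of cubes of real linear forms. -/
theorem realSpan_cubic (c : ZMod (2 * N) × ZMod (2 * N) × ZMod (2 * N) → ℂ)
    (hc : ∀ p, c (-p) = starRingEnd ℂ (c p)) :
    RealSpan 3 (∑ p, C (c p) * (X p.1 * X p.2.1 * X p.2.2) : Poly N) := by
  refine RealSpan.of_two_mul ?_
  have : ∑ p, C (c p) * (X p.1 * X p.2.1 * X p.2.2) =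
      ∑ p, (C (starRingEnd ℂ (c p)) * (X (-p.1) * X (-p.2.1) * X (-p.2.2)) : Poly N) := by
    refine Fintype.sum_equiv (Equiv.neg _) _ _ fun p => ?_
    simp only [Equiv.neg_apply, hc, Complex.conj_conj, Prod.fst_neg, Prod.snd_neg, neg_neg]
  nth_rewrite 2 [this]
  rw [← Finset.sum_add_distrib]
  exact RealSpan.sum _ fun p _ => RealSpan.cubic_re _ _ _ _

/-- Quartic forms with real values are combinations of fourth powers of real linear forms. -/
theorem realSpan_quartic (c : ZMod (2 * N) × ZMod (2 * N) × ZMod (2 * N) × ZMod (2 * N) → ℂ)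
    (hc : ∀ p, c (-p) = starRingEnd ℂ (c p)) :
    RealSpan 4 (∑ p, C (c p) * (X p.1 * X p.2.1 * X p.2.2.1 * X p.2.2.2) : Poly N) := by
  refine RealSpan.of_two_mul ?_
  have : ∑ p, C (c p) * (X p.1 * X p.2.1 * X p.2.2.1 * X p.2.2.2) =
      ∑ p, (C (starRingEnd ℂ (c p)) *
        (X (-p.1) * X (-p.2.1) * X (-p.2.2.1) * X (-p.2.2.2)) : Poly N) := by
    refine Fintype.sum_equiv (Equiv.neg _) _ _ fun p => ?_
    simp only [Equiv.neg_apply, hc, Complex.conj_conj, Prod.fst_neg, Prod.snd_neg, neg_neg]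
  nth_rewrite 2 [this]
  rw [← Finset.sum_add_distrib]
  exact RealSpan.sum _ fun p _ => RealSpan.quartic_re _ _ _ _ _

end RealSpan

/-! ### Removal of the cubic and of the nonresonant quartic terms. -/

section Hamiltonian
open MvPolynomial
variable {N : ℕ} [NeZero N]

/-- `√|sin (π j / N)|`. -/
noncomputable def rootSine (j : ZMod (2 * N)) : ℝ := Real.sqrt |sine j|

theorem rootSine_sq (j : ZMod (2 * N)) : rootSine j ^ 2 = |sine j| := Real.sq_sqrt (abs_nonneg _)

theorem rootSine_neg (j : ZMod (2 * N)) : rootSine (-j) = rootSine j := by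
  rw [rootSine, sine_neg, abs_neg, rootSine]

theorem rootSine_add_half (j : ZMod (2 * N)) :
    rootSine (j + (N : ZMod (2 * N))) = rootSine j := by
  rw [rootSine, sine_add_half, abs_neg, rootSine]

theorem rootSine_eq_zero {j : ZMod (2 * N)} (h : sine j = 0) : rootSine j = 0 := by
  simp [rootSine, h]

/-- The sign `1` or `-1` of a process that preserves the wave number up to a multiple `0` or `1`
modulo `2` of `N`, and `0` if the wave number is not preserved modulo `N`. -/
noncomputable def wind (J : ZMod (2 * N)) : ℝ :=
  if J = 0 then 1 else if J = (N : ZMod (2 * N)) then -1 else 0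

theorem wind_zero : wind (0 : ZMod (2 * N)) = 1 := by simp [wind]

theorem wind_half : wind (N : ZMod (2 * N)) = -1 := by simp [wind, half_ne_zero]

theorem wind_neg (J : ZMod (2 * N)) : wind (-J) = wind J := by
  have e : -J = (N : ZMod (2 * N)) ↔ J = (N : ZMod (2 * N)) := by
    rw [neg_eq_iff_eq_neg, neg_half]
  simp only [wind, neg_eq_zero, e]

theorem wind_add_half (J : ZMod (2 * N)) : wind (J + (N : ZMod (2 * N))) = -wind J := by
  by_cases h0 : J = 0
  · rw [h0, zero_add, wind_half, wind_zero]
  by_cases h1 : J = (N : ZMod (2 * N))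
  · rw [h1, half_add_half, wind_half, wind_zero, neg_neg]
  have h2 : J + (N : ZMod (2 * N)) ≠ 0 := by
    intro h
    exact h1 (by rw [eq_neg_of_add_eq_zero_left h, neg_half])
  have h3 : J + (N : ZMod (2 * N)) ≠ (N : ZMod (2 * N)) := by simpa using h0
  simp [wind, h0, h1, h2, h3]

theorem wind_ne_zero {J : ZMod (2 * N)} (h : wind J ≠ 0) : J = 0 ∨ J = (N : ZMod (2 * N)) := by
  by_contra hh
  rw [not_or] at hh
  exact h (by simp [wind, hh.1, hh.2])

theorem sum_wind {A : Type*} [AddCommGroup A] [Module ℝ A] (p : ZMod (2 * N))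
    (G : ZMod (2 * N) → A) :
    ∑ j, wind (p + j) • G j = G (-p) - G (-p + (N : ZMod (2 * N))) := by
  have h (j : ZMod (2 * N)) : wind (p + j) • G j = (if j = -p then G (-p) else 0) -
      (if j = -p + (N : ZMod (2 * N)) then G (-p + (N : ZMod (2 * N))) else 0) := by
    by_cases h1 : j = -p
    · subst h1
      simp [wind_zero, half_ne_zero]
    by_cases h2 : j = -p + (N : ZMod (2 * N))
    · subst h2
      simp [wind_half, half_ne_zero]
    · have h3 : wind (p + j) = 0 := by
        by_contra h3
        rcases wind_ne_zero h3 with h4 | h4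
        · exact h1 (by linear_combination h4)
        · exact h2 (by linear_combination h4)
      simp [h1, h2, h3]
  simp only [h, Finset.sum_sub_distrib, Finset.sum_ite_eq', Finset.mem_univ, if_true]

/-- Triples of modes. -/
abbrev Triple (N : ℕ) : Type := ZMod (2 * N) × ZMod (2 * N) × ZMod (2 * N)

/-- Quadruples of modes. -/
abbrev Quad (N : ℕ) : Type := ZMod (2 * N) × ZMod (2 * N) × ZMod (2 * N) × ZMod (2 * N)

/-- The cubic form with coefficients `c`. -/
noncomputable def cubicForm (c : Triple N → ℂ) : Poly N :=
  ∑ p, C (c p) * (X p.1 * X p.2.1 * X p.2.2)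

/-- The quartic form with coefficients `c`. -/
noncomputable def quarticForm (c : Quad N → ℂ) : Poly N :=
  ∑ p, C (c p) * (X p.1 * X p.2.1 * X p.2.2.1 * X p.2.2.2)

theorem cubicForm_mem_fil (c : Triple N → ℂ) : cubicForm c ∈ fil _ 3 := by
  rw [cubicForm]
  refine Submodule.sum_mem _ fun p _ => C_mul_mem_fil _ ?_
  have h := mul_mem_fil (mul_mem_fil (X_mem_fil p.1) (X_mem_fil p.2.1)) (X_mem_fil p.2.2)
  exact h

theorem quarticForm_mem_fil (c : Quad N → ℂ) : quarticForm c ∈ fil _ 4 := by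
  rw [quarticForm]
  refine Submodule.sum_mem _ fun p _ => C_mul_mem_fil _ ?_
  have h := mul_mem_fil (mul_mem_fil (mul_mem_fil (X_mem_fil p.1) (X_mem_fil p.2.1))
    (X_mem_fil p.2.2.1)) (X_mem_fil p.2.2.2)
  exact h

theorem rot_cubicForm (c : Triple N → ℂ) : rot (cubicForm c) =
    cubicForm fun p => c p * -(2 * Complex.I * (sine p.1 + sine p.2.1 + sine p.2.2 : ℝ)) := by
  rw [cubicForm, cubicForm, map_sum]
  refine Finset.sum_congr rfl fun p _ => ?_
  rw [rot_C_mul, Derivation.leibniz, Derivation.leibniz, rot_X, rot_X, rot_X, C_mul (a := c p)]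
  simp only [smul_eq_mul, Complex.ofReal_add, mul_add, neg_add, C_add]
  ring

theorem rot_quarticForm (c : Quad N → ℂ) : rot (quarticForm c) =
    quarticForm fun p => c p *
      -(2 * Complex.I * (sine p.1 + sine p.2.1 + sine p.2.2.1 + sine p.2.2.2 : ℝ)) := by
  rw [quarticForm, quarticForm, map_sum]
  refine Finset.sum_congr rfl fun p _ => ?_
  rw [rot_C_mul, Derivation.leibniz, Derivation.leibniz, Derivation.leibniz, rot_X, rot_X, rot_X,
    rot_X, C_mul (a := c p)]
  simp only [smul_eq_mul, Complex.ofReal_add, mul_add, neg_add, C_add]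
  ring

theorem pb_cubicForm_left (c : Triple N → ℂ) (h1 : ∀ i j k, c (i, j, k) = c (i, k, j))
    (h2 : ∀ i j k, c (i, j, k) = c (k, j, i)) (g : Poly N) :
    pb (cubicForm c) g = ∑ i, ∑ j, ∑ k, C (3 * c (i, j, k)) * (X i * X j * pb (X k) g) := by
  have e : pb (cubicForm c) g = ∑ i, ∑ j, ∑ k, (C (c (i, j, k)) * (X i * X j * pb (X k) g) +
      C (c (i, j, k)) * (X i * X k * pb (X j) g) + C (c (i, j, k)) * (X j * X k * pb (X i) g)) := by
    rw [cubicForm, pb_sum_left, Fintype.sum_prod_type]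
    refine Finset.sum_congr rfl fun i _ => ?_
    rw [Fintype.sum_prod_type]
    refine Finset.sum_congr rfl fun j _ => Finset.sum_congr rfl fun k _ => ?_
    rw [pb_C_mul_left, pb_mul_left, pb_mul_left]
    ring
  have e2 : ∑ i, ∑ j, ∑ k, C (c (i, j, k)) * (X i * X k * pb (X j) g) =
      ∑ i, ∑ j, ∑ k, C (c (i, j, k)) * (X i * X j * pb (X k) g) := by
    refine Finset.sum_congr rfl fun i _ => ?_
    rw [Finset.sum_comm]
    refine Finset.sum_congr rfl fun j _ => Finset.sum_congr rfl fun k _ => ?_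
    rw [h1]
  have e3 : ∑ i, ∑ j, ∑ k, C (c (i, j, k)) * (X j * X k * pb (X i) g) =
      ∑ i, ∑ j, ∑ k, C (c (i, j, k)) * (X i * X j * pb (X k) g) := by
    have s1 : ∑ i, ∑ j, ∑ k, C (c (i, j, k)) * (X j * X k * pb (X i) g) =
        ∑ i, ∑ k, ∑ j, C (c (i, j, k)) * (X j * X k * pb (X i) g) :=
      Finset.sum_congr rfl fun i _ => Finset.sum_comm
    rw [s1, Finset.sum_comm]
    refine Finset.sum_congr rfl fun i _ => ?_
    rw [Finset.sum_comm]
    refine Finset.sum_congr rfl fun j _ => Finset.sum_congr rfl fun k _ => ?_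
    rw [h2]
    ring
  rw [e]
  simp only [Finset.sum_add_distrib]
  rw [e2, e3]
  simp only [← Finset.sum_add_distrib]
  refine Finset.sum_congr rfl fun i _ => Finset.sum_congr rfl fun j _ =>
    Finset.sum_congr rfl fun k _ => ?_
  rw [C_mul, show (C (3 : ℂ) : Poly N) = 3 from map_ofNat C 3]
  ring

theorem pb_X_X (k l : ZMod (2 * N)) :
    pb (X k) (X l : Poly N) = if l = -k then C (Complex.I * sgn k) else 0 := by
  rw [pb_X_left, pderiv_X, Pi.single_apply]
  split_ifs <;> simp

/-- One variable of each factor is contracted, `X j` with `X (-j)`; by symmetry there are `3 * 3`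
equal choices. -/
theorem pb_cubicForm (c d : Triple N → ℂ) (hc1 : ∀ i j k, c (i, j, k) = c (i, k, j))
    (hc2 : ∀ i j k, c (i, j, k) = c (k, j, i)) (hd1 : ∀ i j k, d (i, j, k) = d (i, k, j))
    (hd2 : ∀ i j k, d (i, j, k) = d (k, j, i)) :
    pb (cubicForm c) (cubicForm d) = quarticForm fun p =>
      9 * Complex.I * ∑ j, sgn j * (c (p.1, p.2.1, j) * d (p.2.2.1, p.2.2.2, -j)) := by
  have inner (k : ZMod (2 * N)) : pb (X k) (cubicForm d) =
      ∑ l, ∑ m, C (3 * d (l, m, -k) * (Complex.I * sgn k)) * (X l * X m) := by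
    rw [pb_antisymm, pb_cubicForm_left d hd1 hd2, ← Finset.sum_neg_distrib]
    refine Finset.sum_congr rfl fun l _ => ?_
    rw [← Finset.sum_neg_distrib]
    refine Finset.sum_congr rfl fun m _ => ?_
    rw [Finset.sum_eq_single (-k)]
    · rw [pb_antisymm, pb_X_X, if_pos rfl, C_mul (a := 3 * d (l, m, -k))]
      ring
    · intro n _ hn
      rw [pb_antisymm, pb_X_X, if_neg hn]
      simp
    · simp
  rw [pb_cubicForm_left c hc1 hc2, quarticForm, Fintype.sum_prod_type]
  refine Finset.sum_congr rfl fun i _ => ?_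
  rw [Fintype.sum_prod_type]
  refine Finset.sum_congr rfl fun j _ => ?_
  rw [Fintype.sum_prod_type]
  simp only [inner, Finset.mul_sum]
  rw [Finset.sum_comm]
  refine Finset.sum_congr rfl fun l _ => ?_
  rw [Finset.sum_comm]
  refine Finset.sum_congr rfl fun m _ => ?_
  rw [map_sum, Finset.sum_mul]
  refine Finset.sum_congr rfl fun k _ => ?_
  have : (C (9 * Complex.I * (sgn k * (c (i, j, k) * d (l, m, -k)))) : Poly N) =
      C (3 * c (i, j, k)) * C (3 * d (l, m, -k) * (Complex.I * sgn k)) := by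
    rw [← C_mul]
    congr 1
    ring
  rw [this]
  ring

/-- The coefficients of the cubic part of the Hamiltonian. -/
noncomputable def cubicCoeff (p : Triple N) : ℝ :=
  wind (p.1 + p.2.1 + p.2.2) * (rootSine p.1 * rootSine p.2.1 * rootSine p.2.2)

/-- The coefficients of the quartic part of the Hamiltonian. -/
noncomputable def quarticCoeff (p : Quad N) : ℝ :=
  wind (p.1 + p.2.1 + p.2.2.1 + p.2.2.2) *
    (rootSine p.1 * rootSine p.2.1 * rootSine p.2.2.1 * rootSine p.2.2.2)

/-- The sum of the (half) frequencies of a triple. -/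
noncomputable def tripleFreq (p : Triple N) : ℝ := sine p.1 + sine p.2.1 + sine p.2.2

/-- The sum of the (half) frequencies of a quadruple. -/
noncomputable def quadFreq (p : Quad N) : ℝ := sine p.1 + sine p.2.1 + sine p.2.2.1 + sine p.2.2.2

theorem tripleFreq_ne_zero {p : Triple N} (h : cubicCoeff p ≠ 0) : tripleFreq p ≠ 0 := by
  rw [cubicCoeff, mul_ne_zero_iff, mul_ne_zero_iff, mul_ne_zero_iff] at h
  exact sine_add_three_ne_zero (fun h0 => h.2.1.1 (rootSine_eq_zero h0))
    (fun h0 => h.2.1.2 (rootSine_eq_zero h0)) (fun h0 => h.2.2 (rootSine_eq_zero h0))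
    (wind_ne_zero h.1)

theorem cubicCoeff_neg (p : Triple N) : cubicCoeff (-p) = cubicCoeff p := by
  have e : -p.1 + -p.2.1 + -p.2.2 = -(p.1 + p.2.1 + p.2.2) := by ring
  simp only [cubicCoeff, Prod.fst_neg, Prod.snd_neg, rootSine_neg, e, wind_neg]

theorem quarticCoeff_neg (p : Quad N) : quarticCoeff (-p) = quarticCoeff p := by
  have e : -p.1 + -p.2.1 + -p.2.2.1 + -p.2.2.2 = -(p.1 + p.2.1 + p.2.2.1 + p.2.2.2) := by ring
  simp only [quarticCoeff, Prod.fst_neg, Prod.snd_neg, rootSine_neg, e, wind_neg]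

theorem tripleFreq_neg (p : Triple N) : tripleFreq (-p) = -tripleFreq p := by
  simp only [tripleFreq, Prod.fst_neg, Prod.snd_neg, sine_neg]; ring

theorem quadFreq_neg (p : Quad N) : quadFreq (-p) = -quadFreq p := by
  simp only [quadFreq, Prod.fst_neg, Prod.snd_neg, sine_neg]; ring

/-- The second order contribution of the cubic part of the Hamiltonian. -/
noncomputable def kappa (p : Quad N) : ℝ :=
  (1 / 2) * (sine (p.1 + p.2.1) / (sine p.2.2.1 + sine p.2.2.2 - sine (p.1 + p.2.1))
    - sine (p.1 + p.2.1) / (sine p.2.2.1 + sine p.2.2.2 + sine (p.1 + p.2.1)))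

theorem kappa_neg (p : Quad N) : kappa (-p) = kappa p := by
  have e : -p.1 + -p.2.1 = -(p.1 + p.2.1) := by ring
  simp only [kappa, Prod.fst_neg, Prod.snd_neg, sine_neg, e]
  rw [show -sine p.2.2.1 + -sine p.2.2.2 - -sine (p.1 + p.2.1)
    = -(sine p.2.2.1 + sine p.2.2.2 - sine (p.1 + p.2.1)) by ring,
    show -sine p.2.2.1 + -sine p.2.2.2 + -sine (p.1 + p.2.1)
    = -(sine p.2.2.1 + sine p.2.2.2 + sine (p.1 + p.2.1)) by ring, neg_div_neg_eq, neg_div_neg_eq]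

theorem kappa_of_quadFreq_eq_zero {p : Quad N} (h : quadFreq p = 0) :
    kappa p = exchange p.1 p.2.1 := by
  rw [quadFreq] at h
  rw [kappa, exchange, show sine p.2.2.1 + sine p.2.2.2 = -(sine p.1 + sine p.2.1) by linarith]

/-- The generating function that removes the cubic terms. -/
noncomputable def cubicGen (a : ℝ) : Poly N :=
  cubicForm fun p => ((a * cubicCoeff p : ℝ) : ℂ) / (2 * Complex.I * tripleFreq p)

theorem rot_cubicGen (a : ℝ) :
    rot (cubicGen a : Poly N) = -cubicForm fun p => ((a * cubicCoeff p : ℝ) : ℂ) := by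
  rw [cubicGen, rot_cubicForm, cubicForm, cubicForm, ← Finset.sum_neg_distrib]
  refine Finset.sum_congr rfl fun p _ => ?_
  have e : ((a * cubicCoeff p : ℝ) : ℂ) / (2 * Complex.I * tripleFreq p) *
      -(2 * Complex.I * (sine p.1 + sine p.2.1 + sine p.2.2 : ℝ)) =
      -((a * cubicCoeff p : ℝ) : ℂ) := by
    by_cases h : cubicCoeff p = 0
    · simp [h]
    · have h1 : (tripleFreq p : ℂ) ≠ 0 := by exact_mod_cast tripleFreq_ne_zero h
      have h2 := Complex.I_ne_zero
      rw [tripleFreq] at h1 ⊢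
      field_simp
  rw [e, C_neg, neg_mul]

theorem realSpan_cubicGen (a : ℝ) : RealSpan 3 (cubicGen a : Poly N) := by
  refine realSpan_cubic _ fun p => ?_
  rw [cubicCoeff_neg, tripleFreq_neg, map_div₀, map_mul, map_mul, Complex.conj_I,
    Complex.conj_ofReal, Complex.conj_ofReal, Complex.conj_ofNat]
  push_cast
  congr 1
  ring

/-- Conservation of the index at both vertices leaves two values for the contracted mode, `-(p.1 +
p.2.1)` and its shift by `N`. They yield the two fractions in `kappa`. -/
theorem sum_exchange (p : Quad N) :
    ∑ j, wind (p.1 + p.2.1 + j) * (wind (p.2.2.1 + p.2.2.2 + -j) * (sine j /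
      (sine p.2.2.1 + sine p.2.2.2 + sine (-j)))) =
      wind (p.1 + p.2.1 + p.2.2.1 + p.2.2.2) * (2 * kappa p) := by
  have h := sum_wind (p.1 + p.2.1) fun j => wind (p.2.2.1 + p.2.2.2 + -j) * (sine j /
      (sine p.2.2.1 + sine p.2.2.2 + sine (-j)))
  simp only [smul_eq_mul] at h
  rw [h]
  have e1 : p.2.2.1 + p.2.2.2 + - -(p.1 + p.2.1) = p.1 + p.2.1 + p.2.2.1 + p.2.2.2 := by ring
  have e2 : p.2.2.1 + p.2.2.2 + -(-(p.1 + p.2.1) + (N : ZMod (2 * N))) =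
      p.1 + p.2.1 + p.2.2.1 + p.2.2.2 + (N : ZMod (2 * N)) := by
    linear_combination -half_add_half (N := N)
  have e3 : sine (-(p.1 + p.2.1) + (N : ZMod (2 * N))) = sine (p.1 + p.2.1) := by
    rw [sine_add_half, sine_neg, neg_neg]
  rw [e1, e2, wind_add_half, sine_neg (-(p.1 + p.2.1) + (N : ZMod (2 * N))), e3,
    sine_neg (-(p.1 + p.2.1)), sine_neg (p.1 + p.2.1), neg_neg, kappa]
  rw [← sub_eq_add_neg]
  ring

theorem pb_cubicGen (a : ℝ) :
    pb (cubicForm fun p => ((a * cubicCoeff p : ℝ) : ℂ)) (cubicGen a : Poly N) =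
      quarticForm fun p => ((9 * a ^ 2 * (quarticCoeff p * kappa p) : ℝ) : ℂ) := by
  have sc1 (i j k : ZMod (2 * N)) : cubicCoeff (i, j, k) = cubicCoeff (i, k, j) := by
    simp only [cubicCoeff, add_right_comm i j k]; ring
  have sc2 (i j k : ZMod (2 * N)) : cubicCoeff (i, j, k) = cubicCoeff (k, j, i) := by
    simp only [cubicCoeff, show i + j + k = k + j + i by ring]; ring
  have sf1 (i j k : ZMod (2 * N)) : tripleFreq (i, j, k) = tripleFreq (i, k, j) := by
    simp only [tripleFreq]; ring
  have sf2 (i j k : ZMod (2 * N)) : tripleFreq (i, j, k) = tripleFreq (k, j, i) := by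
    simp only [tripleFreq]; ring
  rw [cubicGen, pb_cubicForm]
  · congr 1
    funext p
    have e : (9 * a ^ 2 * (quarticCoeff p * kappa p) : ℝ) = (9 * a ^ 2 / 2) *
        (rootSine p.1 * rootSine p.2.1 * rootSine p.2.2.1 * rootSine p.2.2.2) *
        (wind (p.1 + p.2.1 + p.2.2.1 + p.2.2.2) * (2 * kappa p)) := by
      rw [quarticCoeff]; ring
    rw [e, ← sum_exchange, Finset.mul_sum, Finset.mul_sum]
    push_cast
    refine Finset.sum_congr rfl fun j _ => ?_
    -- The two factors `rootSine` of the contracted mode and the sign from the bracket combine to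
    -- its signed frequency.
    have hr : sgn j * (rootSine j * rootSine j) = sine j := by
      rw [← pow_two, rootSine_sq, sgn_mul_abs]
    have hr' : (sgn j : ℂ) * (rootSine j * rootSine j) = sine j := by exact_mod_cast hr
    simp only [cubicCoeff, tripleFreq, rootSine_neg]
    rw [← hr']
    push_cast
    have h2 := Complex.I_ne_zero
    rw [div_eq_mul_inv, div_eq_mul_inv, mul_inv, mul_inv]
    field_simp
  · intro i j k; rw [sc1]
  · intro i j k; rw [sc2]
  · intro i j k; rw [sc1, sf1]
  · intro i j k; rw [sc2, sf2]

/-- The coefficients of the quartic terms after the removal of the cubic terms. -/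
noncomputable def reducedCoeff (a b : ℝ) (p : Quad N) : ℝ :=
  quarticCoeff p * (b + 9 / 2 * a ^ 2 * kappa p)

/-- The resonant quartic terms. -/
noncomputable def resonantForm (a b : ℝ) : Poly N :=
  quarticForm fun p => ((if quadFreq p = 0 then reducedCoeff a b p else 0 : ℝ) : ℂ)

/-- The generating function that removes the nonresonant quartic terms. -/
noncomputable def quarticGen (a b : ℝ) : Poly N :=
  quarticForm fun p => ((reducedCoeff a b p : ℝ) : ℂ) / (2 * Complex.I * quadFreq p)

theorem realSpan_quarticGen (a b : ℝ) : RealSpan 4 (quarticGen a b : Poly N) := by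
  refine realSpan_quartic _ fun p => ?_
  rw [reducedCoeff, reducedCoeff, quarticCoeff_neg, kappa_neg, quadFreq_neg, map_div₀, map_mul,
    map_mul, Complex.conj_I, Complex.conj_ofReal, Complex.conj_ofReal, Complex.conj_ofNat]
  push_cast
  congr 1
  ring

theorem quarticForm_add (c d : Quad N → ℂ) :
    quarticForm c + quarticForm d = quarticForm fun p => c p + d p := by
  simp only [quarticForm, ← Finset.sum_add_distrib, C_add, add_mul]

theorem C_mul_quarticForm (r : ℂ) (c : Quad N → ℂ) :
    C r * quarticForm c = quarticForm fun p => r * c p := by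
  simp only [quarticForm, Finset.mul_sum, C_mul, mul_assoc]

/-- The homological equation of order four. -/
theorem rot_quarticGen (a b : ℝ) :
    C (1 / 2) * pb (cubicForm fun p => ((a * cubicCoeff p : ℝ) : ℂ)) (cubicGen a : Poly N) +
      (quarticForm fun p => ((b * quarticCoeff p : ℝ) : ℂ)) + rot (quarticGen a b) =
      resonantForm a b := by
  rw [pb_cubicGen, quarticGen, rot_quarticForm, C_mul_quarticForm, quarticForm_add,
    quarticForm_add, resonantForm]
  congr 1
  funext p
  have h2 := Complex.I_ne_zero
  -- On resonances the quotient in `quarticGen` has denominator `0` and hence value `0`, so exactly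
  -- these terms are left alone.
  by_cases h : quadFreq p = 0
  · rw [if_pos h, h, reducedCoeff]
    push_cast
    simp
    ring
  · have h1 : (quadFreq p : ℂ) ≠ 0 := by exact_mod_cast h
    rw [if_neg h]
    change _ + (reducedCoeff a b p : ℂ) / (2 * Complex.I * quadFreq p) *
      -(2 * Complex.I * (quadFreq p : ℝ)) = _
    rw [reducedCoeff]
    push_cast
    field_simp
    ring

/-- The Hamiltonian up to terms of order five. -/
noncomputable def truncated (a b : ℝ) : Poly N :=
  quadratic N + (cubicForm fun p => ((a * cubicCoeff p : ℝ) : ℂ)) +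
    quarticForm fun p => ((b * quarticCoeff p : ℝ) : ℂ)

/-- Birkhoff normal form of order four. -/
theorem exists_normalization (a b : ℝ) : ∃ (T : SympAut N) (g : Poly N), g ∈ fil _ 5 ∧
    ∀ w, aeval (amplitude (T.toEquiv w)) (truncated a b : Poly N) =
      aeval (amplitude w) (quadratic N + resonantForm a b + g) := by
  obtain ⟨T, τ, h1, h2, h3⟩ := realizes_of_realSpan (realSpan_cubicGen (N := N) a)
    (realSpan_quarticGen a b)
  refine ⟨T, τ (truncated a b) - (quadratic N + resonantForm a b), ?_, fun w => ?_⟩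
  · set H3 : Poly N := cubicForm fun p => ((a * cubicCoeff p : ℝ) : ℂ) with hH3
    set H4 : Poly N := quarticForm fun p => ((b * quarticCoeff p : ℝ) : ℂ) with hH4
    have m3 := h2 3 H3 (cubicForm_mem_fil _)
    have m4 := h2 4 H4 (quarticForm_mem_fil _)
    have m5 : pb H4 (cubicGen a) ∈ fil (ZMod (2 * N)) 5 :=
      pb_mem_fil (k := 4) (l := 1) (quarticForm_mem_fil _) (cubicForm_mem_fil _)
    -- Writing `S` for `cubicGen a`, `rot S = -H3` cancels the cubic terms, and `½ {rot S, S} + {H3,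
    -- S} = ½ {H3, S}` is the second order contribution.
    have := add_mem (add_mem (add_mem h3 m3) (fil_mono (by norm_num) m4)) m5
    convert this using 1
    rw [truncated, ← rot_quarticGen, rot_cubicGen, pb_neg_left, map_add, map_add, ← hH3, ← hH4]
    have h2 : (C (1 / 2) : Poly N) * 2 = 1 := by
      rw [show (2 : Poly N) = C 2 from (map_ofNat C 2).symm, ← C_mul]; simp
    linear_combination (-(pb H3 (cubicGen a))) * h2
  · rw [h1]
    congr 1
    ring

end Hamiltonian

/-! ### Classification of quartic resonances and second order coefficients on them. -/

section Resonances
variable {N : ℕ} [NeZero N]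

/-- Generically the sum is `(cos (a + c) - cos (a - c)) / (2 sin a sin c) = -1`. If `a = ± c` one of
the two terms is `0` and the other is `cot² a = 1 / sin² a - 1`. -/
theorem exchange_sum_normal {a c : ZMod (2 * N)} (ha : sine a ≠ 0) (hc : sine c ≠ 0) :
    exchange a c + exchange a (-c) = -1 + (if a + c = 0 then (sine a ^ 2)⁻¹ else 0) +
      (if a = c then (sine a ^ 2)⁻¹ else 0) := by
  have hc' : sine (-c) ≠ 0 := by rwa [sine_neg, neg_ne_zero]
  have hre (b : ZMod (2 * N)) : (phase (b + b)).re = 1 - 2 * sine b ^ 2 := by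
    have h1 : (phase b).re * (phase b).re + (phase b).im * (phase b).im = 1 := by
      have : Complex.normSq (phase b) = 1 := by
        rw [Complex.normSq_eq_norm_sq, phase, ZMod.stdAddChar_apply, Circle.norm_coe]; simp
      rwa [Complex.normSq_apply] at this
    rw [phase_add, Complex.mul_re, sine]
    linear_combination h1
  by_cases h1 : a + c = 0
  · have e : -c = a := by linear_combination -h1
    have h2 : a ≠ c := by
      rintro rfl
      exact ha (sine_eq_zero_of_two_mul h1)
    have h3 : a + a ≠ 0 := fun h => ha (sine_eq_zero_of_two_mul h)
    rw [exchange_of_add_eq_zero h1, if_pos h1, if_neg h2, e, exchange_eq ha ha h3, hre]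
    field_simp
    ring
  by_cases h2 : a = c
  · subst h2
    rw [exchange_of_add_eq_zero (add_neg_cancel a), if_neg h1, if_pos rfl, exchange_eq ha ha h1,
      hre]
    field_simp
    ring
  · have h3 : a + -c ≠ 0 := by
      contrapose! h2
      linear_combination h2
    have e : (phase (a + c)).re - (phase (a + -c)).re = -2 * (sine a * sine c) := by
      rw [phase_add, phase_add, phase_neg_eq_conj, Complex.mul_re, Complex.mul_re, Complex.conj_re,
        Complex.conj_im, sine, sine]
      ring
    rw [exchange_eq ha hc h1, exchange_eq ha hc' h3, if_neg h1, if_neg h2, sine_neg]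
    field_simp
    linear_combination e

/-- The pairing of `a` with `a + N` has external frequency sum `0` and gives `-1`. In the other two
the phase of `a + c` is `± i`, so the values are `± 1 / (2 sin a sin c)` and cancel. -/
theorem exchange_sum_umklapp {a c : ZMod (2 * N)} (ha : sine a ≠ 0) (hc : sine c ≠ 0)
    (h : a + a + c + c = (N : ZMod (2 * N))) :
    exchange a (a + (N : ZMod (2 * N))) + (exchange a c + exchange a (c + (N : ZMod (2 * N))))
      = -1 := by
  have hN := half_add_half (N := N)
  have h1 : sine (a + a) ≠ 0 := by
    intro h0
    rcases sine_eq_zero h0 with h0 | h0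
    · exact ha (sine_eq_zero_of_two_mul h0)
    · exact hc (sine_eq_zero_of_two_mul (by linear_combination h - h0))
  have hac : (a + c) + (a + c) = (N : ZMod (2 * N)) := by linear_combination h
  have h2 : a + c ≠ 0 := by
    intro h0
    rw [h0, add_zero] at hac
    exact half_ne_zero hac.symm
  have h3 : a + (c + (N : ZMod (2 * N))) ≠ 0 := by
    intro h0
    exact half_ne_zero (N := N) (by linear_combination 2 * h0 - h - hN)
  have hc' : sine (c + (N : ZMod (2 * N))) ≠ 0 := by rwa [sine_add_half, neg_ne_zero]
  have e1 : exchange a (a + (N : ZMod (2 * N))) = -1 := by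
    rw [exchange, ← add_assoc, sine_add_half, sine_add_half]
    have : -(sine a + -sine a) = 0 := by ring
    rw [this]
    generalize sine (a + a) = x at h1 ⊢
    rw [zero_sub, zero_add, div_neg, div_self (neg_ne_zero.mpr h1)]
    norm_num
  have e2 : (phase (a + c)).re = 0 := by
    have h4 : phase (a + c) * phase (a + c) = -1 := by rw [← phase_add, hac, phase_half]
    have h5 := congrArg Complex.re h4
    have h6 := congrArg Complex.im h4
    simp only [Complex.mul_re, Complex.mul_im, Complex.neg_re, Complex.one_re, Complex.neg_im,
      Complex.one_im] at h5 h6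
    nlinarith [sq_nonneg (phase (a + c)).re, sq_nonneg (phase (a + c)).im]
  rw [e1, exchange_eq ha hc h2, exchange_eq ha hc' h3,
    show a + (c + (N : ZMod (2 * N))) = a + c + (N : ZMod (2 * N)) from (add_assoc _ _ _).symm, phase_add (a + c), phase_half,
    sine_add_half]
  simp only [mul_neg, mul_one, Complex.neg_re, e2]
  field_simp
  ring

/-- The first with the second and the third with the fourth mode cancel. -/
def Pair12 (p : Quad N) : Prop := p.1 + p.2.1 = 0 ∧ p.2.2.1 + p.2.2.2 = 0
/-- The first with the third and the second with the fourth mode cancel. -/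
def Pair13 (p : Quad N) : Prop := p.1 + p.2.2.1 = 0 ∧ p.2.1 + p.2.2.2 = 0
/-- The first with the fourth and the second with the third mode cancel. -/
def Pair14 (p : Quad N) : Prop := p.1 + p.2.2.2 = 0 ∧ p.2.1 + p.2.2.1 = 0

/-- The umklapp resonances that pair the first with the second mode. -/
def Shift12 (p : Quad N) : Prop :=
  p.2.1 = p.1 + (N : ZMod (2 * N)) ∧ p.2.2.2 = p.2.2.1 + (N : ZMod (2 * N)) ∧
    p.1 + p.2.1 + p.2.2.1 + p.2.2.2 = (N : ZMod (2 * N))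
/-- The umklapp resonances that pair the first with the third mode. -/
def Shift13 (p : Quad N) : Prop :=
  p.2.2.1 = p.1 + (N : ZMod (2 * N)) ∧ p.2.2.2 = p.2.1 + (N : ZMod (2 * N)) ∧
    p.1 + p.2.1 + p.2.2.1 + p.2.2.2 = (N : ZMod (2 * N))
/-- The umklapp resonances that pair the first with the fourth mode. -/
def Shift14 (p : Quad N) : Prop :=
  p.2.2.2 = p.1 + (N : ZMod (2 * N)) ∧ p.2.2.1 = p.2.1 + (N : ZMod (2 * N)) ∧
    p.1 + p.2.1 + p.2.2.1 + p.2.2.2 = (N : ZMod (2 * N))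

open Classical in
/-- The indicator function of a proposition. -/
noncomputable def ind (P : Prop) : ℝ := if P then 1 else 0

theorem ind_true {P : Prop} (h : P) : ind P = 1 := if_pos h
theorem ind_false {P : Prop} (h : ¬P) : ind P = 0 := if_neg h
theorem ind_and (P Q : Prop) : ind (P ∧ Q) = ind P * ind Q := by
  by_cases h : P <;> by_cases h' : Q <;> simp [ind, h, h']
theorem ind_congr {P Q : Prop} (h : P ↔ Q) : ind P = ind Q := by rw [propext h]

theorem inclusion_exclusion {P Q R : Prop} (h : P ∨ Q ∨ R) (h' : ¬(P ∧ Q ∧ R)) :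
    ind P + ind Q + ind R - ind P * ind Q - ind Q * ind R - ind P * ind R = 1 := by
  by_cases hP : P <;> by_cases hQ : Q <;> by_cases hR : R <;> simp [ind, hP, hQ, hR] <;>
    first | exact (h' ⟨hP, hQ, hR⟩).elim | exact absurd h (by simp [hP, hQ, hR])

/-- All four modes have nonzero frequency. -/
def NonzeroFreq (p : Quad N) : Prop :=
  sine p.1 ≠ 0 ∧ sine p.2.1 ≠ 0 ∧ sine p.2.2.1 ≠ 0 ∧ sine p.2.2.2 ≠ 0

theorem eq_neg_of_add {a b : ZMod (2 * N)} (h : a + b = 0) : sine b = -sine a := by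
  rw [← sine_neg, eq_neg_of_add_eq_zero_right h]

theorem sine_shift {a b : ZMod (2 * N)} (h : b = a + (N : ZMod (2 * N))) : sine b = -sine a := by
  rw [h, sine_add_half]

theorem pair_cases {p : Quad N} (h : Pair12 p ∨ Pair13 p ∨ Pair14 p) :
    p.1 + p.2.1 + p.2.2.1 + p.2.2.2 = 0 ∧ quadFreq p = 0 := by
  rw [quadFreq]
  rcases h with h | h | h
  · exact ⟨by linear_combination h.1 + h.2, by rw [eq_neg_of_add h.1, eq_neg_of_add h.2]; ring⟩
  · exact ⟨by linear_combination h.1 + h.2, by rw [eq_neg_of_add h.1, eq_neg_of_add h.2]; ring⟩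
  · exact ⟨by linear_combination h.1 + h.2, by rw [eq_neg_of_add h.1, eq_neg_of_add h.2]; ring⟩

theorem shift_cases {p : Quad N} (h : Shift12 p ∨ Shift13 p ∨ Shift14 p) :
    p.1 + p.2.1 + p.2.2.1 + p.2.2.2 = (N : ZMod (2 * N)) ∧ quadFreq p = 0 := by
  rw [quadFreq]
  rcases h with h | h | h
  · exact ⟨h.2.2, by rw [sine_shift h.1, sine_shift h.2.1]; ring⟩
  · exact ⟨h.2.2, by rw [sine_shift h.1, sine_shift h.2.1]; ring⟩
  · exact ⟨h.2.2, by rw [sine_shift h.1, sine_shift h.2.1]; ring⟩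

theorem pair_of_resonance {p : Quad N} (h : p.1 + p.2.1 + p.2.2.1 + p.2.2.2 = 0)
    (hs : quadFreq p = 0) : Pair12 p ∨ Pair13 p ∨ Pair14 p := by
  rcases resonance_of_sum_eq_zero h hs with h1 | h1 | h1
  · exact Or.inl ⟨h1, by linear_combination h - h1⟩
  · exact Or.inr (Or.inl ⟨h1, by linear_combination h - h1⟩)
  · exact Or.inr (Or.inr ⟨h1, by linear_combination h - h1⟩)

theorem shift_of_resonance {p : Quad N} (hp : NonzeroFreq p)
    (h : p.1 + p.2.1 + p.2.2.1 + p.2.2.2 = (N : ZMod (2 * N)))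
    (hs : quadFreq p = 0) : Shift12 p ∨ Shift13 p ∨ Shift14 p := by
  rcases resonance_of_sum_eq_half h hs hp.1 hp.2.1 hp.2.2.1 with h1 | h1 | h1
  · exact Or.inl ⟨h1.1, h1.2, h⟩
  · exact Or.inr (Or.inl ⟨h1.1, h1.2, h⟩)
  · exact Or.inr (Or.inr ⟨h1.1, h1.2, h⟩)

theorem not_pair_all {p : Quad N} (hp : NonzeroFreq p) : ¬(Pair12 p ∧ Pair13 p ∧ Pair14 p) := by
  rintro ⟨h1, h2, h3⟩
  exact hp.1 (sine_eq_zero_of_two_mul (by linear_combination h1.1 + h2.1 - h3.2))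

theorem not_shift_all (p : Quad N) : ¬(Shift12 p ∧ Shift13 p ∧ Shift14 p) := by
  rintro ⟨h1, h2, h3⟩
  exact half_ne_zero (N := N) (by linear_combination h2.1 - h3.2.1 - h1.1)

/-- Inclusion-exclusion over the ordinary resonances. -/
noncomputable def pairInd (p : Quad N) : ℝ :=
  ind (Pair12 p) + ind (Pair13 p) + ind (Pair14 p) - ind (Pair12 p) * ind (Pair13 p)
    - ind (Pair13 p) * ind (Pair14 p) - ind (Pair12 p) * ind (Pair14 p)

/-- Inclusion-exclusion over the umklapp resonances. -/
noncomputable def shiftInd (p : Quad N) : ℝ :=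
  ind (Shift12 p) + ind (Shift13 p) + ind (Shift14 p) - ind (Shift12 p) * ind (Shift13 p)
    - ind (Shift13 p) * ind (Shift14 p) - ind (Shift12 p) * ind (Shift14 p)

theorem pairInd_eq_zero {p : Quad N} (h : ¬(Pair12 p ∨ Pair13 p ∨ Pair14 p)) : pairInd p = 0 := by
  simp only [not_or] at h
  simp [pairInd, ind_false h.1, ind_false h.2.1, ind_false h.2.2]

theorem shiftInd_eq_zero {p : Quad N} (h : ¬(Shift12 p ∨ Shift13 p ∨ Shift14 p)) :
    shiftInd p = 0 := by
  simp only [not_or] at h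
  simp [shiftInd, ind_false h.1, ind_false h.2.1, ind_false h.2.2]

/-- The classification of the quartic resonances. -/
theorem wind_resonant {p : Quad N} (hp : NonzeroFreq p) :
    wind (p.1 + p.2.1 + p.2.2.1 + p.2.2.2) * ind (quadFreq p = 0) = pairInd p - shiftInd p := by
  by_cases hs : quadFreq p = 0
  · rw [ind_true hs, mul_one]
    by_cases h0 : p.1 + p.2.1 + p.2.2.1 + p.2.2.2 = 0
    · have e1 : pairInd p = 1 := inclusion_exclusion (pair_of_resonance h0 hs) (not_pair_all hp)
      have e2 : shiftInd p = 0 := by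
        refine shiftInd_eq_zero fun h => half_ne_zero (N := N) ?_
        rw [← (shift_cases h).1, h0]
      rw [h0, wind_zero, e1, e2, sub_zero]
    by_cases hN : p.1 + p.2.1 + p.2.2.1 + p.2.2.2 = (N : ZMod (2 * N))
    · have e1 : shiftInd p = 1 := inclusion_exclusion (shift_of_resonance hp hN hs)
        (not_shift_all p)
      have e2 : pairInd p = 0 := pairInd_eq_zero fun h => h0 (pair_cases h).1
      rw [hN, wind_half, e1, e2, zero_sub]
    · rw [pairInd_eq_zero fun h => h0 (pair_cases h).1,
        shiftInd_eq_zero fun h => hN (shift_cases h).1]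
      simp [wind, h0, hN]
  · rw [ind_false hs, pairInd_eq_zero fun h => hs (pair_cases h).2,
      shiftInd_eq_zero fun h => hs (shift_cases h).2]
    simp

/-- The indicator of the resonances of a mode with itself. -/
noncomputable def selfInd (p : Quad N) : ℝ :=
  ind (Pair12 p) * ind (Pair13 p) + ind (Pair13 p) * ind (Pair14 p) + ind (Pair12 p) * ind (Pair14 p)

theorem ite_eq_mul_ind (P : Prop) [Decidable P] (x : ℝ) : (if P then x else 0) = x * ind P := by
  by_cases h : P <;> simp [ind, h]

/-- The reason why `α²` and `β` occur in the combination `β - α²`: summed over the three ways of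
pairing the modes, the second order term is `-1` on every resonance, ordinary or umklapp, except
when a mode meets itself. -/
theorem exchange_sum {p : Quad N} (hp : NonzeroFreq p) :
    wind (p.1 + p.2.1 + p.2.2.1 + p.2.2.2) * ind (quadFreq p = 0) *
      (exchange p.1 p.2.1 + exchange p.1 p.2.2.1 + exchange p.1 p.2.2.2) =
    -(wind (p.1 + p.2.1 + p.2.2.1 + p.2.2.2) * ind (quadFreq p = 0)) +
      selfInd p * (sine p.1 ^ 2)⁻¹ := by
  obtain ⟨a, b, c, d⟩ := p
  by_cases h : Pair12 (a, b, c, d) ∨ Pair13 (a, b, c, d) ∨ Pair14 (a, b, c, d)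
  · rw [(pair_cases h).1, wind_zero, ind_true (pair_cases h).2]
    have na := not_pair_all hp
    rcases h with h | h | h
    · have hb : a + b = 0 := h.1
      have hd : d = -c := eq_neg_of_add_eq_zero_right h.2
      have e1 : ind (a + c = 0) = ind (Pair13 (a, b, c, d)) :=
        ind_congr ⟨fun h' => ⟨h', by linear_combination hb + hd - h'⟩, fun h' => h'.1⟩
      have e2 : ind (a = c) = ind (Pair14 (a, b, c, d)) :=
        ind_congr ⟨fun h' => ⟨by linear_combination h' + hd, by linear_combination hb - h'⟩,
          fun h' => by linear_combination h'.1 - hd⟩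
      have e3 : ind (Pair13 (a, b, c, d)) * ind (Pair14 (a, b, c, d)) = 0 := by
        rw [← ind_and]; exact ind_false fun h' => na ⟨h, h'⟩
      have := exchange_sum_normal hp.1 hp.2.2.1
      dsimp only at this ⊢
      rw [ite_eq_mul_ind, ite_eq_mul_ind, e1, e2, ← hd] at this
      rw [selfInd, ind_true h, e3, exchange_of_add_eq_zero hb]
      linear_combination this
    · have hc : a + c = 0 := h.1
      have hd : d = -b := eq_neg_of_add_eq_zero_right h.2
      have e1 : ind (a + b = 0) = ind (Pair12 (a, b, c, d)) :=
        ind_congr ⟨fun h' => ⟨h', by linear_combination hc + hd - h'⟩, fun h' => h'.1⟩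
      have e2 : ind (a = b) = ind (Pair14 (a, b, c, d)) :=
        ind_congr ⟨fun h' => ⟨by linear_combination h' + hd, by linear_combination hc - h'⟩,
          fun h' => by linear_combination h'.1 - hd⟩
      have e3 : ind (Pair12 (a, b, c, d)) * ind (Pair14 (a, b, c, d)) = 0 := by
        rw [← ind_and]; exact ind_false fun h' => na ⟨h'.1, h, h'.2⟩
      have := exchange_sum_normal hp.1 hp.2.1
      dsimp only at this ⊢
      rw [ite_eq_mul_ind, ite_eq_mul_ind, e1, e2, ← hd] at this
      rw [selfInd, ind_true h, e3, exchange_of_add_eq_zero hc]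
      linear_combination this
    · have hc : a + d = 0 := h.1
      have hd : c = -b := eq_neg_of_add_eq_zero_right h.2
      have e1 : ind (a + b = 0) = ind (Pair12 (a, b, c, d)) :=
        ind_congr ⟨fun h' => ⟨h', by linear_combination hc + hd - h'⟩, fun h' => h'.1⟩
      have e2 : ind (a = b) = ind (Pair13 (a, b, c, d)) :=
        ind_congr ⟨fun h' => ⟨by linear_combination h' + hd, by linear_combination hc - h'⟩,
          fun h' => by linear_combination h'.1 - hd⟩
      have e3 : ind (Pair12 (a, b, c, d)) * ind (Pair13 (a, b, c, d)) = 0 := by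
        rw [← ind_and]; exact ind_false fun h' => na ⟨h'.1, h'.2, h⟩
      have := exchange_sum_normal hp.1 hp.2.1
      dsimp only at this ⊢
      rw [ite_eq_mul_ind, ite_eq_mul_ind, e1, e2, ← hd] at this
      rw [selfInd, ind_true h, e3, exchange_of_add_eq_zero hc]
      linear_combination this
  have hself : selfInd (a, b, c, d) = 0 := by
    simp only [not_or] at h
    simp [selfInd, ind_false h.1, ind_false h.2.1, ind_false h.2.2]
  rw [hself, wind_resonant hp, pairInd_eq_zero h]
  by_cases h' : Shift12 (a, b, c, d) ∨ Shift13 (a, b, c, d) ∨ Shift14 (a, b, c, d)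
  · have hN := half_add_half (N := N)
    suffices exchange a b + exchange a c + exchange a d = -1 by
      dsimp only
      rw [this]; ring
    rcases h' with ⟨h1, h2, h3⟩ | ⟨h1, h2, h3⟩ | ⟨h1, h2, h3⟩ <;> dsimp only at h1 h2 h3 <;> subst h1 h2
    · have := exchange_sum_umklapp hp.1 hp.2.2.1 (by linear_combination h3 - hN)
      dsimp only at this
      linarith
    · have := exchange_sum_umklapp hp.1 hp.2.1 (by linear_combination h3 - hN)
      dsimp only at this
      linarith
    · have := exchange_sum_umklapp hp.1 hp.2.1 (by linear_combination h3 - hN)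
      dsimp only at this
      linarith
  · rw [shiftInd_eq_zero h']
    ring

end Resonances

/-! ### Sums over resonances, symmetrized over the pairings. -/

section Symmetrization
variable {N : ℕ} [NeZero N]

/-- The monomial of a quadruple of modes with frequency factors. -/
noncomputable def weight (z : ZMod (2 * N) → ℂ) (p : Quad N) : ℂ :=
  (rootSine p.1 * rootSine p.2.1 * rootSine p.2.2.1 * rootSine p.2.2.2 : ℝ) *
    (z p.1 * z p.2.1 * z p.2.2.1 * z p.2.2.2)

/-- Exchange of the second and the third mode. -/
def swap23 (p : Quad N) : Quad N := (p.1, p.2.2.1, p.2.1, p.2.2.2)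
/-- Exchange of the second and the fourth mode. -/
def swap24 (p : Quad N) : Quad N := (p.1, p.2.2.2, p.2.2.1, p.2.1)

theorem sum_swap23 (F : Quad N → ℂ) : ∑ p, F (swap23 p) = ∑ p, F p :=
  Fintype.sum_bijective swap23 (Function.Involutive.bijective fun _ => rfl) _ _ fun _ => rfl

theorem sum_swap24 (F : Quad N → ℂ) : ∑ p, F (swap24 p) = ∑ p, F p :=
  Fintype.sum_bijective swap24 (Function.Involutive.bijective fun _ => rfl) _ _ fun _ => rfl

theorem weight_swap23 (z : ZMod (2 * N) → ℂ) (p : Quad N) :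
    weight z (swap23 p) = weight z p := by
  simp only [weight, swap23]; push_cast; ring

theorem weight_swap24 (z : ZMod (2 * N) → ℂ) (p : Quad N) :
    weight z (swap24 p) = weight z p := by
  simp only [weight, swap24]; push_cast; ring

theorem weight_eq_zero (z : ZMod (2 * N) → ℂ) {p : Quad N} (h : ¬NonzeroFreq p) :
    weight z p = 0 := by
  simp only [NonzeroFreq, not_and_or, not_not] at h
  rw [weight]
  rcases h with h | h | h | h <;> rw [rootSine_eq_zero h] <;> simp

theorem eq_add_half_comm {a b : ZMod (2 * N)} :
    a = b + (N : ZMod (2 * N)) ↔ b = a + (N : ZMod (2 * N)) := by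
  constructor <;> intro h <;> linear_combination -h - half_add_half (N := N)

theorem ind_pair12_swap23 (p : Quad N) : ind (Pair12 (swap23 p)) = ind (Pair13 p) := rfl
theorem ind_pair13_swap23 (p : Quad N) : ind (Pair13 (swap23 p)) = ind (Pair12 p) := rfl
theorem ind_pair14_swap23 (p : Quad N) : ind (Pair14 (swap23 p)) = ind (Pair14 p) :=
  ind_congr (by simp only [Pair14, swap23, add_comm])
theorem ind_pair12_swap24 (p : Quad N) : ind (Pair12 (swap24 p)) = ind (Pair14 p) :=
  ind_congr (by simp only [Pair12, Pair14, swap24, add_comm])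
theorem ind_pair13_swap24 (p : Quad N) : ind (Pair13 (swap24 p)) = ind (Pair13 p) :=
  ind_congr (by simp only [Pair13, swap24, add_comm])

theorem ind_shift12_swap23 (p : Quad N) : ind (Shift12 (swap23 p)) = ind (Shift13 p) :=
  ind_congr (by
    simp only [Shift12, Shift13, swap23, add_right_comm p.1 p.2.2.1 p.2.1])
theorem ind_shift14_swap23 (p : Quad N) : ind (Shift14 (swap23 p)) = ind (Shift14 p) :=
  ind_congr (by
    simp only [Shift14, swap23, add_right_comm p.1 p.2.2.1 p.2.1]
    rw [eq_add_half_comm (a := p.2.1)])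
theorem ind_shift12_swap24 (p : Quad N) : ind (Shift12 (swap24 p)) = ind (Shift14 p) :=
  ind_congr (by
    simp only [Shift12, Shift14, swap24]
    rw [eq_add_half_comm (a := p.2.1), show p.1 + p.2.2.2 + p.2.2.1 + p.2.1 =
      p.1 + p.2.1 + p.2.2.1 + p.2.2.2 by ring])
theorem ind_shift13_swap24 (p : Quad N) : ind (Shift13 (swap24 p)) = ind (Shift13 p) :=
  ind_congr (by
    simp only [Shift13, swap24]
    rw [eq_add_half_comm (a := p.2.1), show p.1 + p.2.2.2 + p.2.2.1 + p.2.1 =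
      p.1 + p.2.1 + p.2.2.1 + p.2.2.2 by ring])

theorem sum_weight_swap23 (z : ZMod (2 * N) → ℂ) (f g : Quad N → ℝ)
    (h : ∀ p, f (swap23 p) = g p) : ∑ p, (g p : ℂ) * weight z p = ∑ p, (f p : ℂ) * weight z p := by
  rw [← sum_swap23]
  refine (Fintype.sum_congr _ _ fun p => ?_)
  rw [weight_swap23, ← h]
  rfl

theorem sum_weight_swap24 (z : ZMod (2 * N) → ℂ) (f g : Quad N → ℝ)
    (h : ∀ p, f (swap24 p) = g p) : ∑ p, (g p : ℂ) * weight z p = ∑ p, (f p : ℂ) * weight z p := by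
  rw [← sum_swap24]
  refine (Fintype.sum_congr _ _ fun p => ?_)
  rw [weight_swap24, ← h]
  rfl

/-- The weight is symmetric in the four modes, so the three pairings contribute equally, and so do
their three intersections. -/
theorem sum_weight_pairInd (z : ZMod (2 * N) → ℂ) :
    ∑ p, (pairInd p : ℂ) * weight z p = 3 * ∑ p, (ind (Pair12 p) : ℂ) * weight z p -
      3 * ∑ p, ((ind (Pair12 p) * ind (Pair13 p) : ℝ) : ℂ) * weight z p := by
  have e13 := sum_weight_swap23 z (fun p => ind (Pair12 p)) (fun p => ind (Pair13 p))
    ind_pair12_swap23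
  have e14 := sum_weight_swap24 z (fun p => ind (Pair12 p)) (fun p => ind (Pair14 p))
    ind_pair12_swap24
  have f1 := sum_weight_swap24 z (fun p => ind (Pair12 p) * ind (Pair13 p))
    (fun p => ind (Pair14 p) * ind (Pair13 p))
    fun p => by rw [ind_pair12_swap24, ind_pair13_swap24]
  have f2 := sum_weight_swap23 z (fun p => ind (Pair14 p) * ind (Pair13 p))
    (fun p => ind (Pair14 p) * ind (Pair12 p))
    fun p => by rw [ind_pair14_swap23, ind_pair13_swap23]
  have e (p : Quad N) : (pairInd p : ℂ) * weight z p = (ind (Pair12 p) : ℂ) * weight z p +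
      (ind (Pair13 p) : ℂ) * weight z p + (ind (Pair14 p) : ℂ) * weight z p -
      ((ind (Pair12 p) * ind (Pair13 p) : ℝ) : ℂ) * weight z p -
      ((ind (Pair14 p) * ind (Pair13 p) : ℝ) : ℂ) * weight z p -
      ((ind (Pair14 p) * ind (Pair12 p) : ℝ) : ℂ) * weight z p := by
    rw [pairInd]; push_cast; ring
  simp only [e, Finset.sum_sub_distrib, Finset.sum_add_distrib]
  linear_combination e13 + e14 - 2 * f1 - f2

theorem sum_weight_shiftInd (z : ZMod (2 * N) → ℂ) :
    ∑ p, (shiftInd p : ℂ) * weight z p = 3 * ∑ p, (ind (Shift12 p) : ℂ) * weight z p -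
      3 * ∑ p, ((ind (Shift12 p) * ind (Shift13 p) : ℝ) : ℂ) * weight z p := by
  have e13 := sum_weight_swap23 z (fun p => ind (Shift12 p)) (fun p => ind (Shift13 p))
    ind_shift12_swap23
  have e14 := sum_weight_swap24 z (fun p => ind (Shift12 p)) (fun p => ind (Shift14 p))
    ind_shift12_swap24
  have f1 := sum_weight_swap24 z (fun p => ind (Shift12 p) * ind (Shift13 p))
    (fun p => ind (Shift14 p) * ind (Shift13 p))
    fun p => by rw [ind_shift12_swap24, ind_shift13_swap24]
  have f2 := sum_weight_swap23 z (fun p => ind (Shift14 p) * ind (Shift12 p))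
    (fun p => ind (Shift14 p) * ind (Shift13 p))
    fun p => by rw [ind_shift14_swap23, ind_shift12_swap23]
  have e (p : Quad N) : (shiftInd p : ℂ) * weight z p = (ind (Shift12 p) : ℂ) * weight z p +
      (ind (Shift13 p) : ℂ) * weight z p + (ind (Shift14 p) : ℂ) * weight z p -
      ((ind (Shift12 p) * ind (Shift13 p) : ℝ) : ℂ) * weight z p -
      ((ind (Shift14 p) * ind (Shift13 p) : ℝ) : ℂ) * weight z p -
      ((ind (Shift14 p) * ind (Shift12 p) : ℝ) : ℂ) * weight z p := by
    rw [shiftInd]; push_cast; ring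
  simp only [e, Finset.sum_sub_distrib, Finset.sum_add_distrib]
  linear_combination e13 + e14 - 2 * f1 + f2

/-- The resonance indicator with sign. -/
noncomputable def windInd (p : Quad N) : ℝ :=
  wind (p.1 + p.2.1 + p.2.2.1 + p.2.2.2) * ind (quadFreq p = 0)

theorem windInd_swap23 (p : Quad N) : windInd (swap23 p) = windInd p := by
  simp only [windInd, swap23, quadFreq, add_right_comm p.1 p.2.2.1 p.2.1,
    add_right_comm (sine p.1) (sine p.2.2.1) (sine p.2.1)]

theorem windInd_swap24 (p : Quad N) : windInd (swap24 p) = windInd p := by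
  simp only [windInd, swap24, quadFreq, show p.1 + p.2.2.2 + p.2.2.1 + p.2.1 =
      p.1 + p.2.1 + p.2.2.1 + p.2.2.2 by ring, show sine p.1 + sine p.2.2.2 + sine p.2.2.1 +
      sine p.2.1 = sine p.1 + sine p.2.1 + sine p.2.2.1 + sine p.2.2.2 by ring]

theorem sum_windInd (z : ZMod (2 * N) → ℂ) : ∑ p, (windInd p : ℂ) * weight z p =
    ∑ p, (pairInd p : ℂ) * weight z p - ∑ p, (shiftInd p : ℂ) * weight z p := by
  rw [← Finset.sum_sub_distrib]
  refine Fintype.sum_congr _ _ fun p => ?_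
  by_cases h : NonzeroFreq p
  · rw [windInd, wind_resonant h]; push_cast; ring
  · rw [weight_eq_zero z h]; ring

/-- Permuting the last three modes replaces `exchange p.1 p.2.1` by a third of the sum over the
pairings, to which `exchange_sum` applies; quadruples containing a mode of zero frequency have
weight `0`. -/
theorem sum_windInd_exchange (z : ZMod (2 * N) → ℂ) :
    3 * ∑ p, ((windInd p * exchange p.1 p.2.1 : ℝ) : ℂ) * weight z p =
      -∑ p, (windInd p : ℂ) * weight z p +
      3 * ∑ p, ((ind (Pair12 p) * ind (Pair13 p) * (sine p.1 ^ 2)⁻¹ : ℝ) : ℂ) * weight z p := by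
  have e3 := sum_weight_swap23 z (fun p => windInd p * exchange p.1 p.2.1)
    (fun p => windInd p * exchange p.1 p.2.2.1) fun p => by rw [windInd_swap23]; rfl
  have e4 := sum_weight_swap24 z (fun p => windInd p * exchange p.1 p.2.1)
    (fun p => windInd p * exchange p.1 p.2.2.2) fun p => by rw [windInd_swap24]; rfl
  have f1 := sum_weight_swap24 z (fun p => ind (Pair12 p) * ind (Pair13 p) * (sine p.1 ^ 2)⁻¹)
    (fun p => ind (Pair14 p) * ind (Pair13 p) * (sine p.1 ^ 2)⁻¹)
    fun p => by rw [ind_pair12_swap24, ind_pair13_swap24]; rfl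
  have f2 := sum_weight_swap23 z (fun p => ind (Pair14 p) * ind (Pair13 p) * (sine p.1 ^ 2)⁻¹)
    (fun p => ind (Pair14 p) * ind (Pair12 p) * (sine p.1 ^ 2)⁻¹)
    fun p => by rw [ind_pair14_swap23, ind_pair13_swap23]; rfl
  have e : ∑ p, ((windInd p * exchange p.1 p.2.1 : ℝ) : ℂ) * weight z p +
      ∑ p, ((windInd p * exchange p.1 p.2.2.1 : ℝ) : ℂ) * weight z p +
      ∑ p, ((windInd p * exchange p.1 p.2.2.2 : ℝ) : ℂ) * weight z p =
      -∑ p, (windInd p : ℂ) * weight z p +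
      (∑ p, ((ind (Pair12 p) * ind (Pair13 p) * (sine p.1 ^ 2)⁻¹ : ℝ) : ℂ) * weight z p +
      ∑ p, ((ind (Pair14 p) * ind (Pair13 p) * (sine p.1 ^ 2)⁻¹ : ℝ) : ℂ) * weight z p +
      ∑ p, ((ind (Pair14 p) * ind (Pair12 p) * (sine p.1 ^ 2)⁻¹ : ℝ) : ℂ) * weight z p) := by
    simp only [← Finset.sum_add_distrib, ← Finset.sum_neg_distrib]
    refine Fintype.sum_congr _ _ fun p => ?_
    by_cases h : NonzeroFreq p
    · have := congrArg (fun x : ℝ => (x : ℂ) * weight z p) (exchange_sum h)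
      simp only [selfInd] at this
      simp only [windInd]
      push_cast at this ⊢
      linear_combination this
    · rw [weight_eq_zero z h]; ring
  linear_combination e - e3 - e4 + 2 * f1 + f2

theorem sum_ind_mul {ι κ : Type*} [Fintype ι] [Fintype κ] (φ : ι → κ)
    (hφ : Function.Injective φ) (P : κ → Prop) (h : ∀ p, P p ↔ ∃ i, φ i = p) (F : κ → ℂ) :
    ∑ p, (ind (P p) : ℂ) * F p = ∑ i, F (φ i) := by
  classical
  rw [← Finset.sum_image (s := Finset.univ) (g := φ) (f := F) fun x _ y _ hxy => hφ hxy]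
  rw [← Finset.sum_subset (Finset.subset_univ (Finset.univ.image φ))]
  · refine Finset.sum_congr rfl fun p hp => ?_
    have : P p := (h p).2 (by simpa using hp)
    rw [ind_true this]; simp
  · intro p _ hp
    have : ¬P p := fun h' => hp (by simpa using (h p).1 h')
    rw [ind_false this]; simp

theorem rootSine_mul_self (j : ZMod (2 * N)) : (rootSine j : ℂ) * rootSine j = (|sine j| : ℝ) := by
  rw [← rootSine_sq]; push_cast; ring

theorem sine_sq_eq_rootSine_pow (j : ZMod (2 * N)) :
    (sine j : ℂ) ^ 2 = (rootSine j : ℂ) ^ 4 := by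
  have : sine j ^ 2 = rootSine j ^ 4 := by
    rw [show rootSine j ^ 4 = (rootSine j ^ 2) ^ 2 by ring, rootSine_sq, sq_abs]
  exact_mod_cast this

theorem sum_pair12 (z : ZMod (2 * N) → ℂ) : ∑ p, (ind (Pair12 p) : ℂ) * weight z p =
    (∑ j, (|sine j| : ℝ) * (z j * z (-j))) ^ 2 := by
  rw [sum_ind_mul (fun i : ZMod (2 * N) × ZMod (2 * N) => ((i.1, -i.1, i.2, -i.2) : Quad N)),
    pow_two, Finset.sum_mul_sum, Fintype.sum_prod_type]
  · refine Fintype.sum_congr _ _ fun j => Fintype.sum_congr _ _ fun l => ?_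
    rw [weight, rootSine_neg, rootSine_neg, ← rootSine_mul_self, ← rootSine_mul_self]
    push_cast
    ring
  · intro i i' h
    simp only [Prod.mk.injEq] at h
    exact Prod.ext h.1 h.2.2.1
  · rintro ⟨a, b, c, d⟩
    constructor
    · rintro ⟨h1, h2⟩
      refine ⟨(a, c), ?_⟩
      dsimp only at *
      rw [eq_neg_of_add_eq_zero_right h1, eq_neg_of_add_eq_zero_right h2]
    · rintro ⟨i, h⟩
      simp only [Prod.mk.injEq] at h
      obtain ⟨rfl, rfl, rfl, rfl⟩ := h
      exact ⟨add_neg_cancel _, add_neg_cancel _⟩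

theorem pair_self_iff (p : Quad N) : (Pair12 p ∧ Pair13 p) ↔ ∃ i, (i, -i, -i, i) = p := by
  obtain ⟨a, b, c, d⟩ := p
  constructor
  · rintro ⟨⟨h1, h2⟩, h3, h4⟩
    refine ⟨a, ?_⟩
    dsimp only at *
    rw [eq_neg_of_add_eq_zero_right h1, eq_neg_of_add_eq_zero_right h3,
      show d = a by linear_combination h2 - h3]
  · rintro ⟨i, h⟩
    simp only [Prod.mk.injEq] at h
    obtain ⟨rfl, rfl, rfl, rfl⟩ := h
    exact ⟨⟨add_neg_cancel _, neg_add_cancel _⟩, add_neg_cancel _, neg_add_cancel _⟩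

theorem sum_pair_self (z : ZMod (2 * N) → ℂ) (g : ZMod (2 * N) → ℝ) :
    ∑ p, ((ind (Pair12 p) * ind (Pair13 p) * g p.1 : ℝ) : ℂ) * weight z p =
    ∑ j, ((g j * sine j ^ 2 : ℝ) : ℂ) * (z j * z (-j)) ^ 2 := by
  have := sum_ind_mul (fun i : ZMod (2 * N) => ((i, -i, -i, i) : Quad N))
    (fun i i' h => congrArg Prod.fst h) _ pair_self_iff (fun p => (g p.1 : ℂ) * weight z p)
  simp only [ind_and] at this
  push_cast at this ⊢
  simp only [mul_assoc] at this ⊢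
  rw [this]
  refine Fintype.sum_congr _ _ fun j => ?_
  have h := sine_sq_eq_rootSine_pow j
  rw [weight, rootSine_neg, h]
  push_cast
  ring

/-- The product of the amplitudes of two modes of opposite frequencies and the same `rootSine`. -/
noncomputable def twist (z : ZMod (2 * N) → ℂ) (j : ZMod (2 * N)) : ℂ :=
  z j * z (j + (N : ZMod (2 * N)))

theorem sum_shift12 (z : ZMod (2 * N) → ℂ) : ∑ p, (ind (Shift12 p) : ℂ) * weight z p =
    ∑ j, ∑ l, (ind (j + j + (l + l) = (N : ZMod (2 * N))) : ℂ) *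
      ((|sine j| : ℝ) * (|sine l| : ℝ) * (twist z j * twist z l)) := by
  have e (p : Quad N) : (ind (Shift12 p) : ℂ) * weight z p =
      (ind (p.2.1 = p.1 + (N : ZMod (2 * N)) ∧ p.2.2.2 = p.2.2.1 + (N : ZMod (2 * N))) : ℂ) *
      (ind (p.1 + p.2.1 + p.2.2.1 + p.2.2.2 = (N : ZMod (2 * N))) * weight z p) := by
    rw [← mul_assoc, ← Complex.ofReal_mul, ← ind_and, Shift12, and_assoc]
  simp only [e]
  rw [sum_ind_mul (fun i : ZMod (2 * N) × ZMod (2 * N) =>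
    ((i.1, i.1 + (N : ZMod (2 * N)), i.2, i.2 + (N : ZMod (2 * N))) : Quad N)),
    Fintype.sum_prod_type]
  · refine Fintype.sum_congr _ _ fun j => Fintype.sum_congr _ _ fun l => ?_
    dsimp only
    rw [show j + (j + (N : ZMod (2 * N))) + l + (l + (N : ZMod (2 * N))) = j + j + (l + l) by
      linear_combination half_add_half (N := N)]
    rw [weight, rootSine_add_half, rootSine_add_half, ← rootSine_mul_self, ← rootSine_mul_self,
      twist, twist]
    push_cast
    ring
  · intro i i' h
    simp only [Prod.mk.injEq] at h
    exact Prod.ext h.1 h.2.2.1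
  · rintro ⟨a, b, c, d⟩
    constructor
    · rintro ⟨h1, h2⟩
      exact ⟨(a, c), by rw [← h1, ← h2]⟩
    · rintro ⟨i, h⟩
      simp only [Prod.mk.injEq] at h
      obtain ⟨rfl, rfl, rfl, rfl⟩ := h
      exact ⟨rfl, rfl⟩

theorem sum_shift_self (z : ZMod (2 * N) → ℂ) :
    ∑ p, ((ind (Shift12 p) * ind (Shift13 p) : ℝ) : ℂ) * weight z p =
    ∑ j, (ind (j + j + (j + j) = (N : ZMod (2 * N))) : ℂ) *
      ((sine j ^ 2 : ℝ) * twist z j ^ 2) := by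
  have hN := half_add_half (N := N)
  have e (p : Quad N) : ((ind (Shift12 p) * ind (Shift13 p) : ℝ) : ℂ) * weight z p =
      (ind (p.2.1 = p.1 + (N : ZMod (2 * N)) ∧ p.2.2.1 = p.1 + (N : ZMod (2 * N)) ∧
        p.2.2.2 = p.1) : ℂ) *
      (ind (p.1 + p.2.1 + p.2.2.1 + p.2.2.2 = (N : ZMod (2 * N))) * weight z p) := by
    rw [← mul_assoc, ← Complex.ofReal_mul, ← ind_and, ← ind_and]
    congr 2
    refine ind_congr ?_
    simp only [Shift12, Shift13]
    constructor
    · rintro ⟨⟨h1, h2, h3⟩, h4, h5, -⟩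
      exact ⟨⟨h1, h4, by linear_combination h5 + h1 + hN⟩, h3⟩
    · rintro ⟨⟨h1, h2, h3⟩, h4⟩
      exact ⟨⟨h1, by linear_combination h3 - h2 - hN, h4⟩, h2, by linear_combination h3 - h1 - hN,
        h4⟩
  simp only [e]
  rw [sum_ind_mul (fun i : ZMod (2 * N) =>
    ((i, i + (N : ZMod (2 * N)), i + (N : ZMod (2 * N)), i) : Quad N))]
  · refine Fintype.sum_congr _ _ fun j => ?_
    dsimp only
    have h := sine_sq_eq_rootSine_pow j
    rw [show j + (j + (N : ZMod (2 * N))) + (j + (N : ZMod (2 * N))) + j = j + j + (j + j) by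
      linear_combination half_add_half (N := N), weight, rootSine_add_half, twist]
    push_cast
    rw [h]
    ring
  · exact fun i i' h => congrArg Prod.fst h
  · rintro ⟨a, b, c, d⟩
    constructor
    · rintro ⟨h1, h2, h3⟩
      exact ⟨a, by dsimp only at *; rw [h1, h2, h3]⟩
    · rintro ⟨i, h⟩
      simp only [Prod.mk.injEq] at h
      obtain ⟨rfl, rfl, rfl, rfl⟩ := h
      exact ⟨rfl, rfl, rfl⟩

end Symmetrization

/-! ### The resonant terms in the variables `I`, `J`, `M`. -/

section Evaluation
open MvPolynomial
variable {N : ℕ} [NeZero N]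

theorem amplitude_mul_neg (w : PhaseSpace (Mode N)) {k : ℕ} (hk : k ∈ Finset.Icc 1 (N - 1)) :
    amplitude w (k : ZMod (2 * N)) * amplitude w (-(k : ZMod (2 * N))) = (actionI w k : ℂ) := by
  have h2 := sqrt_two_ne_zero
  have hI := Complex.I_sq
  rw [amplitude_neg, amplitude_natCast w hk, map_div₀, Complex.conj_ofReal, map_sub, map_mul,
    Complex.conj_I, Complex.conj_ofReal, Complex.conj_ofReal, div_mul_div_comm, ← pow_two,
    sqrt_two_sq, actionI]
  push_cast
  linear_combination (-(1 / 2) * (comp w.2 k : ℂ) ^ 2) * hI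

theorem sum_abs_sine_amplitude (w : PhaseSpace (Mode N)) :
    ∑ j, ((|sine j| : ℝ) : ℂ) * (amplitude w j * amplitude w (-j)) =
      ((2 * ∑ k ∈ Finset.Icc 1 (N - 1), sinMode N k * actionI w k : ℝ) : ℂ) := by
  rw [sum_modes]
  push_cast
  rw [Finset.mul_sum]
  simp only [amplitude_zero, amplitude_half, mul_zero, zero_mul, zero_add]
  refine Finset.sum_congr rfl fun k hk => ?_
  rw [neg_neg, sine_neg, abs_neg, sine_natCast, abs_of_pos (sinMode_pos hk),
    mul_comm (amplitude w (-(k : ZMod (2 * N)))), amplitude_mul_neg w hk]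
  ring

theorem sum_self_amplitude (w : PhaseSpace (Mode N)) (g : ZMod (2 * N) → ℝ) (G : ℕ → ℝ)
    (hg : ∀ j, g (-j) = g j)
    (hG : ∀ k ∈ Finset.Icc 1 (N - 1), g (k : ZMod (2 * N)) * sinMode N k ^ 2 = G k) :
    ∑ j, ((g j * sine j ^ 2 : ℝ) : ℂ) * (amplitude w j * amplitude w (-j)) ^ 2 =
      ((2 * ∑ k ∈ Finset.Icc 1 (N - 1), G k * actionI w k ^ 2 : ℝ) : ℂ) := by
  rw [sum_modes]
  push_cast
  rw [Finset.mul_sum]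
  simp only [amplitude_zero, amplitude_half, zero_mul, sine_zero, sine_half, zero_add,
    Complex.ofReal_zero, ne_eq, OfNat.ofNat_ne_zero, not_false_eq_true, zero_pow, mul_zero]
  refine Finset.sum_congr rfl fun k hk => ?_
  rw [neg_neg, sine_neg, hg, sine_natCast, mul_comm (amplitude w (-(k : ZMod (2 * N)))),
    amplitude_mul_neg w hk, ← hG k hk]
  push_cast
  ring

theorem twist_natCast (w : PhaseSpace (Mode N)) {k : ℕ} (hk : k ∈ Finset.Icc 1 (N - 1)) :
    twist (amplitude w) (k : ZMod (2 * N)) = actionJ w k + Complex.I * actionM w k := by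
  have h2 := sqrt_two_ne_zero
  have hI := Complex.I_sq
  have hk' : N - k ∈ Finset.Icc 1 (N - 1) := by rw [Finset.mem_Icc] at *; omega
  have e : (k : ZMod (2 * N)) + (N : ZMod (2 * N)) = -((N - k : ℕ) : ZMod (2 * N)) := by
    rw [Finset.mem_Icc] at hk
    rw [Nat.cast_sub (by omega)]
    linear_combination half_add_half (N := N)
  rw [twist, e, amplitude_neg, amplitude_natCast w hk, amplitude_natCast w hk', map_div₀,
    Complex.conj_ofReal, map_sub, map_mul, Complex.conj_I, Complex.conj_ofReal, Complex.conj_ofReal,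
    div_mul_div_comm, ← pow_two, sqrt_two_sq, actionJ, actionM]
  push_cast
  linear_combination (-(1 / 2) * (comp w.2 k : ℂ) * comp w.2 (N - k)) * hI

theorem twist_neg (w : PhaseSpace (Mode N)) (j : ZMod (2 * N)) :
    twist (amplitude w) (-j) = starRingEnd ℂ (twist (amplitude w) j) := by
  rw [twist, twist, map_mul, ← amplitude_neg, ← amplitude_neg]
  congr 2
  linear_combination half_add_half (N := N)

theorem twist_add_half (z : ZMod (2 * N) → ℂ) (j : ZMod (2 * N)) :
    twist z (j + (N : ZMod (2 * N))) = twist z j := by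
  rw [twist, twist, add_assoc, half_add_half, add_zero, mul_comm]

theorem abs_sine_add_half (j : ZMod (2 * N)) : |sine (j + (N : ZMod (2 * N)))| = |sine j| := by
  rw [sine_add_half, abs_neg]

theorem add_self_eq_add_self {a b : ZMod (2 * N)} :
    a + a = b + b ↔ a = b ∨ a = b + (N : ZMod (2 * N)) := by
  constructor
  · intro h
    rcases sine_eq_zero (sine_eq_zero_of_two_mul (j := a - b) (by linear_combination h)) with h | h
    · exact Or.inl (by linear_combination h)
    · exact Or.inr (by linear_combination h)
  · rintro (rfl | rfl)
    · rfl
    · linear_combination half_add_half (N := N)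

theorem ind_or {P Q : Prop} (h : ¬(P ∧ Q)) : ind (P ∨ Q) = ind P + ind Q := by
  by_cases hP : P <;> by_cases hQ : Q <;> simp_all [ind]

theorem sum_ind_eq {ι : Type*} [Fintype ι] (a : ι) (F : ι → ℂ) :
    ∑ l, (ind (l = a) : ℂ) * F l = F a := by
  rw [Finset.sum_eq_single a]
  · simp [ind]
  · intro b _ hb
    simp [ind, hb]
  · simp

theorem sum_range_two_mul_modes {F : ZMod (2 * N) → ℂ}
    (h : ∀ j, F (j + (N : ZMod (2 * N))) = F j) :
    ∑ j, F j = 2 * ∑ i ∈ Finset.range N, F (i : ZMod (2 * N)) := by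
  rw [sum_zmod_eq_sum_range, show Finset.range (2 * N) = Finset.range (N + N) by rw [two_mul],
    Finset.sum_range_add, two_mul (∑ i ∈ Finset.range N, F (i : ZMod (2 * N)))]
  congr 1
  refine Finset.sum_congr rfl fun i _ => ?_
  rw [Nat.cast_add, add_comm, h]

section Even
variable {n : ℕ}

/-- The umklapp interaction of two modes. -/
noncomputable def umklapp (z : ZMod (2 * N) → ℂ) (n : ℕ) (j : ZMod (2 * N)) : ℂ :=
  (|sine j| : ℝ) * (|sine ((n : ZMod (2 * N)) - j)| : ℝ) *
    (twist z j * twist z ((n : ZMod (2 * N)) - j))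

/-- For `N = 2 * n` the equation `2 j + 2 l = N` has the two solutions `l = n - j` and `l = n - j +
N`, on which the summand agrees. -/
theorem sum_shift12_eq (hn : N = n + n) (z : ZMod (2 * N) → ℂ) :
    ∑ p, (ind (Shift12 p) : ℂ) * weight z p = 2 * ∑ j, umklapp z n j := by
  have hN : (N : ZMod (2 * N)) = n + n := by exact_mod_cast congrArg (Nat.cast (R := ZMod (2 * N))) hn
  rw [sum_shift12, Finset.mul_sum]
  refine Fintype.sum_congr _ _ fun j => ?_
  have e (l : ZMod (2 * N)) : ind (j + j + (l + l) = (N : ZMod (2 * N))) =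
      ind (l = n - j) + ind (l = n - j + (N : ZMod (2 * N))) := by
    rw [← ind_or]
    · refine ind_congr ?_
      rw [← add_self_eq_add_self]
      constructor <;> intro h
      · linear_combination h + hN
      · linear_combination h - hN
    · rintro ⟨h1, h2⟩
      exact half_ne_zero (N := N) (by linear_combination h1 - h2)
  simp only [e, Complex.ofReal_add, add_mul, Finset.sum_add_distrib]
  rw [sum_ind_eq, sum_ind_eq, twist_add_half, abs_sine_add_half, umklapp]
  ring

theorem umklapp_add_half (z : ZMod (2 * N) → ℂ) (n : ℕ) (j : ZMod (2 * N)) :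
    umklapp z n (j + (N : ZMod (2 * N))) = umklapp z n j := by
  have e : (n : ZMod (2 * N)) - (j + (N : ZMod (2 * N))) = n - j + (N : ZMod (2 * N)) := by
    linear_combination -half_add_half (N := N)
  rw [umklapp, umklapp, e, twist_add_half, twist_add_half, abs_sine_add_half, abs_sine_add_half]

/-- Together with the period `N`, this reduces the sum over all `4 * n` modes to real parts over `1,
…, n - 1`. -/
theorem umklapp_add_quarter (hn : N = n + n) (w : PhaseSpace (Mode N)) (j : ZMod (2 * N)) :
    umklapp (amplitude w) n (n + j) = starRingEnd ℂ (umklapp (amplitude w) n j) := by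
  have hN : (N : ZMod (2 * N)) = n + n := by exact_mod_cast congrArg (Nat.cast (R := ZMod (2 * N))) hn
  have e1 : (n : ZMod (2 * N)) - (n + j) = -j := by ring
  have e2 : (n : ZMod (2 * N)) + j = -(n - j) + (N : ZMod (2 * N)) := by linear_combination -hN
  rw [umklapp, umklapp, e1, e2, twist_add_half, twist_neg, twist_neg, sine_neg, abs_neg,
    abs_sine_add_half, sine_neg, abs_neg]
  simp only [map_mul, Complex.conj_ofReal]
  ring

theorem umklapp_natCast (hn : N = n + n) (w : PhaseSpace (Mode N)) {k : ℕ}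
    (hk : k ∈ Finset.Icc 1 (n - 1)) :
    umklapp (amplitude w) n k + starRingEnd ℂ (umklapp (amplitude w) n k) =
      ((Real.sin (2 * k * Real.pi / N) * (actionJ w k * actionJ w (n - k) -
        actionM w k * actionM w (n - k)) : ℝ) : ℂ) := by
  have h1 : k ∈ Finset.Icc 1 (N - 1) := by rw [Finset.mem_Icc] at *; omega
  have h2 : n - k ∈ Finset.Icc 1 (N - 1) := by rw [Finset.mem_Icc] at *; omega
  have hs : Real.sin (2 * k * Real.pi / N) = 2 * (sinMode N k * sinMode N (n - k)) := by
    have hN : (N : ℝ) ≠ 0 := by exact_mod_cast NeZero.ne N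
    have hN' : (N : ℝ) = 2 * n := by rw [hn]; push_cast; ring
    have e : sinMode N (n - k) = Real.cos (k * Real.pi / N) := by
      rw [← Real.sin_pi_div_two_sub, sinMode, Nat.cast_sub (by rw [Finset.mem_Icc] at hk; omega)]
      congr 1
      field_simp
      rw [hN']
      ring
    rw [e, sinMode, ← mul_assoc, ← Real.sin_two_mul]
    congr 1
    ring
  have e : (n : ZMod (2 * N)) - k = ((n - k : ℕ) : ZMod (2 * N)) := by
    rw [Nat.cast_sub (by rw [Finset.mem_Icc] at hk; omega)]
  rw [umklapp, e, twist_natCast w h1, twist_natCast w h2, sine_natCast, sine_natCast,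
    abs_of_pos (sinMode_pos h1), abs_of_pos (sinMode_pos h2), hs]
  simp only [map_mul, map_add, Complex.conj_ofReal, Complex.conj_I]
  push_cast
  have hI := Complex.I_sq
  linear_combination (2 * (sinMode N k : ℂ) * sinMode N (n - k) * actionM w k *
    actionM w (n - k)) * hI

/-- The reflection `k ↦ n - k` exchanges the terms below and above `N / 4`; its fixed point is an
index only if `4 ∣ N`. -/
theorem sum_fold (hn : N = n + n) (t : ℕ → ℝ) (ht : ∀ k ∈ Finset.Icc 1 (n - 1), t (n - k) = t k) :
    ∑ k ∈ Finset.Icc 1 (n - 1), t k = 2 * ∑ k ∈ Finset.Icc 1 (N - 1) with 4 * k < N, t k +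
      if 4 ∣ N then t (N / 4) else 0 := by
  have h0 : n ≠ 0 := by rintro rfl; exact NeZero.ne N hn
  rw [← Finset.sum_filter_add_sum_filter_not (Finset.Icc 1 (n - 1)) (fun k => 2 * k < n),
    ← Finset.sum_filter_add_sum_filter_not ((Finset.Icc 1 (n - 1)).filter fun k => ¬2 * k < n)
      (fun k => 2 * k = n)]
  have e1 : (Finset.Icc 1 (n - 1)).filter (fun k => 2 * k < n) =
      (Finset.Icc 1 (N - 1)).filter fun k => 4 * k < N := by
    ext k; simp only [Finset.mem_filter, Finset.mem_Icc]; omega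
  have e2 : ∑ k ∈ ((Finset.Icc 1 (n - 1)).filter fun k => ¬2 * k < n).filter (fun k => ¬2 * k = n),
      t k = ∑ k ∈ (Finset.Icc 1 (n - 1)).filter (fun k => 2 * k < n), t k := by
    refine Finset.sum_nbij' (fun k => n - k) (fun k => n - k) ?_ ?_ ?_ ?_ ?_
    · intro k; simp only [Finset.mem_filter, Finset.mem_Icc]; omega
    · intro k; simp only [Finset.mem_filter, Finset.mem_Icc]; omega
    · intro k; simp only [Finset.mem_filter, Finset.mem_Icc]; omega
    · intro k; simp only [Finset.mem_filter, Finset.mem_Icc]; omega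
    · intro k hk
      simp only [Finset.mem_filter] at hk
      exact (ht k hk.1.1).symm
  have e3 : ∑ k ∈ ((Finset.Icc 1 (n - 1)).filter fun k => ¬2 * k < n).filter (fun k => 2 * k = n),
      t k = if 4 ∣ N then t (N / 4) else 0 := by
    split_ifs with h
    · rw [Finset.sum_eq_single (N / 4)]
      · intro b hb hb'
        simp only [Finset.mem_filter, Finset.mem_Icc] at hb
        omega
      · intro hb
        simp only [Finset.mem_filter, Finset.mem_Icc] at hb
        omega
    · refine Finset.sum_eq_zero fun k hk => ?_
      simp only [Finset.mem_filter, Finset.mem_Icc] at hk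
      omega
  rw [e2, e3, e1]
  ring

theorem sum_umklapp (hn : N = n + n) (w : PhaseSpace (Mode N)) :
    ∑ j, umklapp (amplitude w) n j =
      ((resonantSum N (actionJ w) (actionM w) + 2 * resonantQuarter N (actionJ w) (actionM w) : ℝ) :
        ℂ) := by
  have h0 : n ≠ 0 := by rintro rfl; exact NeZero.ne N hn
  have : NeZero n := ⟨h0⟩
  set t : ℕ → ℝ := fun k => Real.sin (2 * k * Real.pi / N) * (actionJ w k * actionJ w (n - k) -
        actionM w k * actionM w (n - k)) with ht
  have e1 : ∑ i ∈ Finset.range N, umklapp (amplitude w) n (i : ZMod (2 * N)) =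
      ((∑ k ∈ Finset.Icc 1 (n - 1), t k : ℝ) : ℂ) := by
    rw [show Finset.range N = Finset.range (n + n) by rw [← hn], Finset.sum_range_add,
      ← Finset.sum_add_distrib]
    simp only [Nat.cast_add, umklapp_add_quarter hn]
    rw [sum_range_eq_zero_add]
    simp only [Nat.cast_zero]
    have : umklapp (amplitude w) n (0 : ZMod (2 * N)) = 0 := by simp [umklapp]
    rw [this, map_zero, zero_add, zero_add]
    push_cast [ht]
    refine Finset.sum_congr rfl fun k hk => ?_
    have := umklapp_natCast hn w hk
    push_cast at this
    exact this
  have hN : (N : ℝ) ≠ 0 := by exact_mod_cast NeZero.ne N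
  have hN' : (N : ℝ) = 2 * n := by rw [hn]; push_cast; ring
  rw [sum_range_two_mul_modes (umklapp_add_half _ n), e1, sum_fold hn t, resonantSum,
    resonantQuarter]
  · have h2 : N / 2 = n := by omega
    rw [h2]
    push_cast
    split_ifs with h4
    · obtain ⟨m, hm⟩ := h4
      have hq : t (N / 4) = actionJ w (N / 4) ^ 2 - actionM w (N / 4) ^ 2 := by
        have h5 : N / 4 = m := by omega
        have h6 : n - m = m := by omega
        rw [ht]
        dsimp only
        rw [h5, h6, show 2 * (m : ℝ) * Real.pi / N = Real.pi / 2 from ?_, Real.sin_pi_div_two]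
        · ring
        · have : (N : ℝ) = 4 * m := by rw [hm]; push_cast; ring
          field_simp
          rw [this]; ring
      rw [hq, ht]
      push_cast
      ring
    · rw [ht]
      push_cast
      ring
  · intro k hk
    rw [Finset.mem_Icc] at hk
    rw [ht]
    dsimp only
    rw [show n - (n - k) = k by omega, Nat.cast_sub (by omega),
      show 2 * ((n : ℝ) - k) * Real.pi / N = Real.pi - 2 * k * Real.pi / N from ?_, Real.sin_pi_sub]
    · ring
    · field_simp
      rw [hN']; ring

/-- The condition `4 k = N` modulo `2 * N` is solved by `± N / 4` and `± 3 N / 4`. There `sin² = 1 /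
2`, and the twist is `T`, `conj T`, each for two of the modes, with `T = J + i M`. -/
theorem sum_shift_self_eq (w : PhaseSpace (Mode N)) :
    ∑ p, ((ind (Shift12 p) * ind (Shift13 p) : ℝ) : ℂ) * weight (amplitude w) p =
      ((2 * resonantQuarter N (actionJ w) (actionM w) : ℝ) : ℂ) := by
  have hN0 := NeZero.pos N
  rw [sum_shift_self, sum_modes]
  simp only [sine_zero, sine_half, ne_eq, OfNat.ofNat_ne_zero, not_false_eq_true, zero_pow,
    Complex.ofReal_zero, zero_mul, mul_zero, zero_add]
  have cast_iff (k : ℕ) (hk : k ∈ Finset.Icc 1 (N - 1)) :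
      (k : ZMod (2 * N)) + k + (k + k) = (N : ZMod (2 * N)) ↔ 4 * k = N ∨ 4 * k = 3 * N := by
    rw [Finset.mem_Icc] at hk
    rw [show (k : ZMod (2 * N)) + k + (k + k) = ((4 * k : ℕ) : ZMod (2 * N)) by push_cast; ring,
      ZMod.natCast_eq_natCast_iff]
    constructor
    · intro h
      have h' : (4 * k) % (2 * N) = N := by rw [h, Nat.mod_eq_of_lt (by omega)]
      have h3 := Nat.div_add_mod (4 * k) (2 * N)
      rw [h'] at h3
      have h4 : 4 * k / (2 * N) < 2 := by rw [Nat.div_lt_iff_lt_mul (by omega)]; omega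
      interval_cases 4 * k / (2 * N) <;> omega
    · rintro (h | h)
      · rw [h]
      · rw [h, Nat.ModEq, show 3 * N = N + 2 * N by ring, Nat.add_mod_right]
  have e (k : ℕ) : ind (-(k : ZMod (2 * N)) + -k + (-k + -k) = (N : ZMod (2 * N))) =
      ind ((k : ZMod (2 * N)) + k + (k + k) = (N : ZMod (2 * N))) := by
    refine ind_congr ?_
    have := half_add_half (N := N)
    constructor <;> intro h <;> linear_combination -h - this
  rw [resonantQuarter]
  split_ifs with h4
  · obtain ⟨m, hm⟩ := h4
    have h5 : N / 4 = m := by omega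
    have hm1 : m ∈ Finset.Icc 1 (N - 1) := by rw [Finset.mem_Icc]; omega
    have hm3 : 3 * m ∈ Finset.Icc 1 (N - 1) := by rw [Finset.mem_Icc]; omega
    have hsub : {m, 3 * m} ⊆ Finset.Icc 1 (N - 1) := by
      intro k hk
      rw [Finset.mem_insert, Finset.mem_singleton] at hk
      rcases hk with rfl | rfl <;> assumption
    rw [← Finset.sum_subset hsub, Finset.sum_pair (by omega)]
    · have i1 : ind ((m : ZMod (2 * N)) + m + (m + m) = (N : ZMod (2 * N))) = 1 :=
        ind_true ((cast_iff m hm1).2 (by omega))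
      have i3 : ind (((3 * m : ℕ) : ZMod (2 * N)) + (3 * m : ℕ) + ((3 * m : ℕ) + (3 * m : ℕ)) =
          (N : ZMod (2 * N))) = 1 := ind_true ((cast_iff _ hm3).2 (by omega))
      have e3 : ((3 * m : ℕ) : ZMod (2 * N)) = -m + (N : ZMod (2 * N)) := by
        rw [show (N : ZMod (2 * N)) = ((4 * m : ℕ) : ZMod (2 * N)) by rw [← hm]]
        push_cast; ring
      have hs : sine (m : ZMod (2 * N)) ^ 2 = 1 / 2 := by
        have : (N : ℝ) = 4 * m := by rw [hm]; push_cast; ring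
        have hN : (N : ℝ) ≠ 0 := by exact_mod_cast NeZero.ne N
        rw [sine_natCast, sinMode, show (m : ℝ) * Real.pi / N = Real.pi / 4 from ?_,
          Real.sin_pi_div_four, div_pow, Real.sq_sqrt] <;> try norm_num
        field_simp
        rw [this]; ring
      rw [e, e, i1, i3, e3, twist_add_half, neg_add, neg_half, twist_add_half, neg_neg, sine_add_half,
        sine_add_half, neg_sq, neg_sq, sine_neg, neg_sq, hs, twist_neg, twist_natCast w hm1, h5]
      simp only [map_mul, map_add, Complex.conj_ofReal, Complex.conj_I]
      push_cast
      have hI := Complex.I_sq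
      linear_combination (2 * (actionM w m : ℂ) ^ 2) * hI
    · intro k hk hk'
      rw [Finset.mem_insert, Finset.mem_singleton] at hk'
      rw [e, ind_false fun h => ?_]
      · simp
      · have := (cast_iff k hk).1 h
        omega
  · rw [mul_zero, Complex.ofReal_zero]
    refine Finset.sum_eq_zero fun k hk => ?_
    rw [e, ind_false fun h => ?_]
    · simp
    · have := (cast_iff k hk).1 h
      omega

theorem aeval_quarticForm (z : ZMod (2 * N) → ℂ) (c : Quad N → ℂ) :
    aeval z (quarticForm c) = ∑ p, c p * (z p.1 * z p.2.1 * z p.2.2.1 * z p.2.2.2) := by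
  simp [quarticForm, map_sum]

theorem aeval_quadratic (z : ZMod (2 * N) → ℂ) :
    aeval z (quadratic N) = ∑ j, ((|sine j| : ℝ) : ℂ) * (z j * z (-j)) := by
  simp [quadratic, map_sum]

theorem aeval_resonantForm (z : ZMod (2 * N) → ℂ) (a b : ℝ) :
    aeval z (resonantForm a b) = b * ∑ p, (windInd p : ℂ) * weight z p +
      9 / 2 * a ^ 2 * ∑ p, ((windInd p * exchange p.1 p.2.1 : ℝ) : ℂ) * weight z p := by
  rw [resonantForm, aeval_quarticForm, Finset.mul_sum, Finset.mul_sum, ← Finset.sum_add_distrib]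
  refine Fintype.sum_congr _ _ fun p => ?_
  rw [windInd, weight]
  split_ifs with h
  · rw [reducedCoeff, quarticCoeff, kappa_of_quadFreq_eq_zero h, ind_true h]
    push_cast
    ring
  · rw [ind_false h]
    simp

theorem sum_ne_eq (s : Finset ℕ) (f g : ℕ → ℝ) :
    ∑ l ∈ s, ∑ m ∈ s with l ≠ m, f l * f m * g l * g m =
      (∑ k ∈ s, f k * g k) ^ 2 - ∑ k ∈ s, f k ^ 2 * g k ^ 2 := by
  rw [pow_two, Finset.sum_mul_sum, ← Finset.sum_sub_distrib]
  refine Finset.sum_congr rfl fun l hl => ?_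
  rw [Finset.sum_filter, ← Finset.sum_erase_add _ _ hl, ← Finset.sum_erase_add _ _ hl]
  simp only [ne_eq, not_true_eq_false, if_false]
  rw [add_zero, show f l * g l * (f l * g l) = f l ^ 2 * g l ^ 2 by ring, add_sub_cancel_right]
  refine Finset.sum_congr rfl fun m hm => ?_
  rw [if_pos (Finset.ne_of_mem_erase hm).symm]
  ring

/-- The resonant normal form in terms of the actions. -/
theorem aeval_normalForm (hEven : Even N) (α β : ℝ) (w : PhaseSpace (Mode N)) :
    aeval (amplitude w) (quadratic N + resonantForm (α / (6 * Real.sqrt N)) (β / (24 * N))) =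
      ((normalForm N α β (actionI w) - resonantTerm N α β (actionJ w) (actionM w) : ℝ) : ℂ) := by
  obtain ⟨n, hn⟩ := hEven
  have hN : (N : ℝ) ≠ 0 := by exact_mod_cast NeZero.ne N
  have hNc : (N : ℂ) ≠ 0 := by exact_mod_cast NeZero.ne N
  have hsq : (α / (6 * Real.sqrt N)) ^ 2 = α ^ 2 / (36 * N) := by
    rw [div_pow, mul_pow, Real.sq_sqrt (by positivity)]; norm_num
  have hsqc : ((α / (6 * Real.sqrt N) : ℝ) : ℂ) ^ 2 = α ^ 2 / (36 * N) := by exact_mod_cast hsq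
  set A : ℝ := ∑ k ∈ Finset.Icc 1 (N - 1), sinMode N k * actionI w k with hA
  set B : ℝ := ∑ k ∈ Finset.Icc 1 (N - 1), sinMode N k ^ 2 * actionI w k ^ 2 with hB
  set D : ℝ := ∑ k ∈ Finset.Icc 1 (N - 1), actionI w k ^ 2 with hD
  set R : ℝ := resonantSum N (actionJ w) (actionM w) with hR
  set Q : ℝ := resonantQuarter N (actionJ w) (actionM w) with hQ
  have z1 := sum_windInd (amplitude w)
  rw [sum_weight_pairInd, sum_weight_shiftInd, sum_pair12, sum_abs_sine_amplitude,
    sum_shift12_eq hn, sum_umklapp hn, sum_shift_self_eq] at z1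
  have x1 := sum_windInd_exchange (amplitude w)
  have s1 := sum_pair_self (amplitude w) (fun _ => 1)
  have s2 := sum_pair_self (amplitude w) (fun j => (sine j ^ 2)⁻¹)
  rw [sum_self_amplitude w _ (fun k => sinMode N k ^ 2) (fun _ => rfl)
    (fun k _ => one_mul _)] at s1
  rw [sum_self_amplitude w _ (fun k => 1) (fun j => by rw [sine_neg, neg_sq])
    (fun k hk => by
      rw [sine_natCast, inv_mul_cancel₀ (pow_ne_zero 2 (sinMode_pos hk).ne')])] at s2
  simp only [mul_one, one_mul] at s1 s2
  rw [s1, ← hA, ← hB, ← hR, ← hQ] at z1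
  rw [s2] at x1
  have r1 : normalForm N α β (actionI w) - resonantTerm N α β (actionJ w) (actionM w) =
      2 * A + 1 / (4 * N) * (α ^ 2 * D + (β - α ^ 2) * B) + (β - α ^ 2) / (2 * N) * (A ^ 2 - B) -
      (β - α ^ 2) / (4 * N) * (R + Q) := by
    rw [normalForm, resonantTerm, sum_ne_eq]
    have : ∑ k ∈ Finset.Icc 1 (N - 1), coeff N α β k * actionI w k ^ 2 =
        α ^ 2 * D + (β - α ^ 2) * B := by
      rw [hD, hB, Finset.mul_sum, Finset.mul_sum, ← Finset.sum_add_distrib]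
      exact Finset.sum_congr rfl fun k _ => by rw [coeff]; ring
    rw [this]
  rw [map_add, aeval_quadratic, sum_abs_sine_amplitude, aeval_resonantForm, hsqc, r1]
  set Z := ∑ p, (windInd p : ℂ) * weight (amplitude w) p
  set X := ∑ p, ((windInd p * exchange p.1 p.2.1 : ℝ) : ℂ) * weight (amplitude w) p
  -- With `a` and `b` the parameters of `resonantForm`, the coefficient of `Z` becomes `b - 3/2 a² =
  -- (β - α²) / (24 N)`, where `Z = 12 A² - 6 B - 6 R - 6 Q`, and the remaining term is `9 a² D = α²
  -- D / (4 N)`.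
  have x2 : X = (-Z + 3 * ((2 * D : ℝ) : ℂ)) / 3 := by rw [← x1]; ring
  rw [x2, z1, ← hA]
  push_cast
  field_simp
  ring

end Even
end Evaluation

/-! ### Discrete Fourier transform on the chain. -/

section Fourier
variable {N : ℕ} [NeZero N]

/-- Reduction of wave numbers modulo `N`. -/
def toZMod (j : ZMod (2 * N)) : ZMod N := ZMod.castHom (Dvd.intro_left 2 rfl) (ZMod N) j

/-- The Fourier modes `exp (2 π i n j / N)`. -/
noncomputable def mode (n : ZMod N) (j : ZMod (2 * N)) : ℂ := ZMod.stdAddChar (n * toZMod j)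

theorem mode_add (n : ZMod N) (j l : ZMod (2 * N)) : mode n (j + l) = mode n j * mode n l := by
  rw [mode, toZMod, map_add, mul_add, AddChar.map_add_eq_mul]
  rfl

theorem mode_neg (n : ZMod N) (j : ZMod (2 * N)) : mode n (-j) = starRingEnd ℂ (mode n j) := by
  have e : toZMod (-j) = -toZMod j := map_neg _ _
  rw [mode, e, mul_neg, AddChar.map_neg_eq_inv, mode, ZMod.stdAddChar_apply,
    ← Circle.coe_inv_eq_conj, Circle.coe_inv]

theorem mode_succ (n : ZMod N) (j : ZMod (2 * N)) :
    mode (n + 1) j = mode n j * (phase j * phase j) := by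
  rw [mode, mode, add_mul, one_mul, AddChar.map_add_eq_mul]
  congr 1
  obtain ⟨k, rfl⟩ := ZMod.natCast_zmod_surjective j
  have h := ZMod.stdAddChar_coe (N := N) (k : ℤ)
  rw [← phase_add, ← Nat.cast_add, phase_natCast, toZMod, map_natCast]
  push_cast at h ⊢
  rw [h]
  congr 1
  ring

theorem toZMod_eq_zero {j : ZMod (2 * N)} : toZMod j = 0 ↔ j = 0 ∨ j = (N : ZMod (2 * N)) := by
  have hN := NeZero.pos N
  constructor
  · intro h
    rw [← ZMod.natCast_zmod_val j, toZMod, map_natCast, ZMod.natCast_eq_zero_iff] at h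
    have h1 := ZMod.val_lt j
    obtain ⟨c, hc⟩ := h
    have h2 : c < 2 := by
      by_contra h2
      have : N * 2 ≤ N * c := Nat.mul_le_mul_left N (by omega)
      omega
    interval_cases c
    · left
      rw [← ZMod.natCast_zmod_val j, hc]; simp
    · right
      rw [← ZMod.natCast_zmod_val j, hc]; simp
  · rintro (rfl | rfl)
    · simp [toZMod]
    · rw [toZMod, map_natCast, ZMod.natCast_self]

/-- Orthogonality of characters modulo `N` leaves `J = 0` and `J = N`; the half-step factor `phase
J` is `1` and `-1` there. This is the origin of `wind`. -/
theorem sum_phase_mul_mode (J : ZMod (2 * N)) :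
    ∑ n : ZMod N, phase J * mode n J = N * wind J := by
  rw [← Finset.mul_sum]
  simp only [mode]
  rw [AddChar.sum_mulShift _ (ZMod.isPrimitive_stdAddChar N), ZMod.card]
  by_cases h0 : J = 0
  · rw [if_pos (toZMod_eq_zero.2 (Or.inl h0)), h0, phase_zero, wind_zero]; simp
  by_cases h1 : J = (N : ZMod (2 * N))
  · rw [if_pos (toZMod_eq_zero.2 (Or.inr h1)), h1, phase_half, wind_half]; simp
  · rw [if_neg fun h => (toZMod_eq_zero.1 h).elim h0 h1, wind, if_neg h0, if_neg h1]; simp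

theorem sum_mode_mul (p : ZMod (2 * N)) (G : ZMod (2 * N) → ℂ) :
    ∑ n : ZMod N, ∑ j, mode n (p + j) * G j = N * (G (-p) + G (-p + (N : ZMod (2 * N)))) := by
  have h := sum_wind p (fun j => phase (-(p + j)) * G j)
  have e1 : -(p + -p) = 0 := by ring
  have e2 : -(p + (-p + (N : ZMod (2 * N)))) = (N : ZMod (2 * N)) := by
    linear_combination -half_add_half (N := N)
  rw [e1, e2, phase_zero, phase_half] at h
  rw [Finset.sum_comm, show G (-p) + G (-p + (N : ZMod (2 * N))) =
    1 * G (-p) - -1 * G (-p + (N : ZMod (2 * N))) by ring, ← h, Finset.mul_sum]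
  refine Fintype.sum_congr _ _ fun j => ?_
  have h1 := sum_phase_mul_mode (p + j)
  rw [← Finset.mul_sum] at h1
  have h2 : phase (-(p + j)) * phase (p + j) = 1 := by
    rw [← phase_add, neg_add_cancel, phase_zero]
  rw [← Finset.sum_mul, Complex.real_smul]
  linear_combination (phase (-(p + j)) * G j) * h1 - (∑ n : ZMod N, mode n (p + j)) * G j * h2

/-- The superposition of modes with coefficients `c` and amplitudes `z`. -/
noncomputable def wave (c z : ZMod (2 * N) → ℂ) (n : ZMod N) : ℂ := ∑ j, c j * mode n j * z j

theorem sum_wave_mul_wave (c d z z' : ZMod (2 * N) → ℂ) : ∑ n, wave c z n * wave d z' n =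
    N * ∑ j, c j * z j * (d (-j) * z' (-j) +
      d (-j + (N : ZMod (2 * N))) * z' (-j + (N : ZMod (2 * N)))) := by
  have e (n : ZMod N) : wave c z n * wave d z' n =
      ∑ j, c j * z j * ∑ l, mode n (j + l) * (d l * z' l) := by
    rw [wave, wave, Finset.sum_mul_sum]
    refine Fintype.sum_congr _ _ fun j => ?_
    rw [Finset.mul_sum]
    refine Fintype.sum_congr _ _ fun l => ?_
    rw [mode_add]
    ring
  simp only [e]
  rw [Finset.sum_comm, Finset.mul_sum]
  refine Fintype.sum_congr _ _ fun j => ?_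
  rw [← Finset.mul_sum, sum_mode_mul]
  ring

theorem sum_wave (c z : ZMod (2 * N) → ℂ) (h0 : c 0 = 0) (hN : c (N : ZMod (2 * N)) = 0) :
    ∑ n, wave c z n = 0 := by
  have h := sum_mode_mul (0 : ZMod (2 * N)) fun j => c j * z j
  simp only [zero_add, neg_zero, h0, hN, zero_mul, mul_zero, add_zero] at h
  rw [← h]
  refine Fintype.sum_congr _ _ fun n => Fintype.sum_congr _ _ fun j => ?_
  ring

theorem wave_conj {c z : ZMod (2 * N) → ℂ} (hc : ∀ j, c (-j) = starRingEnd ℂ (c j))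
    (hz : ∀ j, z (-j) = starRingEnd ℂ (z j)) (n : ZMod N) :
    ((wave c z n).re : ℂ) = wave c z n := by
  rw [← Complex.conj_eq_iff_re, wave, map_sum]
  refine Fintype.sum_equiv (Equiv.neg _) _ _ fun j => ?_
  rw [Equiv.neg_apply, hc, hz, mode_neg, map_mul, map_mul]

/-- The coefficients of the positions. -/
noncomputable def posCoeff (j : ZMod (2 * N)) : ℂ := rootSine j / (2 * Complex.I * sine j)

/-- The coefficients of the momenta. -/
noncomputable def momCoeff (j : ZMod (2 * N)) : ℂ := rootSine j

/-- The coefficients of the elongations. -/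
noncomputable def elongCoeff (j : ZMod (2 * N)) : ℂ := phase j * rootSine j

theorem posCoeff_neg (j : ZMod (2 * N)) : posCoeff (-j) = -posCoeff j := by
  rw [posCoeff, posCoeff, rootSine_neg, sine_neg, Complex.ofReal_neg, mul_neg, div_neg]

theorem conj_posCoeff (j : ZMod (2 * N)) : posCoeff (-j) = starRingEnd ℂ (posCoeff j) := by
  rw [posCoeff_neg, posCoeff, map_div₀, map_mul, map_mul, Complex.conj_ofReal, Complex.conj_ofReal,
    Complex.conj_I, Complex.conj_ofNat, mul_neg, neg_mul, div_neg]

theorem posCoeff_add_half (j : ZMod (2 * N)) :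
    posCoeff (j + (N : ZMod (2 * N))) = -posCoeff j := by
  rw [posCoeff, posCoeff, rootSine_add_half, sine_add_half, Complex.ofReal_neg, mul_neg, div_neg]

/-- Division by `0` has value `0`, so the two modes of zero frequency drop out; uniform motion is
carried by `Q` and `P` instead. -/
theorem posCoeff_zero : posCoeff (0 : ZMod (2 * N)) = 0 := by simp [posCoeff]
theorem posCoeff_half : posCoeff (N : ZMod (2 * N)) = 0 := by simp [posCoeff]
theorem momCoeff_zero : momCoeff (0 : ZMod (2 * N)) = 0 := by simp [momCoeff, rootSine]
theorem momCoeff_half : momCoeff (N : ZMod (2 * N)) = 0 := by simp [momCoeff, rootSine]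

theorem conj_momCoeff (j : ZMod (2 * N)) : momCoeff (-j) = starRingEnd ℂ (momCoeff j) := by
  rw [momCoeff, momCoeff, Complex.conj_ofReal, rootSine_neg]

theorem conj_elongCoeff (j : ZMod (2 * N)) : elongCoeff (-j) = starRingEnd ℂ (elongCoeff j) := by
  rw [elongCoeff, elongCoeff, map_mul, Complex.conj_ofReal, rootSine_neg, phase_neg_eq_conj]

/-- A step along the chain multiplies a mode by `phase j ^ 2`, and `phase j ^ 2 - 1 = phase j * (2 i
sine j)` cancels the denominator of `posCoeff`. -/
theorem wave_posCoeff_succ_sub (z : ZMod (2 * N) → ℂ) (n : ZMod N) :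
    wave posCoeff z (n + 1) - wave posCoeff z n = wave elongCoeff z n := by
  rw [wave, wave, wave, ← Finset.sum_sub_distrib]
  refine Fintype.sum_congr _ _ fun j => ?_
  have h1 := two_I_sine' j
  have hp := phase_ne_zero j
  have h2 : phase j * phase j - 1 = phase j * (2 * Complex.I * sine j) := by
    rw [h1]; field_simp
  have h3 : posCoeff j * (2 * Complex.I * sine j) = rootSine j := by
    by_cases h : sine j = 0
    · simp [posCoeff, rootSine_eq_zero h]
    · have : (2 * Complex.I * sine j : ℂ) ≠ 0 :=
        mul_ne_zero (mul_ne_zero two_ne_zero Complex.I_ne_zero) (by exact_mod_cast h)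
      rw [posCoeff, div_mul_cancel₀ _ this]
  rw [mode_succ, elongCoeff, ← h3]
  linear_combination (posCoeff j * mode n j * z j) * h2

theorem two_mul_posCoeff_mul_momCoeff (j : ZMod (2 * N)) :
    2 * (posCoeff j * momCoeff j) = -Complex.I * sgn j := by
  by_cases h : sine j = 0
  · simp [posCoeff, sgn, h]
  have h' : (sine j : ℂ) ≠ 0 := by exact_mod_cast h
  have e : (sgn j : ℂ) * sine j = rootSine j * rootSine j := by
    rw [rootSine_mul_self]
    have : sgn j * sine j = |sine j| := by
      rcases lt_or_gt_of_ne h with h0 | h0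
      · rw [sgn, Real.sign_of_neg h0, abs_of_neg h0, neg_one_mul]
      · rw [sgn, Real.sign_of_pos h0, abs_of_pos h0, one_mul]
    exact_mod_cast this
  have hI := Complex.I_ne_zero
  have hI2 := Complex.I_sq
  rw [posCoeff, momCoeff]
  field_simp
  rw [pow_two, ← e]
  linear_combination ((sgn j : ℂ) * sine j) * hI2

end Fourier

/-! ### The linear canonical transformation to normal modes. -/

section Linear
variable {N : ℕ} [NeZero N]

/-- The oscillating part of the positions or momenta. -/
noncomputable def oscillation (c : ZMod (2 * N) → ℂ) (w : PhaseSpace (Mode N)) (n : ZMod N) : ℝ :=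
  (wave c (amplitude w) n).re / Real.sqrt N

theorem oscillation_add (c : ZMod (2 * N) → ℂ) (w w' : PhaseSpace (Mode N)) (n : ZMod N) :
    oscillation c (w + w') n = oscillation c w n + oscillation c w' n := by
  rw [oscillation, oscillation, oscillation, ← add_div, ← Complex.add_re, wave, wave, wave,
    ← Finset.sum_add_distrib]
  simp only [amplitude_add, mul_add]

theorem oscillation_smul (c : ZMod (2 * N) → ℂ) (r : ℝ) (w : PhaseSpace (Mode N)) (n : ZMod N) :
    oscillation c (r • w) n = r * oscillation c w n := by
  rw [oscillation, oscillation, ← mul_div_assoc, ← Complex.re_ofReal_mul, wave, wave,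
    Finset.mul_sum]
  simp only [amplitude_smul, mul_left_comm]

theorem sum_oscillation {c : ZMod (2 * N) → ℂ} (h0 : c 0 = 0) (hN : c (N : ZMod (2 * N)) = 0)
    (w : PhaseSpace (Mode N)) : ∑ n, oscillation c w n = 0 := by
  simp only [oscillation]
  rw [← Finset.sum_div, ← Complex.re_sum, sum_wave _ _ h0 hN]
  simp

theorem ofReal_oscillation {c : ZMod (2 * N) → ℂ} (hc : ∀ j, c (-j) = starRingEnd ℂ (c j))
    (w : PhaseSpace (Mode N)) (n : ZMod N) :
    (oscillation c w n : ℂ) = wave c (amplitude w) n / (Real.sqrt N : ℝ) := by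
  rw [oscillation, Complex.ofReal_div, wave_conj hc (amplitude_neg w)]

theorem sqrt_cast_sq : ((Real.sqrt N : ℝ) : ℂ) ^ 2 = N := by
  rw [← Complex.ofReal_pow, Real.sq_sqrt (by positivity)]; simp

theorem sqrt_cast_ne_zero : ((Real.sqrt N : ℝ) : ℂ) ≠ 0 := by
  have : (0 : ℝ) < N := by exact_mod_cast NeZero.pos N
  rw [Complex.ofReal_ne_zero]
  positivity

/-- Orthogonality on the chain couples `j` with `-j` and with `-j + N`. Under the shift by `N`,
`posCoeff` is odd and `momCoeff` is even, so the unwanted second coupling cancels between the two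
products. -/
theorem symp_oscillation (a b : PhaseSpace (Mode N)) :
    ∑ n, (oscillation posCoeff a n * oscillation momCoeff b n -
      oscillation momCoeff a n * oscillation posCoeff b n) = symp a b := by
  have h2 := sqrt_cast_ne_zero (N := N)
  have hN : (N : ℂ) ≠ 0 := by exact_mod_cast NeZero.ne N
  have : ((∑ n, (oscillation posCoeff a n * oscillation momCoeff b n -
      oscillation momCoeff a n * oscillation posCoeff b n) : ℝ) : ℂ) = (symp a b : ℂ) := by
    rw [symp_eq_sum_amplitude]
    push_cast
    simp only [ofReal_oscillation conj_posCoeff, ofReal_oscillation conj_momCoeff,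
      div_mul_div_comm, ← pow_two, sqrt_cast_sq]
    rw [Finset.sum_sub_distrib, ← Finset.sum_div, ← Finset.sum_div, sum_wave_mul_wave,
      sum_wave_mul_wave, mul_div_cancel_left₀ _ hN, mul_div_cancel_left₀ _ hN,
      ← Finset.sum_sub_distrib]
    refine Fintype.sum_congr _ _ fun j => ?_
    rw [posCoeff_add_half, posCoeff_neg, momCoeff, momCoeff, momCoeff, rootSine_add_half,
      rootSine_neg]
    have := two_mul_posCoeff_mul_momCoeff j
    rw [momCoeff] at this
    linear_combination (amplitude a j * amplitude b (-j)) * this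
  exact_mod_cast this

/-- The linear canonical transformation to the normal modes, as a map to the phase space. -/
noncomputable def fromModes : CoordSpace N →ₗ[ℝ] PhaseSpace (ZMod N) where
  toFun x := (fun n => x.1.1 + oscillation posCoeff x.2 n,
    fun n => x.1.2 / N + oscillation momCoeff x.2 n)
  map_add' x y := by
    ext n <;> simp only [Prod.fst_add, Prod.snd_add, Pi.add_apply, oscillation_add] <;> ring
  map_smul' r x := by
    ext n <;> simp only [Prod.smul_fst, Prod.smul_snd, Pi.smul_apply, oscillation_smul,
      smul_eq_mul, RingHom.id_apply] <;> ring

theorem symp_fromModes (x y : CoordSpace N) :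
    symp (fromModes x) (fromModes y) = coordSymp N x y := by
  have hN : (N : ℝ) ≠ 0 := by exact_mod_cast NeZero.ne N
  have e : symp (fromModes x) (fromModes y) =
      ∑ n : ZMod N, (x.1.1 * (y.1.2 / N) - x.1.2 / N * y.1.1) +
      (x.1.1 * ∑ n, oscillation momCoeff y.2 n + y.1.2 / N * ∑ n, oscillation posCoeff x.2 n -
        x.1.2 / N * ∑ n, oscillation posCoeff y.2 n - y.1.1 * ∑ n, oscillation momCoeff x.2 n) +
      ∑ n, (oscillation posCoeff x.2 n * oscillation momCoeff y.2 n -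
      oscillation momCoeff x.2 n * oscillation posCoeff y.2 n) := by
    rw [symp]
    simp only [Finset.mul_sum, ← Finset.sum_add_distrib, ← Finset.sum_sub_distrib]
    refine Fintype.sum_congr _ _ fun n => ?_
    simp only [fromModes, LinearMap.coe_mk, AddHom.coe_mk]
    ring
  rw [e, symp_oscillation, sum_oscillation posCoeff_zero posCoeff_half,
    sum_oscillation posCoeff_zero posCoeff_half, sum_oscillation momCoeff_zero momCoeff_half,
    sum_oscillation momCoeff_zero momCoeff_half, coordSymp, Finset.sum_const, Finset.card_univ,
    ZMod.card]
  simp only [nsmul_eq_mul]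
  field_simp
  ring

theorem fromModes_injective : Function.Injective (fromModes (N := N)) := by
  rw [← LinearMap.ker_eq_bot, LinearMap.ker_eq_bot']
  intro x hx
  -- Pairing `x` with its rotation by the standard complex structure gives the sum of squares of its
  -- coordinates.
  have h := symp_fromModes x ((-x.1.2, x.1.1), (-x.2.2, x.2.1))
  rw [hx, coordSymp, symp, symp] at h
  simp only [Prod.fst_zero, Prod.snd_zero, Pi.zero_apply, zero_mul, sub_self,
    Finset.sum_const_zero, Pi.neg_apply, mul_neg, sub_neg_eq_add] at h
  have h1 : 0 ≤ ∑ i, (x.2.1 i * x.2.1 i + x.2.2 i * x.2.2 i) :=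
    Finset.sum_nonneg fun i _ => add_nonneg (mul_self_nonneg _) (mul_self_nonneg _)
  have h2 : x.1.1 = 0 := by nlinarith
  have h3 : x.1.2 = 0 := by nlinarith
  have h4 : ∑ i, (x.2.1 i * x.2.1 i + x.2.2 i * x.2.2 i) = 0 := by
    nlinarith
  rw [Finset.sum_eq_zero_iff_of_nonneg fun i _ => add_nonneg (mul_self_nonneg _) (mul_self_nonneg _)] at h4
  refine Prod.ext (Prod.ext h2 h3) (Prod.ext (funext fun i => ?_) (funext fun i => ?_))
  · have := h4 i (Finset.mem_univ i)
    change x.2.1 i = 0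
    nlinarith [mul_self_nonneg (x.2.1 i), mul_self_nonneg (x.2.2 i)]
  · have := h4 i (Finset.mem_univ i)
    change x.2.2 i = 0
    nlinarith [mul_self_nonneg (x.2.1 i), mul_self_nonneg (x.2.2 i)]

/-- The linear canonical transformation to the normal modes. -/
noncomputable def modesEquiv : CoordSpace N ≃L[ℝ] PhaseSpace (ZMod N) :=
  (LinearMap.linearEquivOfInjective fromModes fromModes_injective (by
    have := NeZero.pos N
    simp only [Module.finrank_prod, Module.finrank_fintype_fun_eq_card, Module.finrank_self,
      Fintype.card_coe, Nat.card_Icc, ZMod.card]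
    omega)).toContinuousLinearEquiv

theorem modesEquiv_apply (x : CoordSpace N) : modesEquiv x =
    (fun n => x.1.1 + oscillation posCoeff x.2 n, fun n => x.1.2 / N + oscillation momCoeff x.2 n) :=
  rfl

theorem symp_modesEquiv (x y : CoordSpace N) :
    symp (modesEquiv x) (modesEquiv y) = coordSymp N x y := symp_fromModes x y

theorem centerOfMass_modesEquiv (x : CoordSpace N) :
    (centerOfMass N (modesEquiv x), N * meanMomentum N (modesEquiv x)) = x.1 := by
  have hN : (N : ℝ) ≠ 0 := by exact_mod_cast NeZero.ne N
  rw [centerOfMass, meanMomentum, modesEquiv_apply]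
  simp only [Finset.sum_add_distrib]
  rw [sum_oscillation posCoeff_zero posCoeff_half, sum_oscillation momCoeff_zero momCoeff_half,
    Finset.sum_const, Finset.sum_const, Finset.card_univ, ZMod.card, nsmul_eq_mul, nsmul_eq_mul]
  refine Prod.ext ?_ ?_
  · field_simp; simp
  · field_simp; simp

end Linear

/-! ### The FPU Hamiltonian in normal modes. -/

section NormalModes
open MvPolynomial
variable {N : ℕ} [NeZero N]

theorem aeval_cubicForm (z : ZMod (2 * N) → ℂ) (c : Triple N → ℂ) :
    aeval z (cubicForm c) = ∑ p, c p * (z p.1 * z p.2.1 * z p.2.2) := by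
  simp [cubicForm, map_sum]

theorem sum_pow_three {ι : Type*} [Fintype ι] (g : ι → ℂ) :
    (∑ j, g j) ^ 3 = ∑ p : ι × ι × ι, g p.1 * g p.2.1 * g p.2.2 := by
  have h : (∑ j, g j) ^ 2 = ∑ p : ι × ι, g p.1 * g p.2 := by
    rw [pow_two, Finset.sum_mul_sum, Fintype.sum_prod_type]
  rw [pow_succ', h, Finset.sum_mul_sum, Fintype.sum_prod_type]
  simp only [mul_assoc]

theorem sum_pow_four {ι : Type*} [Fintype ι] (g : ι → ℂ) :
    (∑ j, g j) ^ 4 = ∑ p : ι × ι × ι × ι, g p.1 * g p.2.1 * g p.2.2.1 * g p.2.2.2 := by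
  rw [pow_succ', sum_pow_three, Finset.sum_mul_sum, Fintype.sum_prod_type]
  simp only [mul_assoc]

theorem wave_elongCoeff (z : ZMod (2 * N) → ℂ) (n : ZMod N) :
    wave elongCoeff z n = ∑ j, (phase j * mode n j) * (rootSine j * z j) := by
  rw [wave]
  refine Fintype.sum_congr _ _ fun j => ?_
  rw [elongCoeff]
  ring

theorem sum_wave_pow_three (z : ZMod (2 * N) → ℂ) :
    ∑ n, wave elongCoeff z n ^ 3 = N * aeval z (cubicForm fun p => ((cubicCoeff p : ℝ) : ℂ)) := by
  simp only [wave_elongCoeff, sum_pow_three]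
  rw [aeval_cubicForm, Finset.sum_comm, Finset.mul_sum]
  refine Fintype.sum_congr _ _ fun p => ?_
  have h := sum_phase_mul_mode (p.1 + p.2.1 + p.2.2)
  rw [cubicCoeff]
  push_cast
  rw [show (N : ℂ) * (wind (p.1 + p.2.1 + p.2.2) * (rootSine p.1 * rootSine p.2.1 *
    rootSine p.2.2) * (z p.1 * z p.2.1 * z p.2.2)) = (N * wind (p.1 + p.2.1 + p.2.2)) *
    (rootSine p.1 * rootSine p.2.1 * rootSine p.2.2 * (z p.1 * z p.2.1 * z p.2.2)) by ring, ← h,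
    Finset.sum_mul]
  refine Fintype.sum_congr _ _ fun n => ?_
  simp only [phase_add, mode_add]
  ring

theorem sum_wave_pow_four (z : ZMod (2 * N) → ℂ) :
    ∑ n, wave elongCoeff z n ^ 4 =
      N * aeval z (quarticForm fun p => ((quarticCoeff p : ℝ) : ℂ)) := by
  simp only [wave_elongCoeff, sum_pow_four]
  rw [aeval_quarticForm, Finset.sum_comm, Finset.mul_sum]
  refine Fintype.sum_congr _ _ fun p => ?_
  have h := sum_phase_mul_mode (p.1 + p.2.1 + p.2.2.1 + p.2.2.2)
  rw [quarticCoeff]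
  push_cast
  rw [show (N : ℂ) * (wind (p.1 + p.2.1 + p.2.2.1 + p.2.2.2) * (rootSine p.1 * rootSine p.2.1 *
    rootSine p.2.2.1 * rootSine p.2.2.2) * (z p.1 * z p.2.1 * z p.2.2.1 * z p.2.2.2)) =
    (N * wind (p.1 + p.2.1 + p.2.2.1 + p.2.2.2)) * (rootSine p.1 * rootSine p.2.1 *
    rootSine p.2.2.1 * rootSine p.2.2.2 * (z p.1 * z p.2.1 * z p.2.2.1 * z p.2.2.2)) by ring, ← h,
    Finset.sum_mul]
  refine Fintype.sum_congr _ _ fun n => ?_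
  simp only [phase_add, mode_add]
  ring

/-- The kinetic and the elastic energy each contain products of the modes `j` and `-j + N`; they
have opposite signs because `phase` is odd under the shift by `N`. -/
theorem sum_wave_sq_add (z : ZMod (2 * N) → ℂ) :
    ∑ n, (wave momCoeff z n ^ 2 + wave elongCoeff z n ^ 2) = 2 * N * aeval z (quadratic N) := by
  simp only [pow_two]
  rw [Finset.sum_add_distrib, sum_wave_mul_wave, sum_wave_mul_wave, aeval_quadratic, ← mul_add,
    ← Finset.sum_add_distrib, mul_comm (2 : ℂ), mul_assoc (N : ℂ) 2,
    Finset.mul_sum Finset.univ _ (2 : ℂ)]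
  congr 1
  refine Fintype.sum_congr _ _ fun j => ?_
  simp only [momCoeff, elongCoeff, rootSine_neg, rootSine_add_half, phase_add, phase_half,
    ← rootSine_mul_self]
  have h : phase j * phase (-j) = 1 := by rw [← phase_add, add_neg_cancel, phase_zero]
  linear_combination (rootSine j * z j * (rootSine j * (z (-j) - z (-j + (N : ZMod (2 * N)))))) * h

/-- The elongations of the springs. -/
noncomputable def elongation (w : PhaseSpace (Mode N)) (n : ZMod N) : ℝ := oscillation elongCoeff w n

theorem elongation_eq (w : PhaseSpace (Mode N)) (n : ZMod N) :
    elongation w n = oscillation posCoeff w (n + 1) - oscillation posCoeff w n := by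
  rw [elongation, oscillation, oscillation, oscillation, ← sub_div, ← Complex.sub_re,
    wave_posCoeff_succ_sub]

theorem hamiltonian_modesEquiv (V : ℝ → ℝ) (Q P : ℝ) (w : PhaseSpace (Mode N)) :
    hamiltonian N V (modesEquiv ((Q, N * P), w)) = N * P ^ 2 / 2 +
      (1 / 2 * ∑ n, oscillation momCoeff w n ^ 2 + ∑ n, V (elongation w n)) := by
  have hN : (N : ℝ) ≠ 0 := by exact_mod_cast NeZero.ne N
  have e (n : ZMod N) : (N * P / N + oscillation momCoeff w n) ^ 2 =
      P ^ 2 + 2 * P * oscillation momCoeff w n + oscillation momCoeff w n ^ 2 := by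
    field_simp
    ring
  rw [hamiltonian, modesEquiv_apply]
  simp only [elongation_eq, add_sub_add_left_eq_sub, e, Finset.sum_add_distrib]
  rw [← Finset.mul_sum, sum_oscillation momCoeff_zero momCoeff_half, Finset.sum_const,
    Finset.card_univ, ZMod.card, nsmul_eq_mul]
  ring

/-- The oscillations carry a factor `1 / √N` and summation over the chain gives `N`, whence `α / 6 *
N / √N ^ 3 = α / (6 √N)` and `β / 24 * N / √N ^ 4 = β / (24 N)`. -/
theorem polynomial_hamiltonian (α β : ℝ) (w : PhaseSpace (Mode N)) :
    ((1 / 2 * ∑ n, oscillation momCoeff w n ^ 2 + ∑ n, (elongation w n ^ 2 / 2 +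
      α / 6 * elongation w n ^ 3 + β / 24 * elongation w n ^ 4) : ℝ) : ℂ) =
      aeval (amplitude w) (truncated (α / (6 * Real.sqrt N)) (β / (24 * N)) : Poly N) := by
  have hN : (N : ℂ) ≠ 0 := by exact_mod_cast NeZero.ne N
  have hs := sqrt_cast_ne_zero (N := N)
  have hs2 := sqrt_cast_sq (N := N)
  have h2 := sum_wave_sq_add (amplitude w)
  have h3 := sum_wave_pow_three (amplitude w)
  have h4 := sum_wave_pow_four (amplitude w)
  rw [Finset.sum_add_distrib] at h2
  have c3 (a : ℝ) : aeval (amplitude w) (cubicForm fun p => ((a * cubicCoeff p : ℝ) : ℂ)) =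
      a * aeval (amplitude w) (cubicForm fun p => ((cubicCoeff p : ℝ) : ℂ)) := by
    rw [aeval_cubicForm, aeval_cubicForm, Finset.mul_sum]
    push_cast
    simp only [mul_assoc]
  have c4 (a : ℝ) : aeval (amplitude w) (quarticForm fun p => ((a * quarticCoeff p : ℝ) : ℂ)) =
      a * aeval (amplitude w) (quarticForm fun p => ((quarticCoeff p : ℝ) : ℂ)) := by
    rw [aeval_quarticForm, aeval_quarticForm, Finset.mul_sum]
    push_cast
    simp only [mul_assoc]
  rw [truncated, map_add, map_add, c3, c4]
  push_cast
  simp only [elongation, ofReal_oscillation conj_momCoeff, ofReal_oscillation conj_elongCoeff,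
    div_pow, Finset.sum_add_distrib]
  rw [show ((Real.sqrt N : ℝ) : ℂ) ^ 3 = N * (Real.sqrt N : ℝ) by rw [← hs2]; ring,
    show ((Real.sqrt N : ℝ) : ℂ) ^ 4 = (N : ℂ) ^ 2 by rw [← hs2]; ring, hs2]
  simp only [← Finset.mul_sum, ← Finset.sum_div]
  rw [h3, h4, show ∑ n, wave momCoeff (amplitude w) n ^ 2 = 2 * N * aeval (amplitude w) (quadratic N)
    - ∑ n, wave elongCoeff (amplitude w) n ^ 2 by rw [← h2]; ring]
  field_simp
  ring

theorem abs_oscillation_le {c : ZMod (2 * N) → ℂ} : ∃ K, 0 ≤ K ∧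
    ∀ (w : PhaseSpace (Mode N)) (n : ZMod N), |oscillation c w n| ≤ K * ‖w‖ := by
  refine ⟨(∑ j, ‖c j‖ * 4) / Real.sqrt N, by positivity, fun w n => ?_⟩
  rw [oscillation, abs_div, abs_of_nonneg (Real.sqrt_nonneg _), div_mul_eq_mul_div]
  gcongr
  refine (Complex.abs_re_le_norm _).trans ?_
  rw [wave, Finset.sum_mul]
  refine (norm_sum_le _ _).trans (Finset.sum_le_sum fun j _ => ?_)
  have hm : ‖mode n j‖ = 1 := by rw [mode, ZMod.stdAddChar_apply, Circle.norm_coe]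
  rw [norm_mul, norm_mul, hm, mul_one, mul_assoc]
  gcongr
  exact norm_amplitude_le w j

end NormalModes

/-! ### The chart and the error estimate. -/

section Chart
open MvPolynomial Asymptotics Filter Topology
variable {N : ℕ} [NeZero N]

/-- The Taylor formula is used at order five, since its remainder is stated as a little-o; the fifth
order term is then moved into the bound. -/
theorem IsPotential.exists_bound {α β : ℝ} {V : ℝ → ℝ} (h : IsPotential α β V) :
    ∃ δ : ℝ, 0 < δ ∧ ∃ K : ℝ, 0 ≤ K ∧ ∀ x, |x| < δ →
      |V x - (x ^ 2 / 2 + α / 6 * x ^ 3 + β / 24 * x ^ 4)| ≤ K * |x| ^ 5 := by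
  have h1 : ContDiff ℝ (5 : ℕ) V := contDiff_infty.1 h.smooth 5
  have h2 := taylor_isLittleO_univ (x₀ := 0) h1
  have e (x : ℝ) : taylorWithinEval V 5 Set.univ 0 x =
      x ^ 2 / 2 + α / 6 * x ^ 3 + β / 24 * x ^ 4 + (iteratedDeriv 5 V 0 / 120) * x ^ 5 := by
    rw [taylor_within_apply]
    simp only [iteratedDerivWithin_univ, Finset.sum_range_succ, Finset.sum_range_zero,
      iteratedDeriv_zero, h.zero, h.first, h.second, h.third, h.fourth, Nat.factorial, sub_zero,
      smul_eq_mul]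
    push_cast
    ring
  have h3 := h2.bound (c := 1) one_pos
  rw [Metric.eventually_nhds_iff] at h3
  obtain ⟨δ, hδ, h4⟩ := h3
  refine ⟨δ, hδ, 1 + |iteratedDeriv 5 V 0 / 120|, by positivity, fun x hx => ?_⟩
  have h5 := h4 (y := x) (by simpa [Real.dist_eq] using hx)
  rw [e, sub_zero, Real.norm_eq_abs, Real.norm_eq_abs, abs_pow, one_mul] at h5
  have e2 : V x - (x ^ 2 / 2 + α / 6 * x ^ 3 + β / 24 * x ^ 4) =
      (V x - (x ^ 2 / 2 + α / 6 * x ^ 3 + β / 24 * x ^ 4 + iteratedDeriv 5 V 0 / 120 * x ^ 5)) +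
      iteratedDeriv 5 V 0 / 120 * x ^ 5 := by ring
  rw [e2, add_mul, one_mul]
  refine (abs_add_le _ _).trans (add_le_add h5 ?_)
  rw [abs_mul, abs_pow]

/-- The homeomorphism underlying a symplectic automorphism. -/
noncomputable def SympAut.homeomorph (T : SympAut N) : PhaseSpace (Mode N) ≃ₜ PhaseSpace (Mode N) where
  toEquiv := T.toEquiv
  continuous_toFun := T.contDiff.continuous
  continuous_invFun := T.contDiff_symm.continuous

/-- The canonical coordinates given by the normal modes followed by a symplectic automorphism. -/
noncomputable def SympAut.chart (T : SympAut N) :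
    OpenPartialHomeomorph (PhaseSpace (ZMod N)) (CoordSpace N) :=
  (modesEquiv.symm.toHomeomorph.trans
    ((Homeomorph.refl (ℝ × ℝ)).prodCongr T.homeomorph.symm)).toOpenPartialHomeomorph

theorem SympAut.chart_apply (T : SympAut N) (z : PhaseSpace (ZMod N)) :
    T.chart z = ((modesEquiv.symm z).1, T.toEquiv.symm (modesEquiv.symm z).2) := rfl

theorem SympAut.chart_symm_apply (T : SympAut N) (x : CoordSpace N) :
    T.chart.symm x = modesEquiv (x.1, T.toEquiv x.2) := rfl

theorem SympAut.fderiv_chart (T : SympAut N) (z a : PhaseSpace (ZMod N)) :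
    fderiv ℝ T.chart z a = ((modesEquiv.symm a).1,
      fderiv ℝ T.toEquiv.symm (modesEquiv.symm z).2 (modesEquiv.symm a).2) := by
  let L : PhaseSpace (ZMod N) →L[ℝ] CoordSpace N := (modesEquiv (N := N)).symm
  have h1 : HasFDerivAt L L z := L.hasFDerivAt
  have h2 : HasFDerivAt T.toEquiv.symm (fderiv ℝ T.toEquiv.symm (modesEquiv.symm z).2)
      (modesEquiv.symm z).2 :=
    (T.contDiff_symm.differentiable (by simp) _).hasFDerivAt
  have h3 := h1.fst.prodMk (h2.comp z h1.snd)
  have h4 : HasFDerivAt T.chart _ z := h3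
  rw [h4.fderiv]
  rfl

theorem SympAut.isCanonicalChart (T : SympAut N) : IsCanonicalChart N T.chart where
  analytic := by
    refine ContDiff.contDiffOn ?_
    change ContDiff ℝ ω fun z : PhaseSpace (ZMod N) =>
      ((modesEquiv.symm z).1, T.toEquiv.symm (modesEquiv.symm z).2)
    have h := modesEquiv.symm.contDiff (n := ω) (𝕜 := ℝ) (E := PhaseSpace (ZMod N))
      (F := CoordSpace N)
    exact (contDiff_fst.comp h).prodMk (T.contDiff_symm.comp (contDiff_snd.comp h))
  analytic_symm := by
    refine ContDiff.contDiffOn ?_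
    change ContDiff ℝ ω fun x : CoordSpace N => modesEquiv (x.1, T.toEquiv x.2)
    exact modesEquiv.contDiff.comp (contDiff_fst.prodMk (T.contDiff.comp contDiff_snd))
  symplectic z _ a b := by
    rw [T.fderiv_chart, T.fderiv_chart, coordSymp, T.symp_symm]
    have h := symp_modesEquiv (modesEquiv.symm a) (modesEquiv.symm b)
    rw [ContinuousLinearEquiv.apply_symm_apply, ContinuousLinearEquiv.apply_symm_apply] at h
    exact h.symm
  center z _ := by
    have h := centerOfMass_modesEquiv (modesEquiv.symm z)
    rw [ContinuousLinearEquiv.apply_symm_apply] at h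
    exact h.symm
  equilibrium Q P := by
    have hN : (N : ℝ) ≠ 0 := by exact_mod_cast NeZero.ne N
    have h : ((fun _ => Q, fun _ => P) : PhaseSpace (ZMod N)) = modesEquiv ((Q, N * P), 0) := by
      have h0 (c : ZMod (2 * N) → ℂ) (n : ZMod N) : oscillation c 0 n = 0 := by
        simpa using oscillation_smul c 0 0 n
      rw [modesEquiv_apply]
      simp only [h0, add_zero]
      rw [mul_div_cancel_left₀ _ hN]
    refine ⟨Set.mem_univ _, ?_⟩
    rw [h, T.chart_apply, ContinuousLinearEquiv.symm_apply_apply]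
    exact (Equiv.symm_apply_eq _).2 T.map_zero.symm

theorem SympAut.exists_bound (T : SympAut N) : ∃ δ : ℝ, 0 < δ ∧ ∃ K : ℝ, 0 ≤ K ∧ ∀ w, ‖w‖ < δ →
    ‖T.toEquiv w‖ ≤ K * ‖w‖ := by
  have h := (T.contDiff.differentiable (by simp) 0).isBigO_sub
  rw [T.map_zero] at h
  simp only [sub_zero] at h
  obtain ⟨K, hK, hb⟩ := h.exists_nonneg
  have hb' := hb.bound
  rw [Metric.eventually_nhds_iff] at hb'
  obtain ⟨δ, hδ, h4⟩ := hb'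
  exact ⟨δ, hδ, K, hK, fun w hw => h4 (by simpa using hw)⟩

theorem exists_hamiltonian_bound (hEven : Even N) {α β : ℝ} {T : SympAut N} {g : Poly N}
    (hg : g ∈ fil _ 5)
    (hT : ∀ w, aeval (amplitude (T.toEquiv w))
        (truncated (α / (6 * Real.sqrt N)) (β / (24 * N)) : Poly N) =
      aeval (amplitude w) (quadratic N + resonantForm (α / (6 * Real.sqrt N)) (β / (24 * N)) + g))
    {V : ℝ → ℝ} (hV : IsPotential α β V) :
    ∃ r : ℝ, 0 < r ∧ ∃ C : ℝ, ∀ (Q P : ℝ) (w : PhaseSpace (Mode N)), ‖w‖ < r →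
      |hamiltonian N V (T.chart.symm ((Q, N * P), w)) -
        (N * P ^ 2 / 2 + normalForm N α β (actionI w)
          - resonantTerm N α β (actionJ w) (actionM w))| ≤ C * ‖w‖ ^ 5 := by
  obtain ⟨δ, hδ, K, hK, hVb⟩ := hV.exists_bound
  obtain ⟨δ', hδ', K', hK', hTb⟩ := T.exists_bound
  obtain ⟨K'', hK'', hu⟩ := abs_oscillation_le (c := elongCoeff (N := N))
  obtain ⟨G, hG, hgb⟩ := aeval_bound hg
  have hden : 0 < K'' * K' + 1 := by positivity
  -- The radius `1 / 4` makes `ρ = 4 ‖w‖ ≤ 1` in `aeval_bound`; the last one keeps every elongation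
  -- below `δ`, with `+ 1` guarding against division by `0`. The constant adds the Taylor remainders
  -- of `N` springs to the bound for `g`.
  refine ⟨min δ' (min (1 / 4) (δ / (K'' * K' + 1))), by positivity,
    N * (K * (K'' * K') ^ 5) + G * 4 ^ 5, fun Q P w hw => ?_⟩
  rw [lt_min_iff, lt_min_iff] at hw
  obtain ⟨hw1, hw2, hw3⟩ := hw
  rw [lt_div_iff₀ hden] at hw3
  set u := elongation (T.toEquiv w) with hu_def
  have hub (n : ZMod N) : |u n| ≤ K'' * K' * ‖w‖ := by
    refine (hu _ n).trans ?_
    rw [mul_assoc]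
    exact mul_le_mul_of_nonneg_left (hTb w hw1) hK''
  have hrem (n : ZMod N) : |V (u n) - (u n ^ 2 / 2 + α / 6 * u n ^ 3 + β / 24 * u n ^ 4)| ≤
      K * (K'' * K') ^ 5 * ‖w‖ ^ 5 := by
    refine (hVb _ ?_).trans ?_
    · refine (hub n).trans_lt ?_
      nlinarith [norm_nonneg w]
    · rw [mul_assoc, ← mul_pow]
      have := hub n
      gcongr
  have hp := polynomial_hamiltonian α β (T.toEquiv w)
  rw [hT, map_add, aeval_normalForm hEven] at hp
  have hgw := hgb (amplitude w) (4 * ‖w‖) (by linarith) (norm_amplitude_le w) (by positivity)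
  rw [eq_sub_of_add_eq' hp.symm, ← Complex.ofReal_sub, Complex.norm_real, Real.norm_eq_abs] at hgw
  rw [T.chart_symm_apply, hamiltonian_modesEquiv]
  have e : N * P ^ 2 / 2 + (1 / 2 * ∑ n, oscillation momCoeff (T.toEquiv w) n ^ 2 +
        ∑ n, V (elongation (T.toEquiv w) n)) -
      (N * P ^ 2 / 2 + normalForm N α β (actionI w) - resonantTerm N α β (actionJ w) (actionM w)) =
      ∑ n, (V (u n) - (u n ^ 2 / 2 + α / 6 * u n ^ 3 + β / 24 * u n ^ 4)) +
      ((1 / 2 * ∑ n, oscillation momCoeff (T.toEquiv w) n ^ 2 + ∑ n, (u n ^ 2 / 2 +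
        α / 6 * u n ^ 3 + β / 24 * u n ^ 4)) - (normalForm N α β (actionI w) -
        resonantTerm N α β (actionJ w) (actionM w))) := by
    rw [Finset.sum_sub_distrib]
    ring
  rw [e]
  refine (abs_add_le _ _).trans ?_
  rw [add_mul]
  refine add_le_add ?_ ?_
  · refine (Finset.abs_sum_le_sum_abs _ _).trans ((Finset.sum_le_sum fun n _ => hrem n).trans ?_)
    rw [Finset.sum_const, Finset.card_univ, ZMod.card, nsmul_eq_mul, mul_assoc (N : ℝ)]
  · refine hgw.trans (le_of_eq ?_)
    rw [mul_pow, mul_assoc]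

end Chart
end FPU

theorem theorem3 (N : ℕ) [NeZero N] (hN : 4 ≤ N) (hEven : Even N) (α β : ℝ) :
    ∃ Φ : OpenPartialHomeomorph (FPU.PhaseSpace (ZMod N)) (FPU.CoordSpace N),
      FPU.IsCanonicalChart N Φ ∧
      ∀ V : ℝ → ℝ, FPU.IsPotential α β V →
        ∃ r : ℝ, 0 < r ∧ ∃ C : ℝ, ∀ (Q P : ℝ) (w : FPU.PhaseSpace (FPU.Mode N)), ‖w‖ < r →
          ((Q, N * P), w) ∈ Φ.target ∧
          |FPU.hamiltonian N V (Φ.symm ((Q, N * P), w)) -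
              (N * P ^ 2 / 2 + FPU.normalForm N α β (FPU.actionI w)
                - FPU.resonantTerm N α β (FPU.actionJ w) (FPU.actionM w))| ≤ C * ‖w‖ ^ 5 := by
  obtain ⟨T, g, hg, hT⟩ := FPU.exists_normalization (N := N) (α / (6 * Real.sqrt N)) (β / (24 * N))
  -- `T` is fixed before `V` is introduced, so the chart depends on `N`, `α`, `β` only; it is
  -- global, which makes membership in the target trivial.
  refine ⟨T.chart, T.isCanonicalChart, fun V hV => ?_⟩
  obtain ⟨r, hr, C, hC⟩ := FPU.exists_hamiltonian_bound hEven hg hT hV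
  exact ⟨r, hr, C, fun Q P w hw => ⟨Set.mem_univ _, hC Q P w hw⟩⟩
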